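/- Let $n\ge 1$ and $G=SE(n)$, with Lie algebra $\mathfrak g=\mathfrak{so}(n)\times\mathbb R^n$. Let $B_1,B_2\subset\mathbb R^n$ be two rigid bodies, that is, closed connected $n$-dimensional submanifolds with smooth boundary, not necessarily bounded. Let $B_j$ carry a finite mass distribution $\mu_j$, supported on $B_j$, of total mass $m_j$, with zero first moment, finite second moments and inertia matrix $L_j=\big(\tfrac1{m_j}\int b_rb_s\,d\mu_j\big)_{r,s}$; put $\mathcal L_j(Z)=L_jZ+ZL_j$. Let $M\subset G\times G$ be the closure of the set $M_0$ of all $(g_1,g_2)$ with $g_1(B_1)\cap g_2(B_2)=\emptyset$, and let $S=\partial M$ be its boundary in $G\times G$. Assume that $M$ is a smooth manifold with smooth boundary $S$ and that in every $q=(g_1,g_2)\in S$ the bodies touch in exactly one point $g_1(b_1)=g_2(b_2)$. Velocities at $q$ are left-translated to $\xi=((Z_1,z_1),(Z_2,z_2))\in\mathfrak g\times\mathfrak g$, and the kinetic energy metric is $$\langle\xi,\eta\rangle=\sum_j m_j\big[\tfrac12\operatorname{Tr}(\mathcal L_j(Z^\xi_j)(Z_j^\eta)^\dagger)+z^\xi_j\cdot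 z^\eta_j\big],$$ which is assumed to be positive definite. For $q\in S$, with $g_j=(A_j,a_j)$, let $\mathbf n_q$ be the unit normal to $S$ pointing into $M$, and let $\mathcal C_q:T_qM\to T_qM$ be a strict collision map: a linear map that sends $\{\langle v,\mathbf n_q\rangle\le 0\}$ into $\{\langle v,\mathbf n_q\rangle\ge 0\}$, is isometric, satisfies $\mathcal C_q^2=\mathrm{Id}$, preserves the total momentum $u\mapsto\langle v,\frac{d}{dt}|_{t=0}e^{tu}q\rangle$, $u\in\mathfrak g$, and for which every $\mathcal C_qv-v$ is of the form $\big((\mathcal L_j^{-1}(b_j\wedge u_j),u_j)\big)_{j=1,2}$ with $u_j\in\mathbb R^n$ and $m_1A_1u_1+m_2A_2u_2=0$, where $(a\wedge b)_{ij}=a_jb_i-a_ib_j$. Such a $\mathcal C_q$ preserves $T_qS$. Suppose that the field $q\mapsto\mathcal C_q$ is piecewise smooth on $S$ (it suffices that it is smooth on a relatively open dense subset of $S$) and that, where it is smooth, it is parallel on $S$: $\nabla_X(\mathcal C Y)=\mathcal C(\nabla_XY)$ for all vector fields $X,Y$ on $S$, where $\nabla$ is the Levi-Civita connection of the kinetic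 energy metric on $S$. Let $\mathcal E>0$ and $$N^{\mathcal E}\setminus TS=\{(q,v)\in TM:\ q\in S,\ \tfrac12\|v\|^2=\mathcal E,\ v\notin T_qS\}.$$ Let $\theta_{(q,v)}(X)=\langle v,d\pi X\rangle_q$, with $\pi:TM\to M$ the projection, let $d=\dim M=n(n+1)$, and let $\Omega=(d\theta)^{d-1}$ be the resulting form of top degree $2d-2$ on $N^{\mathcal E}\setminus TS$. The billiard map $T$ takes $(q,v)$ to $(q',\mathcal C_{q'}v')$, where $(q',v')$ is the state in which the force-free motion of the two bodies starting at $(q,v)$, after staying in $M_0$, first reaches $S$ again. The domain $D$ of $T$ consists of the $(q,v)\in N^{\mathcal E}\setminus TS$ for which such a $(q',v')$ exists, the field $\mathcal C$ is smooth near $q'$ on $S$, and $\mathcal C_{q'}v'\notin T_{q'}S$. Then $D$ is open in $N^{\mathcal E}\setminus TS$, $T$ maps $D$ differentiably into $N^{\mathcal E}\setminus TS$, and $\Omega$ is invariant under $T$ up to sign: $T^*\Omega=\varepsilon\,\Omega$ on $D$, with a locally constant function $\varepsilon:D\to\{1,-1\}$. -/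

import Mathlib

open Set Filter Topology MeasureTheory
open scoped ContDiff

namespace RoughBilliards

noncomputable section

/-- The ambient Euclidean space `ℝⁿ`. -/
abbrev Pt (n : ℕ) : Type := EuclideanSpace ℝ (Fin n)

/-- Real `n × n` matrices, regarded as linear operators on `ℝⁿ`: the product `*` is composition and
the transpose is the adjoint. -/
abbrev Mat (n : ℕ) : Type := Pt n →L[ℝ] Pt n

/-- The transpose. -/
abbrev tr {n : ℕ} (A : Mat n) : Mat n := ContinuousLinearMap.adjoint A

/-- The vector space in which `SE(n) × SE(n)`, its tangent spaces and its Lie algebra all lie: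
pairs, indexed by the two bodies, of elements `(A, a)` with `A` a matrix and `a` a vector. -/
abbrev Conf (n : ℕ) : Type := Fin 2 → Mat n × Pt n

/-- The group `SE(n) × SE(n)`, as a subset of `Conf n`. -/
def SE2 (n : ℕ) : Set (Conf n) :=
  {q | ∀ j, tr (q j).1 * (q j).1 = 1 ∧ (q j).1.det = 1}

/-- The Lie algebra `𝔤 × 𝔤` of `SE(n) × SE(n)`, where `𝔤 = 𝔰𝔢(n) = 𝔰𝔬(n) × ℝⁿ`. -/
def lieAlg (n : ℕ) : Submodule ℝ (Conf n) where
  carrier := {ξ | ∀ j, tr (ξ j).1 = -(ξ j).1}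
  add_mem' := by
    intro a b ha hb j
    have h1 := ha j
    have h2 := hb j
    simp only [Pi.add_apply, Prod.fst_add, tr, map_add] at h1 h2 ⊢
    rw [h1, h2]
    abel
  zero_mem' := by
    intro j
    simp
  smul_mem' := by
    intro c a ha j
    have h1 := ha j
    simp only [Pi.smul_apply, Prod.smul_fst, tr, map_smulₛₗ] at h1 ⊢
    rw [h1]
    simp

/-- The vector space in which the states `(q, ξ)` lie: a configuration `q` together with a velocity,
the latter being left-translated to `𝔤 × 𝔤`.  The tangent bundle of `SE(n) × SE(n)` is the subset
given by `q ∈ SE2 n` and `ξ ∈ lieAlg n`. -/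
abbrev State (n : ℕ) : Type := Conf n × Conf n

/-- Position `g(b) = A b + a` of the material point `b` in the configuration `g = (A, a)`. -/
def place {n : ℕ} (g : Mat n × Pt n) (b : Pt n) : Pt n := g.1 b + g.2

/-- Differential at the identity of the left translation by `q`: `(Z, z) ↦ (A Z, A z)`. -/
def translate {n : ℕ} (q ξ : Conf n) : Conf n :=
  fun j => ((q j).1 * (ξ j).1, (q j).1 (ξ j).2)

/-- Inverse of `translate q` for `q ∈ SE2 n` (where `A⁻¹ = Aᵀ`): left translation of a tangent
vector at `q` to the Lie algebra. -/
def untranslate {n : ℕ} (q X : Conf n) : Conf n :=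
  fun j => (tr (q j).1 * (X j).1, tr (q j).1 (X j).2)

/-- The matrix `a ∧ b` with entries `(a ∧ b)_{ij} = a_j b_i - a_i b_j`. -/
def wedge {n : ℕ} (a b : Pt n) : Mat n :=
  Matrix.toEuclideanCLM (n := Fin n) (𝕜 := ℝ) (Matrix.of fun i j => a j * b i - a i * b j)

/-! ### Mass distributions and the kinetic energy metric -/

/-- Total mass. -/
def mass {n : ℕ} (μ : Measure (Pt n)) : ℝ := μ.real univ

/-- The inertia matrix, with entries `m⁻¹ ∫ b_r b_s dμ(b)`. -/
def inertia {n : ℕ} (μ : Measure (Pt n)) : Mat n :=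
  Matrix.toEuclideanCLM (n := Fin n) (𝕜 := ℝ)
    (Matrix.of fun r s => (mass μ)⁻¹ * ∫ b, b r * b s ∂μ)

/-- The map `Z ↦ L Z + Z L`. -/
def inertiaMap {n : ℕ} (μ : Measure (Pt n)) (Z : Mat n) : Mat n :=
  inertia μ * Z + Z * inertia μ

/-- The kinetic energy form of one body, on left-translated velocities `(Z, z)`. -/
def bodyForm {n : ℕ} (μ : Measure (Pt n)) (u v : Mat n × Pt n) : ℝ :=
  mass μ * (1 / 2 * LinearMap.trace ℝ (Pt n) (inertiaMap μ u.1 * tr v.1 : Mat n) + inner ℝ u.2 v.2)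

/-- A rigid body in reference configuration: a closed connected `n`-dimensional submanifold of `ℝⁿ`
with smooth boundary, not necessarily bounded, with a finite mass distribution supported on it that
has finite second moments, centre of mass at the origin, and positive definite kinetic energy. -/
structure RigidBody (n : ℕ) where
  carrier : Set (Pt n)
  isClosed_carrier : IsClosed carrier
  isConnected_carrier : IsConnected carrier
  smooth_boundary : ∀ b ∈ frontier carrier, ∃ f : Pt n → ℝ, ∃ U : Set (Pt n),
    IsOpen U ∧ b ∈ U ∧ ContDiffOn ℝ ∞ f U ∧ fderiv ℝ f b ≠ 0 ∧ carrier ∩ U = {x ∈ U | f x ≤ 0}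
  μ : Measure (Pt n)
  finite_μ : IsFiniteMeasure μ
  supported_μ : μ carrierᶜ = 0
  second_moment : Integrable (fun b => ‖b‖ ^ 2) μ
  first_moment : ∀ i, ∫ b, b i ∂μ = 0
  form_pos : ∀ u : Mat n × Pt n, tr u.1 = -u.1 → u ≠ 0 → 0 < bodyForm μ u u

variable {n : ℕ}

/-- The kinetic energy metric of the two-body system, on left-translated velocities. -/
def kin (B : Fin 2 → RigidBody n) (u v : Conf n) : ℝ :=
  ∑ j, bodyForm (B j).μ (u j) (v j)

/-! ### The configuration manifold and its boundary -/

/-- Interior configurations: the two bodies are disjoint. -/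
def interiorConf (B : Fin 2 → RigidBody n) : Set (Conf n) :=
  {q ∈ SE2 n | Disjoint (place (q 0) '' (B 0).carrier) (place (q 1) '' (B 1).carrier)}

/-- The configuration space `M`: the closure of the set of interior configurations. -/
def confSpace (B : Fin 2 → RigidBody n) : Set (Conf n) := closure (interiorConf B)

/-- The boundary `S = ∂M` of the configuration space, relative to `SE(n) × SE(n)`. -/
def bdry (B : Fin 2 → RigidBody n) : Set (Conf n) :=
  confSpace B ∩ closure (SE2 n \ confSpace B)

/-- `M` is a smooth manifold with smooth boundary: near each boundary point it is given in
`SE(n) × SE(n)` by an inequality `f ≥ 0`, with `f` smooth and `df ≠ 0` on the tangent space. -/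
def HasSmoothBdry (B : Fin 2 → RigidBody n) : Prop :=
  ∀ q ∈ bdry B, ∃ f : Conf n → ℝ, ∃ U : Set (Conf n),
    IsOpen U ∧ q ∈ U ∧ ContDiffOn ℝ ∞ f U ∧
    (∃ ξ ∈ lieAlg n, fderiv ℝ f q (translate q ξ) ≠ 0) ∧
    confSpace B ∩ U = {p ∈ SE2 n ∩ U | 0 ≤ f p}

/-- In each boundary configuration the bodies are in contact at exactly one point. -/
def HasUniqueContact (B : Fin 2 → RigidBody n) : Prop :=
  ∀ q ∈ bdry B, ∃! x : Pt n, ∀ j, x ∈ place (q j) '' (B j).carrier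

/-- Tangent vectors to an embedded submanifold `s` of a normed space at `x`: velocities at time `0`
of smooth curves through `x` that stay in `s`. -/
def tangentVectors {F : Type*} [NormedAddCommGroup F] [NormedSpace ℝ F] (s : Set F) (x : F) :
    Set F :=
  {X | ∃ c : ℝ → F, ContDiffAt ℝ ∞ c 0 ∧ c 0 = x ∧ (∀ᶠ t in 𝓝 0, c t ∈ s) ∧ HasDerivAt c X 0}

/-- The tangent space `T_q S`, left-translated to `𝔤 × 𝔤`. -/
def bdryTangent (B : Fin 2 → RigidBody n) (q : Conf n) : Set (Conf n) :=
  {ξ ∈ lieAlg n | translate q ξ ∈ tangentVectors (bdry B) q}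

/-- `ν` is the unit normal vector to `S` at `q` pointing into `M` (left-translated). -/
structure IsInwardNormal (B : Fin 2 → RigidBody n) (q : Conf n) (ν : Conf n) : Prop where
  mem : ν ∈ lieAlg n
  unit : kin B ν ν = 1
  orthogonal : ∀ ξ ∈ bdryTangent B q, kin B ν ξ = 0
  inward : ∃ c : ℝ → Conf n, ContDiffAt ℝ ∞ c 0 ∧ c 0 = q ∧ HasDerivAt c (translate q ν) 0 ∧
    ∀ᶠ t in 𝓝[≥] 0, c t ∈ confSpace B

/-! ### Momentum, impulses and collision maps -/

/-- Momentum `𝒫_j(q, ξ)(w)` of body `j` in the state `(q, ξ)`, for `w = (W, w) ∈ 𝔤`: the inner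
product of its velocity with the vector `(d/dt) e^{tw} g_j = (W A_j, W a_j + w)` of the
infinitesimal action, which is left-translated here by multiplication with `A_jᵀ`. -/
def momentum (B : Fin 2 → RigidBody n) (j : Fin 2) (q ξ : Conf n) (w : Mat n × Pt n) : ℝ :=
  bodyForm (B j).μ (ξ j)
    (tr (q j).1 * (w.1 * (q j).1), tr (q j).1 (w.1 (q j).2 + w.2))

/-- `b` is the pair of contact points, in the reference bodies, of the configuration `q`. -/
def IsContactPair (B : Fin 2 → RigidBody n) (q : Conf n) (b : Fin 2 → Pt n) : Prop :=
  (∀ j, b j ∈ (B j).carrier) ∧ place (q 0) (b 0) = place (q 1) (b 1)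

/-- The impulse subspace at `q` for the contact points `b`: the vectors
`((ℒ₁⁻¹(b₁ ∧ u₁), u₁), (ℒ₂⁻¹(b₂ ∧ u₂), u₂))` with `m₁ A₁ u₁ + m₂ A₂ u₂ = 0`. -/
def impulseSpace (B : Fin 2 → RigidBody n) (q : Conf n) (b : Fin 2 → Pt n) : Set (Conf n) :=
  {ξ ∈ lieAlg n | (∀ j, inertiaMap (B j).μ (ξ j).1 = wedge (b j) (ξ j).2) ∧
    ∑ j, mass (B j).μ • (q j).1 (ξ j).2 = 0}

/-- `C` is (the linear extension of) a strict collision map at `q`; only the restriction of `C` to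
`𝔤 × 𝔤 ≅ T_q M` matters. -/
structure IsStrictCollisionMap (B : Fin 2 → RigidBody n) (q : Conf n)
    (C : Conf n →ₗ[ℝ] Conf n) : Prop where
  mapsTo : ∀ v ∈ lieAlg n, C v ∈ lieAlg n
  mapsTo_halfSpace : ∀ ν, IsInwardNormal B q ν → ∀ v ∈ lieAlg n, kin B v ν ≤ 0 → 0 ≤ kin B (C v) ν
  conserves_energy : ∀ u ∈ lieAlg n, ∀ v ∈ lieAlg n, kin B (C v) (C u) = kin B v u
  conserves_momentum : ∀ v ∈ lieAlg n, ∀ w : Mat n × Pt n, tr w.1 = -w.1 →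
    ∑ j, momentum B j q (C v) w = ∑ j, momentum B j q v w
  involutive : ∀ v ∈ lieAlg n, C (C v) = v
  impulse : ∀ v ∈ lieAlg n, ∀ b, IsContactPair B q b → C v - v ∈ impulseSpace B q b

/-! ### Smoothness and parallelism of a field of collision maps -/

/-- The points of `S` near which the field `q ↦ C_q` is smooth on `S`. -/
def smoothLocus (B : Fin 2 → RigidBody n) (C : Conf n → Conf n →ₗ[ℝ] Conf n) :
    Set (Conf n) :=
  {q ∈ bdry B | ∃ U ∈ 𝓝 q, ∀ ξ ∈ lieAlg n, ContDiffOn ℝ ∞ (fun p => C p ξ) (bdry B ∩ U)}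

/-- Piecewise smoothness, in the weak sense that the field is smooth on a (relatively open) dense
subset of `S`, the union of the interiors of the smooth pieces. -/
def IsPiecewiseSmooth (B : Fin 2 → RigidBody n) (C : Conf n → Conf n →ₗ[ℝ] Conf n) : Prop :=
  bdry B ⊆ closure (smoothLocus B C)

/-- A smooth vector field on `S` near `q`, in left-translated form, extended smoothly to a
neighbourhood of `q` in `Conf n`. -/
def IsTangentField (B : Fin 2 → RigidBody n) (q : Conf n) (X : Conf n → Conf n) : Prop :=
  ContDiffAt ℝ ∞ X q ∧ ∀ᶠ p in 𝓝[bdry B] q, X p ∈ bdryTangent B p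

/-- The vector field `p ↦ dL_p X(p)` on `Conf n` that `X` represents. -/
def ambientField (X : Conf n → Conf n) (p : Conf n) : Conf n := translate p (X p)

/-- The directional derivative of `⟨Y, Z⟩` along `X`, at `q`. -/
def derivInner (B : Fin 2 → RigidBody n) (X Y Z : Conf n → Conf n) (q : Conf n) : ℝ :=
  fderiv ℝ (fun p => kin B (Y p) (Z p)) q (ambientField X q)

/-- The inner product `⟨[X, Y], Z⟩` at `q`. -/
def innerBracket (B : Fin 2 → RigidBody n) (X Y Z : Conf n → Conf n) (q : Conf n) : ℝ :=
  kin B (untranslate q (VectorField.lieBracket ℝ (ambientField X) (ambientField Y) q)) (Z q)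

/-- `w = (∇_X Y)_q` for the Levi-Civita connection `∇` of the kinetic energy metric on `S`, defined
by the Koszul formula. -/
def IsCovDeriv (B : Fin 2 → RigidBody n) (X Y : Conf n → Conf n) (q : Conf n)
    (w : Conf n) : Prop :=
  w ∈ bdryTangent B q ∧ ∀ Z, IsTangentField B q Z →
    2 * kin B w (Z q) =
      derivInner B X Y Z q + derivInner B Y X Z q - derivInner B Z X Y q
        + innerBracket B X Y Z q - innerBracket B X Z Y q - innerBracket B Y Z X q

/-- `∇C = 0` at `q`: for all vector fields `X`, `Y` on `S` near `q`, `∇_X(CY) = C(∇_X Y)` at `q`.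
(A strict collision map preserves `T_q S`, so `CY` is again a vector field on `S`.) -/
def IsParallelAt (B : Fin 2 → RigidBody n) (C : Conf n → Conf n →ₗ[ℝ] Conf n)
    (q : Conf n) : Prop :=
  ∀ X Y Y' : Conf n → Conf n, IsTangentField B q X → IsTangentField B q Y →
    IsTangentField B q Y' → (∀ᶠ p in 𝓝[bdry B] q, Y' p = C p (Y p)) →
    ∀ w w', IsCovDeriv B X Y q w → IsCovDeriv B X Y' q w' → w' = C q w

/-! ### The billiard map -/

/-- The states in `N^𝓔 ∖ TS`: base point on `S`, kinetic energy `𝓔`, velocity not tangent to `S`. -/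
def phaseSpace (B : Fin 2 → RigidBody n) (𝓔 : ℝ) : Set (State n) :=
  {x | x.1 ∈ bdry B ∧ x.2 ∈ lieAlg n ∧ 1 / 2 * kin B x.2 x.2 = 𝓔 ∧ x.2 ∉ bdryTangent B x.1}

/-- `c` is a force-free motion of the two bodies on the time interval `[0, τ]`: the configuration
moves with the given velocity, and Newton's law `(d/dt) 𝒫_j = 0` holds for each body. -/
def IsFreeMotion (B : Fin 2 → RigidBody n) (c : ℝ → State n) (τ : ℝ) : Prop :=
  ∀ t ∈ Icc 0 τ, (c t).1 ∈ SE2 n ∧ (c t).2 ∈ lieAlg n ∧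
    HasDerivWithinAt (fun s => (c s).1) (translate (c t).1 (c t).2) (Icc 0 τ) t ∧
    ∀ (j : Fin 2) (w : Mat n × Pt n), tr w.1 = -w.1 →
      HasDerivWithinAt (fun s => momentum B j (c s).1 (c s).2 w) 0 (Icc 0 τ) t

/-- Starting from the state `x`, the next collision happens with pre-collision state `y`. -/
def IsNextCollision (B : Fin 2 → RigidBody n) (x y : State n) : Prop :=
  ∃ τ > 0, ∃ c : ℝ → State n, IsFreeMotion B c τ ∧ c 0 = x ∧ c τ = y ∧
    (∀ t ∈ Ioo 0 τ, (c t).1 ∈ interiorConf B) ∧ y.1 ∈ bdry B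

/-- The map induced by the field of collision maps on states. -/
def collide (C : Conf n → Conf n →ₗ[ℝ] Conf n) (y : State n) : State n := (y.1, C y.1 y.2)

/-- The billiard map: from a post-collision state to the next post-collision state (with an
arbitrary value where there is no next collision). -/
def billiardMap (B : Fin 2 → RigidBody n) (C : Conf n → Conf n →ₗ[ℝ] Conf n)
    (x : State n) : State n :=
  Classical.epsilon fun z => ∃ y, IsNextCollision B x y ∧ z = collide C y

/-- The domain of the billiard map on `N^𝓔 ∖ TS`: there is a next collision, it takes place at a
smooth point of the field of collision maps, and it is not grazing. -/
def billiardDomain (B : Fin 2 → RigidBody n) (C : Conf n → Conf n →ₗ[ℝ] Conf n) (𝓔 : ℝ) :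
    Set (State n) :=
  {x ∈ phaseSpace B 𝓔 | ∃ y, IsNextCollision B x y ∧ y.1 ∈ smoothLocus B C ∧
    collide C y ∈ phaseSpace B 𝓔}

/-! ### The contact form and the top form -/

theorem bodyForm_add_right (μ : Measure (Pt n)) (u v w : Mat n × Pt n) :
    bodyForm μ u (v + w) = bodyForm μ u v + bodyForm μ u w := by
  simp only [bodyForm, Prod.fst_add, Prod.snd_add, tr, map_add, mul_add, inner_add_right,
    ContinuousLinearMap.toLinearMap_add]
  ring

theorem bodyForm_smul_right (μ : Measure (Pt n)) (a : ℝ) (u v : Mat n × Pt n) :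
    bodyForm μ u (a • v) = a * bodyForm μ u v := by
  have h : inertiaMap μ u.1 * tr (a • v.1) = a • (inertiaMap μ u.1 * tr v.1) := by
    ext1 x
    simp [tr]
  simp only [bodyForm, Prod.smul_fst, Prod.smul_snd]
  rw [h, inner_smul_right, ContinuousLinearMap.toLinearMap_smul, map_smul, smul_eq_mul]
  ring

/-- The contact form `θ_{(q,v)}(X) = ⟨v, dπ X⟩_q`, as a one-form on the vector space `State n`; the
contact form on `TM`, and on its submanifolds, is its restriction. -/
def contactForm (B : Fin 2 → RigidBody n) (x : State n) : State n →L[ℝ] ℝ :=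
  LinearMap.toContinuousLinearMap
    { toFun := fun X => kin B x.2 (untranslate x.1 X.1)
      map_add' := by
        intro X Y
        simp only [kin, ← Finset.sum_add_distrib, ← bodyForm_add_right]
        refine Finset.sum_congr rfl fun j _ => ?_
        congr 1
        simp [untranslate, mul_add]
      map_smul' := by
        intro a X
        simp only [kin, RingHom.id_apply, smul_eq_mul, Finset.mul_sum, ← bodyForm_smul_right]
        refine Finset.sum_congr rfl fun j _ => ?_
        congr 1
        refine Prod.ext ?_ ?_
        · ext1 y
          simp [untranslate]
        · simp [untranslate] }

/-- The two-form `dθ`. -/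
def symplecticForm (B : Fin 2 → RigidBody n) (x X Y : State n) : ℝ :=
  extDeriv (fun y => ContinuousAlternatingMap.ofSubsingleton ℝ (State n) ℝ (0 : Fin 1)
    (contactForm B y)) x ![X, Y]

/-- The `k`-fold exterior power `α ∧ ⋯ ∧ α` of an alternating two-form `α`. -/
def wedgePower {F : Type*} (α : F → F → ℝ) (k : ℕ) (X : Fin (2 * k) → F) : ℝ :=
  (1 / 2 ^ k) * ∑ σ : Equiv.Perm (Fin (2 * k)), ((Equiv.Perm.sign σ : ℤ) : ℝ) *
    ∏ i : Fin k, α (X (σ ⟨2 * i, by omega⟩)) (X (σ ⟨2 * i + 1, by omega⟩))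

/-- The dimension `2 dim SE(n) = n (n + 1)` of the configuration manifold. -/
def dimConf (n : ℕ) : ℕ := n * (n + 1)

/-- The form `Ω = (dθ)^{d-1}`, `d = dim M`, of top degree `2d - 2` on `N^𝓔 ∖ TS`. -/
def topForm (B : Fin 2 → RigidBody n) (x : State n) (X : Fin (2 * (dimConf n - 1)) → State n) : ℝ :=
  wedgePower (symplecticForm B x) (dimConf n - 1) X

end

end RoughBilliards

open RoughBilliards

/-! The billiard map is the free flight from one contact to the next, followed by the collision v ↦
C_q v. The form Ω is followed through both factors.

Free flight. In left-translated velocities the force-free motion is the Euler–Arnold equation ⟨ξ',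
σ⟩ = ⟨ξ, [ξ, σ]⟩ together with q' = qξ, a quadratic differential equation on the vector space of
states. The flight time depends on the initial state, so a variation of the flight has an extra
component along the flow. Its pairing with another variation is a multiple of that variation's
change of energy, which is zero on the energy surface. Hence dθ is preserved there
(`IsVariation.symplecticForm_eq`). The flight is defined and differentiable near a given state by
the implicit function theorem, used in the space of paths for the flow (`exists_flow`) and then for
the hitting time (`exists_hitting`). Nearby flights have no earlier contact: near their two ends
transversality fixes the sign of a defining function of S, and in between M₀ is relatively open and
the time interval compact (`IsNextCollision.exists_hasFDerivAt`).

Collision. Tangent vectors of the energy surface over S split into E × F, with E = T_qS for the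
position and F = v^⊥ for the velocity, both of dimension d - 1. Since dθ vanishes on F, every
nonzero term of (dθ)^{d-1} on a basis adapted to E × F pairs one vector of E with one of F, so only
the pairing between E and F matters (`wedgePower_eq_det_mul`). The derivative of q ↦ C_q changes dθ
only on pairs from E and drops out. An isometric involution is self-adjoint, so C can be moved from
F to E in the pairing, and Ω is multiplied by the determinant of C on T_qS (`wedgePower_collide`).
The half-space condition forces Cν = -ν, so this factor is -det C. It is ±1 because C is an
involution, and locally constant because C is continuous where the field is smooth. -/

namespace RoughBilliards

noncomputable section

/-! ### Smooth dependence on initial data for quadratic differential equations -/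

section QuadraticODE

variable {E : Type*} [NormedAddCommGroup E]

/-- A path on the unit interval, extended to the line by constants. -/
abbrev extendPath (f : C(Icc (0 : ℝ) 1, E)) : ℝ → E := IccExtend zero_le_one f

theorem continuous_extendPath (f : C(Icc (0 : ℝ) 1, E)) : Continuous (extendPath f) :=
  f.continuous.Icc_extend'

theorem norm_extendPath_le (f : C(Icc (0 : ℝ) 1, E)) (u : ℝ) : ‖extendPath f u‖ ≤ ‖f‖ :=
  f.norm_coe_le_norm _

theorem extendPath_of_mem (f : C(Icc (0 : ℝ) 1, E)) {s : ℝ} (hs : s ∈ Icc (0 : ℝ) 1) :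
    extendPath f s = f ⟨s, hs⟩ := IccExtend_of_mem _ _ hs

variable [NormedSpace ℝ E]

/-- The primitive vanishing at `0`, as an operator on paths. -/
def primitive : C(Icc (0 : ℝ) 1, E) →L[ℝ] C(Icc (0 : ℝ) 1, E) :=
  LinearMap.mkContinuous
    { toFun := fun f => ⟨fun s => ∫ u in (0 : ℝ)..s, extendPath f u,
        (intervalIntegral.continuous_primitive
          (fun a b => (continuous_extendPath f).intervalIntegrable a b) 0).comp
          continuous_subtype_val⟩
      map_add' := by
        intro f g
        ext s
        simp only [ContinuousMap.coe_mk, ContinuousMap.add_apply]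
        rw [← intervalIntegral.integral_add ((continuous_extendPath f).intervalIntegrable _ _)
          ((continuous_extendPath g).intervalIntegrable _ _)]
        rfl
      map_smul' := by
        intro a f
        ext s
        simp only [ContinuousMap.coe_mk, ContinuousMap.smul_apply, RingHom.id_apply]
        rw [← intervalIntegral.integral_smul]
        rfl }
    1 (by
      intro f
      rw [one_mul, ContinuousMap.norm_le _ (norm_nonneg _)]
      intro s
      have h := intervalIntegral.norm_integral_le_of_norm_le_const (a := 0) (b := (s : ℝ))
        (f := extendPath f) (C := ‖f‖) (fun u _ => norm_extendPath_le f u)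
      refine h.trans ?_
      rw [sub_zero, abs_of_nonneg s.2.1]
      exact mul_le_of_le_one_right (norm_nonneg _) s.2.2)

theorem primitive_apply (f : C(Icc (0 : ℝ) 1, E)) (s : Icc (0 : ℝ) 1) :
    primitive f s = ∫ u in (0 : ℝ)..s, extendPath f u := rfl

theorem primitive_zero_left (f : C(Icc (0 : ℝ) 1, E)) :
    primitive f ⟨0, left_mem_Icc.2 zero_le_one⟩ = 0 := by
  simp [primitive_apply]

theorem hasDerivWithinAt_primitive [CompleteSpace E] (f : C(Icc (0 : ℝ) 1, E)) {s : ℝ}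
    (hs : s ∈ Icc (0 : ℝ) 1) :
    HasDerivWithinAt (extendPath (primitive f)) (extendPath f s) (Icc 0 1) s := by
  have h := (continuous_extendPath f).integral_hasStrictDerivAt 0 s
  refine h.hasDerivAt.hasDerivWithinAt.congr (fun u hu => ?_) ?_
  · rw [extendPath_of_mem _ hu, primitive_apply]
  · rw [extendPath_of_mem _ hs, primitive_apply]

/-- The operator that applies a bilinear map pointwise to a pair of paths. -/
def pointwise (β : E →L[ℝ] E →L[ℝ] E) :
    C(Icc (0 : ℝ) 1, E) →L[ℝ] C(Icc (0 : ℝ) 1, E) →L[ℝ] C(Icc (0 : ℝ) 1, E) :=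
  LinearMap.mkContinuous₂
    (LinearMap.mk₂ ℝ (fun c h => ⟨fun s => β (c s) (h s), by fun_prop⟩)
      (by intros; ext; simp) (by intros; ext; simp) (by intros; ext; simp) (by intros; ext; simp))
    ‖β‖ (by
      intro c h
      rw [ContinuousMap.norm_le _ (by positivity)]
      intro s
      exact (β.le_opNorm₂ _ _).trans (by gcongr <;> exact ContinuousMap.norm_coe_le_norm _ _))

/-- A Volterra operator is quasi-nilpotent. -/
theorem isUnit_one_sub_primitive_comp [CompleteSpace E]
    (A : C(Icc (0 : ℝ) 1, E) →L[ℝ] C(Icc (0 : ℝ) 1, E)) {M : ℝ} (hM : 0 ≤ M)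
    (hA : ∀ f s, ‖A f s‖ ≤ M * ‖f s‖) : IsUnit (1 - primitive ∘L A) := by
  set K := primitive ∘L A with hK
  -- Each iteration integrates the bound once more in s, which produces the factor 1/n!.
  have key : ∀ (n : ℕ) (f : C(Icc (0 : ℝ) 1, E)) (s : Icc (0 : ℝ) 1),
      ‖(K ^ n) f s‖ ≤ M ^ n * (s : ℝ) ^ n / n.factorial * ‖f‖ := by
    intro n f
    induction n with
    | zero => intro s; simpa using f.norm_coe_le_norm s
    | succ n ih =>
      intro s
      have h1 : (K ^ (n + 1)) f s = ∫ u in (0 : ℝ)..s, extendPath (A ((K ^ n) f)) u := by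
        rw [pow_succ']
        rfl
      rw [h1]
      have h2 : ‖∫ u in (0 : ℝ)..s, extendPath (A ((K ^ n) f)) u‖ ≤
          ∫ u in (0 : ℝ)..s, M * (M ^ n * u ^ n / n.factorial * ‖f‖) := by
        refine intervalIntegral.norm_integral_le_of_norm_le s.2.1 (ae_of_all _ fun u hu => ?_)
          (by apply Continuous.intervalIntegrable; fun_prop)
        have hu' : u ∈ Icc (0 : ℝ) 1 := ⟨hu.1.le, hu.2.trans s.2.2⟩
        rw [extendPath_of_mem _ hu']
        exact (hA _ _).trans (mul_le_mul_of_nonneg_left (ih ⟨u, hu'⟩) hM)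
      refine h2.trans (le_of_eq ?_)
      have h3 : (fun u : ℝ => M * (M ^ n * u ^ n / n.factorial * ‖f‖)) =
          fun u => (M ^ (n + 1) / n.factorial * ‖f‖) * u ^ n := by
        funext u
        ring
      rw [h3, intervalIntegral.integral_const_mul, integral_pow, Nat.factorial_succ]
      have : (n.factorial : ℝ) ≠ 0 := by positivity
      have : (n : ℝ) + 1 ≠ 0 := by positivity
      push_cast
      field_simp
      simp
  obtain ⟨n, hn⟩ : ∃ n : ℕ, M ^ n / n.factorial < 1 :=
    ((FloorSemiring.tendsto_pow_div_factorial_atTop M).eventually_lt_const one_pos).exists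
  have hnorm : ‖K ^ n‖ < 1 := by
    refine lt_of_le_of_lt (ContinuousLinearMap.opNorm_le_bound _ (by positivity) fun f => ?_) hn
    rw [ContinuousMap.norm_le _ (by positivity)]
    intro s
    refine (key n f s).trans ?_
    have : (s : ℝ) ^ n ≤ 1 := pow_le_one₀ s.2.1 s.2.2
    gcongr
    exact mul_le_of_le_one_right (by positivity) this
  -- Some power of K has norm below 1, and 1 - K is a factor of 1 - Kⁿ whose cofactor, a geometric
  -- sum, commutes with it.
  have hu : IsUnit (1 - K ^ n) := ⟨Units.oneSub (K ^ n) hnorm, rfl⟩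
  rw [← mul_neg_geom_sum] at hu
  refine ((Commute.isUnit_mul_iff ?_).1 hu).1
  exact (Commute.sum_right _ _ _ fun i _ =>
    ((Commute.one_left _).sub_left ((Commute.refl K).pow_right i)))

/-- The constant path, as a linear operator. -/
def constPath : E →L[ℝ] C(Icc (0 : ℝ) 1, E) :=
  LinearMap.mkContinuous
    { toFun := fun x => ContinuousMap.const _ x
      map_add' := fun _ _ => rfl
      map_smul' := fun _ _ => rfl } 1 (by
      intro x
      rw [one_mul, ContinuousMap.norm_le _ (norm_nonneg _)]
      intro s
      rfl)

/-- Smooth dependence on the initial value and on the (rescaled) time for the equation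
`x' = β(x, x)`, together with the linearized equation. -/
theorem exists_path_family [CompleteSpace E] (β : E →L[ℝ] E →L[ℝ] E) (t₀ : ℝ) (x₀ : E)
    (c₀ : C(Icc (0 : ℝ) 1, E))
    (hc₀ : c₀ = constPath x₀ + t₀ • primitive (pointwise β c₀ c₀)) :
    ∃ (Ψ : ℝ × E → C(Icc (0 : ℝ) 1, E)) (Ψ' : ℝ × E →L[ℝ] C(Icc (0 : ℝ) 1, E)),
      HasStrictFDerivAt Ψ Ψ' (t₀, x₀) ∧ Ψ (t₀, x₀) = c₀ ∧
      (∀ᶠ p in 𝓝 (t₀, x₀), Ψ p = constPath p.2 + p.1 • primitive (pointwise β (Ψ p) (Ψ p))) ∧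
      ∀ p : ℝ × E, Ψ' p = constPath p.2 + p.1 • primitive (pointwise β c₀ c₀) +
        t₀ • primitive (pointwise β c₀ (Ψ' p) + pointwise β (Ψ' p) c₀) := by
  -- The zeros of G are the integrated equations. Rescaling the time to [0, 1] makes the run time a
  -- parameter, so that all solutions lie in one Banach space.
  let G : (ℝ × E) × C(Icc (0 : ℝ) 1, E) → C(Icc (0 : ℝ) 1, E) := fun z =>
    z.2 - (constPath z.1.2 + z.1.1 • primitive (pointwise β z.2 z.2))
  have hG0 : G ((t₀, x₀), c₀) = 0 := sub_eq_zero.2 hc₀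
  have hcd : ContDiffAt ℝ 1 G ((t₀, x₀), c₀) := by
    have : ContDiff ℝ 1 G := by
      refine contDiff_snd.sub (.add ?_ (.fun_smul ?_ ?_))
      · exact (constPath (E := E)).contDiff.comp (contDiff_snd.comp contDiff_fst)
      · exact contDiff_fst.comp contDiff_fst
      · refine (primitive (E := E)).contDiff.comp ?_
        fun_prop
    exact this.contDiffAt
  let D : (ℝ × E) × C(Icc (0 : ℝ) 1, E) →L[ℝ] C(Icc (0 : ℝ) 1, E) :=
    fderiv ℝ G ((t₀, x₀), c₀)
  have hD : ∀ (p : ℝ × E) (h : C(Icc (0 : ℝ) 1, E)), D (p, h) =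
      h - (constPath p.2 + (t₀ • primitive (pointwise β c₀ h + pointwise β h c₀) +
        p.1 • primitive (pointwise β c₀ c₀))) := by
    intro p h
    have h2 : HasFDerivAt (fun z : (ℝ × E) × C(Icc (0 : ℝ) 1, E) => z.2)
      (ContinuousLinearMap.snd ℝ _ _) ((t₀, x₀), c₀) := hasFDerivAt_snd
    have h1 : HasFDerivAt (fun z : (ℝ × E) × C(Icc (0 : ℝ) 1, E) => z.1)
      (ContinuousLinearMap.fst ℝ _ _) ((t₀, x₀), c₀) := hasFDerivAt_fst
    have hB := (primitive (E := E)).hasFDerivAt.comp ((t₀, x₀), c₀)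
      (((pointwise β).hasFDerivAt.comp ((t₀, x₀), c₀) h2).clm_apply h2)
    have := (h2.sub (((constPath (E := E)).hasFDerivAt.comp ((t₀, x₀), c₀) h1.snd).add
      (h1.fst.smul hB))).fderiv
    have h3 : D = _ := this
    rw [h3]
    simp
  have hunit : IsUnit (1 - primitive ∘L (t₀ • (pointwise β c₀ + (pointwise β).flip c₀))) := by
    refine isUnit_one_sub_primitive_comp _ (M := |t₀| * (2 * ‖β‖ * ‖c₀‖)) (by positivity) ?_
    intro f s
    have e : (t₀ • (pointwise β c₀ + (pointwise β).flip c₀)) f s =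
      t₀ • (β (c₀ s) (f s) + β (f s) (c₀ s)) := rfl
    rw [e, norm_smul, Real.norm_eq_abs, mul_assoc]
    gcongr
    refine (norm_add_le _ _).trans ?_
    have a1 := β.le_opNorm₂ (c₀ s) (f s)
    have a2 := β.le_opNorm₂ (f s) (c₀ s)
    have a3 : ‖β‖ * ‖c₀ s‖ * ‖f s‖ ≤ ‖β‖ * ‖c₀‖ * ‖f s‖ := by
      gcongr
      exact c₀.norm_coe_le_norm s
    linarith
  -- The partial derivative in the path is the identity minus a Volterra operator, hence invertible
  -- for every run time, not just a short one.
  have hinv : (fderiv ℝ G ((t₀, x₀), c₀) ∘L .inr ℝ (ℝ × E) C(Icc (0 : ℝ) 1, E)).IsInvertible := by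
    have e : fderiv ℝ G ((t₀, x₀), c₀) ∘L .inr ℝ (ℝ × E) C(Icc (0 : ℝ) 1, E) =
        1 - primitive ∘L (t₀ • (pointwise β c₀ + (pointwise β).flip c₀)) := by
      ext1 h
      have := hD 0 h
      simp only [ContinuousLinearMap.comp_apply, ContinuousLinearMap.inr_apply]
      change D (0, h) = _
      rw [this]
      simp
    rw [e]
    obtain ⟨u, hu⟩ := hunit
    exact ⟨ContinuousLinearEquiv.unitsEquiv ℝ _ u, by rw [← hu]; rfl⟩
  refine ⟨hcd.implicitFunction one_ne_zero hinv, _,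
    hcd.hasStrictFDerivAt_implicitFunction one_ne_zero hinv,
    hcd.implicitFunction_apply_self one_ne_zero hinv, ?_, ?_⟩
  · filter_upwards [hcd.eventually_apply_implicitFunction one_ne_zero hinv] with p hp
    rw [hG0] at hp
    exact sub_eq_zero.1 hp
  · intro p
    set Ψ' := -(fderiv ℝ G ((t₀, x₀), c₀) ∘L .inr ℝ (ℝ × E) C(Icc (0 : ℝ) 1, E)).inverse ∘L
      (fderiv ℝ G ((t₀, x₀), c₀) ∘L .inl ℝ (ℝ × E) C(Icc (0 : ℝ) 1, E)) with hΨ'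
    -- Differentiating G(p, Ψ p) = 0 gives the linearized integral equation; here it is read off
    -- from the formula for the derivative of the implicit function.
    have h0 : D (p, Ψ' p) = 0 := by
      have hsplit : (p, Ψ' p) = (p, 0) + (0, Ψ' p) := by simp
      rw [hsplit, map_add]
      have : D (0, Ψ' p) = -D (p, 0) := by
        have h4 := hinv.self_comp_inverse
        have h5 := congrArg (fun T => T (D (p, 0))) h4
        simp only [ContinuousLinearMap.comp_apply, ContinuousLinearMap.inr_apply,
          ContinuousLinearMap.id_apply] at h5
        have h6 : Ψ' p = -((fderiv ℝ G ((t₀, x₀), c₀) ∘L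
          .inr ℝ (ℝ × E) C(Icc (0 : ℝ) 1, E)).inverse (D (p, 0))) := by
          simp [hΨ', D]
        have h7 : ((0 : ℝ × E), Ψ' p) = -(0, ((fderiv ℝ G ((t₀, x₀), c₀) ∘L
          .inr ℝ (ℝ × E) C(Icc (0 : ℝ) 1, E)).inverse (D (p, 0)))) := by
          rw [h6]; simp
        rw [h7, map_neg]
        exact congrArg Neg.neg h5
      rw [this, add_neg_cancel]
    rw [hD] at h0
    refine (sub_eq_zero.1 h0).trans ?_
    abel

/-- Uniqueness for linear equations. -/
theorem eq_zero_of_hasDerivWithinAt_of_bound {f f' : ℝ → E} {K a b : ℝ}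
    (hf : ∀ s ∈ Icc a b, HasDerivWithinAt f (f' s) (Icc a b) s) (h0 : f a = 0)
    (bound : ∀ s ∈ Icc a b, ‖f' s‖ ≤ K * ‖f s‖) : ∀ s ∈ Icc a b, f s = 0 :=
  eq_zero_of_abs_deriv_le_mul_abs_self_of_eq_zero_right
    (fun s hs => (hf s hs).continuousWithinAt)
    (fun s hs => (hf s (Ico_subset_Icc_self hs)).mono_of_mem_nhdsWithin
      (Icc_mem_nhdsGE_of_mem hs)) h0
    (fun s hs => bound s (Ico_subset_Icc_self hs))

theorem extendPath_of_eq_primitive [CompleteSpace E] {f g : C(Icc (0 : ℝ) 1, E)} {x : E}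
    (h : f = constPath x + primitive g) :
    extendPath f 0 = x ∧
      ∀ s ∈ Icc (0 : ℝ) 1, HasDerivWithinAt (extendPath f) (extendPath g s) (Icc 0 1) s := by
  have e : ∀ s, extendPath f s = x + extendPath (primitive g) s := by
    intro s
    rw [h]
    rfl
  constructor
  · rw [e, extendPath_of_mem _ (left_mem_Icc.2 zero_le_one), primitive_zero_left, add_zero]
  · intro s hs
    exact ((hasDerivWithinAt_primitive g hs).const_add x).congr (fun u _ => e u) (e s)

/-- Smooth dependence on the initial value and on the (rescaled) time for the equation
`x' = β(x, x)`, together with the linearized equation, in differential form. -/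
theorem exists_flow [CompleteSpace E] (β : E →L[ℝ] E →L[ℝ] E) (t₀ : ℝ) (c : ℝ → E)
    (hc : ∀ s ∈ Icc (0 : ℝ) 1, HasDerivWithinAt c (t₀ • β (c s) (c s)) (Icc 0 1) s) :
    ∃ (Ψ : ℝ × E → C(Icc (0 : ℝ) 1, E)) (Ψ' : ℝ × E →L[ℝ] C(Icc (0 : ℝ) 1, E)),
      HasStrictFDerivAt Ψ Ψ' (t₀, c 0) ∧
      (∀ s ∈ Icc (0 : ℝ) 1, extendPath (Ψ (t₀, c 0)) s = c s) ∧
      (∀ᶠ p in 𝓝 (t₀, c 0), extendPath (Ψ p) 0 = p.2 ∧ ∀ s ∈ Icc (0 : ℝ) 1,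
        HasDerivWithinAt (extendPath (Ψ p))
          (p.1 • β (extendPath (Ψ p) s) (extendPath (Ψ p) s)) (Icc 0 1) s) ∧
      ∀ p : ℝ × E, extendPath (Ψ' p) 0 = p.2 ∧ ∀ s ∈ Icc (0 : ℝ) 1,
        HasDerivWithinAt (extendPath (Ψ' p)) (p.1 • β (c s) (c s) +
          t₀ • (β (c s) (extendPath (Ψ' p) s) + β (extendPath (Ψ' p) s) (c s))) (Icc 0 1) s := by
  have hcont : ContinuousOn c (Icc 0 1) := fun s hs => (hc s hs).continuousWithinAt
  let c₀ : C(Icc (0 : ℝ) 1, E) := ⟨(Icc (0 : ℝ) 1).domRestrict c, hcont.domRestrict⟩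
  have hcc : ∀ s ∈ Icc (0 : ℝ) 1, extendPath c₀ s = c s := fun s hs => extendPath_of_mem _ hs
  let g := t₀ • pointwise β c₀ c₀
  have hg : ∀ s ∈ Icc (0 : ℝ) 1, extendPath g s = t₀ • β (c s) (c s) := fun s hs =>
    extendPath_of_mem _ hs
  obtain ⟨hr0, hr⟩ := extendPath_of_eq_primitive (f := constPath (c 0) + primitive g) rfl
  -- The curve and the primitive of its derivative have the same derivative, so the bound holds with
  -- K = 0. Conserved quantities are treated in the same way below.
  have hdiff := eq_zero_of_hasDerivWithinAt_of_bound (K := 0) (a := 0) (b := 1)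
    (fun s hs => (hc s hs).sub (hr s hs)) (sub_eq_zero.2 hr0.symm)
    (fun s hs => by rw [hg s hs]; simp)
  have hc₀ : c₀ = constPath (c 0) + t₀ • primitive (pointwise β c₀ c₀) := by
    ext s
    have h1 := sub_eq_zero.1 (hdiff s s.2)
    rw [extendPath_of_mem _ s.2] at h1
    change c s = _
    rw [h1, map_smul]
  obtain ⟨Ψ, Ψ', h1, h2, h3, h4⟩ := exists_path_family β t₀ (c 0) c₀ hc₀
  refine ⟨Ψ, Ψ', h1, fun s hs => by rw [h2, hcc s hs], ?_, fun p => ?_⟩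
  · filter_upwards [h3] with p hp
    rw [← map_smul] at hp
    exact extendPath_of_eq_primitive hp
  · have h5 := h4 p
    rw [add_assoc, ← map_smul primitive, ← map_smul primitive, ← map_add] at h5
    obtain ⟨h6, h7⟩ := extendPath_of_eq_primitive h5
    refine ⟨h6, fun s hs => ?_⟩
    rw [← hcc s hs]
    exact h7 s hs

end QuadraticODE

end

end RoughBilliards

namespace RoughBilliards

noncomputable section

/-! ### Exterior powers of two-forms with a Lagrangian subspace -/

section WedgePower

open Module

variable {F : Type*} [AddCommGroup F] [Module ℝ F]

/-- The product of the values of `α` on consecutive pairs of arguments. -/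
def pairProduct (α : F →ₗ[ℝ] F →ₗ[ℝ] ℝ) (k : ℕ) : MultilinearMap ℝ (fun _ : Fin (2 * k) => F) ℝ :=
  -- The argument in slot m occurs only in the factor with index m / 2, on the left or on the right
  -- according to the parity of m.
  have key : ∀ (X : Fin (2 * k) → F) (m : Fin (2 * k)), ∃ ℓ : F →ₗ[ℝ] ℝ, ∀ x,
      ∏ i : Fin k, α (Function.update X m x ⟨2 * i, by omega⟩)
        (Function.update X m x ⟨2 * i + 1, by omega⟩) = ℓ x := by
    intro X m
    have hm : (m : ℕ) / 2 < k := by omega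
    let i₀ : Fin k := ⟨m / 2, hm⟩
    have hrest : ∀ x, ∀ i ∈ Finset.univ.erase i₀,
        α (Function.update X m x ⟨2 * i, by omega⟩) (Function.update X m x ⟨2 * i + 1, by omega⟩) =
        α (X ⟨2 * i, by omega⟩) (X ⟨2 * i + 1, by omega⟩) := by
      intro x i hi
      have hi' : (i : ℕ) ≠ m / 2 := fun h => (Finset.ne_of_mem_erase hi) (Fin.ext h)
      rw [Function.update_of_ne, Function.update_of_ne]
      · intro h; rw [Fin.ext_iff] at h; simp at h; omega
      · intro h; rw [Fin.ext_iff] at h; simp at h; omega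
    set P := ∏ i ∈ Finset.univ.erase i₀,
      α (X ⟨2 * i, by omega⟩) (X ⟨2 * i + 1, by omega⟩)
    have hsplit : ∀ x, ∏ i : Fin k, α (Function.update X m x ⟨2 * i, by omega⟩)
        (Function.update X m x ⟨2 * i + 1, by omega⟩) =
        P * α (Function.update X m x ⟨2 * i₀, by omega⟩)
          (Function.update X m x ⟨2 * i₀ + 1, by omega⟩) := by
      intro x
      rw [← Finset.mul_prod_erase _ _ (Finset.mem_univ i₀), Finset.prod_congr rfl (hrest x),
        mul_comm]
    rcases Nat.even_or_odd' (m : ℕ) with ⟨r, hr | hr⟩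
    · have e0 : (⟨2 * i₀, by omega⟩ : Fin (2 * k)) = m := Fin.ext (by simp [i₀]; omega)
      have e1 : (⟨2 * i₀ + 1, by omega⟩ : Fin (2 * k)) ≠ m := by
        intro h; rw [Fin.ext_iff] at h; simp [i₀] at h; omega
      refine ⟨P • α.flip (X ⟨2 * i₀ + 1, by omega⟩), fun x => ?_⟩
      rw [hsplit, Function.update_of_ne e1, e0, Function.update_self]
      simp
    · have e0 : (⟨2 * i₀ + 1, by omega⟩ : Fin (2 * k)) = m := Fin.ext (by simp [i₀]; omega)
      have e1 : (⟨2 * i₀, by omega⟩ : Fin (2 * k)) ≠ m := by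
        intro h; rw [Fin.ext_iff] at h; simp [i₀] at h; omega
      refine ⟨P • α (X ⟨2 * i₀, by omega⟩), fun x => ?_⟩
      rw [hsplit, Function.update_of_ne e1, e0, Function.update_self]
      simp
  MultilinearMap.mk' (fun X => ∏ i : Fin k, α (X ⟨2 * i, by omega⟩) (X ⟨2 * i + 1, by omega⟩))
    (by
      intro X m x y
      obtain ⟨ℓ, hℓ⟩ := key X m
      simp only [hℓ, map_add])
    (by
      intro X m a x
      obtain ⟨ℓ, hℓ⟩ := key X m
      simp only [hℓ, map_smul])

/-- `wedgePower` of a bilinear form, as an alternating map. -/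
def wedgePowerMap (α : F →ₗ[ℝ] F →ₗ[ℝ] ℝ) (k : ℕ) : F [⋀^Fin (2 * k)]→ₗ[ℝ] ℝ :=
  (1 / 2 ^ k : ℝ) • MultilinearMap.alternatization (pairProduct α k)

theorem wedgePowerMap_apply (α : F →ₗ[ℝ] F →ₗ[ℝ] ℝ) (k : ℕ) (X : Fin (2 * k) → F) :
    wedgePowerMap α k X = wedgePower (fun a b => α a b) k X := by
  simp only [wedgePowerMap, AlternatingMap.smul_apply, MultilinearMap.alternatization_apply,
    wedgePower, smul_eq_mul]
  congr 1
  refine Finset.sum_congr rfl fun σ _ => ?_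
  rw [Units.smul_def, zsmul_eq_mul]
  rfl

/-- A form of top degree is a multiple of the determinant in a basis, which is multiplicative. -/
theorem compLinearMap_eq_det_smul [Module.Finite ℝ F] {k : ℕ} (hk : finrank ℝ F = k)
    (f : F [⋀^Fin k]→ₗ[ℝ] ℝ) (L : F →ₗ[ℝ] F) : f.compLinearMap L = LinearMap.det L • f := by
  let e := finBasisOfFinrankEq ℝ F hk
  ext X
  rw [f.eq_smul_basis_det e]
  have := e.det_comp L X
  simp only [AlternatingMap.compLinearMap_apply, AlternatingMap.smul_apply, smul_eq_mul]
  rw [show (fun i => L (X i)) = L ∘ X from rfl, this]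
  ring

variable {E : Type*} [AddCommGroup E] [Module ℝ E]

/-- A top exterior power of a two-form on `E × F` that vanishes on the Lagrangian subspace `F` is
determined by the pairing between `E` and `F`. -/
theorem wedgePower_eq_det_mul [Module.Finite ℝ E] [Module.Finite ℝ F] {k : ℕ}
    (hE : finrank ℝ E = k) (hF : finrank ℝ F = k)
    (α α' : (E × F) →ₗ[ℝ] (E × F) →ₗ[ℝ] ℝ) (R : E →ₗ[ℝ] E)
    (h0 : ∀ y y', α (0, y) (0, y') = 0) (h0' : ∀ y y', α' (0, y) (0, y') = 0)
    (h1 : ∀ x y, α' (x, 0) (0, y) = α (R x, 0) (0, y))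
    (h2 : ∀ x y, α' (0, y) (x, 0) = α (0, y) (R x, 0)) (X : Fin (2 * k) → E × F) :
    wedgePower (fun a b => α' a b) k X =
      LinearMap.det R * wedgePower (fun a b => α a b) k X := by
  have hdet : LinearMap.det (R.prodMap (LinearMap.id : F →ₗ[ℝ] F)) = LinearMap.det R := by
    rw [LinearMap.det_prodMap, LinearMap.det_id, mul_one]
  -- The forms α' and the pull-back of α may differ on pairs from E. Their top powers agree
  -- nevertheless, which is checked term by term on a basis adapted to E × F.
  have hmain : wedgePowerMap α' k =
      (wedgePowerMap α k).compLinearMap (R.prodMap (LinearMap.id : F →ₗ[ℝ] F)) := by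
    let bE := finBasisOfFinrankEq ℝ E hE
    let bF := finBasisOfFinrankEq ℝ F hF
    refine Basis.ext_alternating (bE.prod bF) fun v hv => ?_
    simp only [AlternatingMap.compLinearMap_apply, wedgePowerMap_apply, wedgePower]
    congr 1
    refine Finset.sum_congr rfl fun σ _ => ?_
    congr 1
    have hvb : Function.Bijective (fun i => v (σ i)) := by
      rw [Fintype.bijective_iff_injective_and_card]
      exact ⟨hv.comp σ.injective, by simp; omega⟩
    let w : Fin (2 * k) ≃ Fin k ⊕ Fin k := Equiv.ofBijective _ hvb
    change ∏ i : Fin k, α' ((bE.prod bF) (w ⟨2 * i, _⟩)) ((bE.prod bF) (w ⟨2 * i + 1, _⟩)) =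
      ∏ i : Fin k, α ((R.prodMap LinearMap.id) ((bE.prod bF) (w ⟨2 * i, _⟩)))
        ((R.prodMap LinearMap.id) ((bE.prod bF) (w ⟨2 * i + 1, _⟩)))
    by_cases hbad : ∃ i : Fin k, (∃ a, w ⟨2 * i, by omega⟩ = .inr a) ∧
        ∃ b, w ⟨2 * i + 1, by omega⟩ = .inr b
    -- Two vectors of F in one pair make both products vanish.
    · obtain ⟨i, ⟨a, ha⟩, b, hb⟩ := hbad
      rw [Finset.prod_eq_zero (Finset.mem_univ i), Finset.prod_eq_zero (Finset.mem_univ i)]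
      · rw [ha, hb]; simp [h0]
      · rw [ha, hb]; simp [h0']
    -- Pigeonhole: g sends a basis vector of F to the index of its pair. As no pair holds two of
    -- them, the k vectors of F occupy all k pairs, and the partner is always from E.
    · let g : Fin k → Fin k := fun r => ⟨(w.symm (.inr r) : ℕ) / 2, by omega⟩
      have hg : Function.Injective g := by
        intro r r' hrr
        by_contra hne
        have hq : (w.symm (.inr r) : ℕ) / 2 = (w.symm (.inr r') : ℕ) / 2 :=
          congrArg Fin.val hrr
        have hne' : (w.symm (.inr r) : ℕ) ≠ w.symm (.inr r') := by
          intro h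
          exact hne (Sum.inr_injective (w.symm.injective (Fin.ext h)))
        have key : ∀ r r' : Fin k, (w.symm (.inr r) : ℕ) = 2 * ((w.symm (.inr r) : ℕ) / 2) →
            (w.symm (.inr r') : ℕ) = 2 * ((w.symm (.inr r) : ℕ) / 2) + 1 → False := by
          intro r r' e e'
          refine hbad ⟨g r, ⟨r, ?_⟩, ⟨r', ?_⟩⟩
          · exact (w.symm_apply_eq.1 (Fin.ext e)).symm
          · exact (w.symm_apply_eq.1 (Fin.ext e')).symm
        rcases Nat.mod_two_eq_zero_or_one (w.symm (.inr r) : ℕ) with h | h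
        · exact key r r' (by omega) (by omega)
        · exact key r' r (by omega) (by omega)
      have hgs := Finite.injective_iff_surjective.1 hg
      refine Finset.prod_congr rfl fun i _ => ?_
      obtain ⟨r, hr⟩ := hgs i
      have hr' : (w.symm (.inr r) : ℕ) / 2 = i := congrArg Fin.val hr
      rcases Nat.mod_two_eq_zero_or_one (w.symm (.inr r) : ℕ) with h | h
      · have e : w ⟨2 * i, by omega⟩ = .inr r := by
          exact (w.symm_apply_eq.1 (Fin.ext (by simp; omega))).symm
        rcases e' : w ⟨2 * i + 1, by omega⟩ with a | b
        · rw [e]; simp [h2]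
        · exact absurd ⟨i, ⟨r, e⟩, b, e'⟩ hbad
      · have e : w ⟨2 * i + 1, by omega⟩ = .inr r := by
          exact (w.symm_apply_eq.1 (Fin.ext (by simp; omega))).symm
        rcases e' : w ⟨2 * i, by omega⟩ with a | b
        · rw [e]; simp [h1]
        · exact absurd ⟨i, ⟨b, e'⟩, r, e⟩ hbad
  rw [← wedgePowerMap_apply, ← wedgePowerMap_apply, hmain,
    compLinearMap_eq_det_smul (by rw [finrank_prod]; omega), hdet]
  rfl

end WedgePower

end

end RoughBilliards

namespace RoughBilliards

noncomputable section

open Module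

variable {n : ℕ}

theorem isTopologicalAddGroup_pt (n : ℕ) : IsTopologicalAddGroup (Pt n) :=
  SeminormedAddCommGroup.toIsTopologicalAddGroup

attribute [local instance] isTopologicalAddGroup_pt

/-! ### Transposes, traces and determinants -/

theorem tr_mul (A B : Mat n) : tr (A * B) = tr B * tr A := ContinuousLinearMap.adjoint_comp A B

@[simp]
theorem tr_tr (A : Mat n) : tr (tr A) = A := ContinuousLinearMap.adjoint_adjoint A

theorem inner_tr_right (A : Mat n) (x y : Pt n) : inner ℝ x (tr A y) = inner ℝ (A x) y :=
  ContinuousLinearMap.adjoint_inner_right A x y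

/-- The trace of a matrix. -/
abbrev matTrace (A : Mat n) : ℝ := LinearMap.trace ℝ (Pt n) (A : Pt n →ₗ[ℝ] Pt n)

theorem toMatrix_tr (A : Mat n) :
    LinearMap.toMatrix (EuclideanSpace.basisFun (Fin n) ℝ).toBasis
      (EuclideanSpace.basisFun (Fin n) ℝ).toBasis (tr A : Pt n →ₗ[ℝ] Pt n) =
    (LinearMap.toMatrix (EuclideanSpace.basisFun (Fin n) ℝ).toBasis
      (EuclideanSpace.basisFun (Fin n) ℝ).toBasis (A : Pt n →ₗ[ℝ] Pt n)).conjTranspose := by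
  have h : (tr A : Pt n →ₗ[ℝ] Pt n) = LinearMap.adjoint (A : Pt n →ₗ[ℝ] Pt n) := by
    rw [LinearMap.eq_adjoint_iff]
    intro x y
    exact ContinuousLinearMap.adjoint_inner_left A y x
  rw [h, LinearMap.toMatrix_adjoint]

theorem matTrace_tr (A : Mat n) : matTrace (tr A) = matTrace A := by
  rw [matTrace, LinearMap.trace_eq_matrix_trace ℝ (EuclideanSpace.basisFun (Fin n) ℝ).toBasis,
    toMatrix_tr, Matrix.trace_conjTranspose, star_trivial, matTrace,
    LinearMap.trace_eq_matrix_trace ℝ (EuclideanSpace.basisFun (Fin n) ℝ).toBasis]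

theorem matTrace_mul_comm (A B : Mat n) : matTrace (A * B) = matTrace (B * A) :=
  LinearMap.trace_mul_comm ℝ (A : Pt n →ₗ[ℝ] Pt n) (B : Pt n →ₗ[ℝ] Pt n)

theorem det_tr (A : Mat n) : (tr A).det = A.det := by
  rw [ContinuousLinearMap.det, ← LinearMap.det_toMatrix (EuclideanSpace.basisFun (Fin n) ℝ).toBasis,
    toMatrix_tr, Matrix.det_conjTranspose, star_trivial, LinearMap.det_toMatrix,
    ContinuousLinearMap.det]

theorem mat_det_mul (A B : Mat n) : (A * B).det = A.det * B.det :=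
  LinearMap.det_comp (A : Pt n →ₗ[ℝ] Pt n) (B : Pt n →ₗ[ℝ] Pt n)

theorem mat_det_one : (1 : Mat n).det = 1 := LinearMap.det_id

theorem mul_tr_of_tr_mul {A : Mat n} (h : tr A * A = 1) : A * tr A = 1 := by
  have h1 : (tr A : Pt n →ₗ[ℝ] Pt n) * (A : Pt n →ₗ[ℝ] Pt n) = 1 :=
    congrArg (fun T : Mat n => (T : Pt n →ₗ[ℝ] Pt n)) h
  have h2 := mul_eq_one_comm.1 h1
  ext1 x
  exact congrArg (fun T : Pt n →ₗ[ℝ] Pt n => T x) h2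

theorem sq_det_of_orthogonal {A : Mat n} (h : tr A * A = 1) : A.det ^ 2 = 1 := by
  have := congrArg ContinuousLinearMap.det h
  rwa [mat_det_mul, det_tr, mat_det_one, ← sq] at this

/-! ### The kinetic energy metric -/

theorem tr_inertia (μ : Measure (Pt n)) : tr (inertia μ) = inertia μ := by
  rw [inertia, tr, ← ContinuousLinearMap.star_eq_adjoint, ← map_star]
  congr 1
  ext i j
  simp [Matrix.star_apply, mul_comm]

theorem bodyForm_comm (μ : Measure (Pt n)) (u v : Mat n × Pt n) :
    bodyForm μ u v = bodyForm μ v u := by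
  have key : ∀ Z W : Mat n, matTrace (inertia μ * Z * tr W) = matTrace (inertia μ * W * tr Z) := by
    intro Z W
    rw [← matTrace_tr, tr_mul, tr_mul, tr_tr, tr_inertia, ← mul_assoc, matTrace_mul_comm,
      ← mul_assoc]
  have key' : ∀ Z W : Mat n, matTrace (Z * inertia μ * tr W) = matTrace (W * inertia μ * tr Z) := by
    intro Z W
    rw [← matTrace_tr, tr_mul, tr_mul, tr_tr, tr_inertia, mul_assoc]
  have h : matTrace (inertiaMap μ u.1 * tr v.1) = matTrace (inertiaMap μ v.1 * tr u.1) := by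
    simp only [inertiaMap, add_mul]
    have a : ∀ X Y : Mat n, matTrace (X + Y) = matTrace X + matTrace Y := fun X Y =>
      map_add (LinearMap.trace ℝ (Pt n)) _ _
    rw [a, a, key, key']
  unfold bodyForm
  rw [real_inner_comm]
  exact congrArg (fun x => mass μ * (1 / 2 * x + inner ℝ v.2 u.2)) h

theorem kin_comm (B : Fin 2 → RigidBody n) (u v : Conf n) : kin B u v = kin B v u :=
  Finset.sum_congr rfl fun _ _ => bodyForm_comm _ _ _

/-- The kinetic energy metric as a bilinear map. -/
def kinBilin (B : Fin 2 → RigidBody n) : Conf n →ₗ[ℝ] Conf n →ₗ[ℝ] ℝ :=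
  have hadd : ∀ u v w, kin B u (v + w) = kin B u v + kin B u w := fun u v w => by
    simp only [kin, Pi.add_apply, bodyForm_add_right, Finset.sum_add_distrib]
  have hsmul : ∀ (a : ℝ) u v, kin B u (a • v) = a * kin B u v := fun a u v => by
    simp only [kin, Pi.smul_apply, bodyForm_smul_right, Finset.mul_sum]
  LinearMap.mk₂ ℝ (kin B)
    (fun u v w => by rw [kin_comm, hadd, kin_comm B w, kin_comm B w])
    (fun a u v => by rw [kin_comm, hsmul, kin_comm B v, smul_eq_mul])
    hadd hsmul

theorem kinBilin_apply (B : Fin 2 → RigidBody n) (u v : Conf n) : kinBilin B u v = kin B u v := rfl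

theorem kin_pos (B : Fin 2 → RigidBody n) {u : Conf n} (hu : u ∈ lieAlg n) (h0 : u ≠ 0) :
    0 < kin B u u := by
  have hnonneg : ∀ j, 0 ≤ bodyForm (B j).μ (u j) (u j) := by
    intro j
    by_cases hj : u j = 0
    · have := bodyForm_smul_right (B j).μ (0 : ℝ) (u j) (u j)
      rw [zero_smul, zero_mul] at this
      rw [hj] at this ⊢
      exact this.ge
    · exact ((B j).form_pos _ (hu j) hj).le
  obtain ⟨j, hj⟩ := Function.ne_iff.1 h0
  exact Finset.sum_pos' (fun j _ => hnonneg j) ⟨j, Finset.mem_univ j, (B j).form_pos _ (hu j) hj⟩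

/-- The kinetic energy is positive definite only on the Lie algebra, so the representing vector is
sought there and represents only the restriction of the form. Definiteness gives an injection into
the dual, which has the same dimension. -/
theorem exists_riesz (B : Fin 2 → RigidBody n) :
    ∃ R : (Conf n →ₗ[ℝ] ℝ) →ₗ[ℝ] Conf n, ∀ ℓ, R ℓ ∈ lieAlg n ∧
      ∀ σ ∈ lieAlg n, kin B (R ℓ) σ = ℓ σ := by
  let K : lieAlg n →ₗ[ℝ] Dual ℝ (lieAlg n) := (kinBilin B).domRestrict₁₂ (lieAlg n) (lieAlg n)
  have hK : Function.Injective K := by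
    rw [injective_iff_map_eq_zero]
    intro u hu
    by_contra h0
    have h1 := kin_pos B u.2 (fun h => h0 (Subtype.ext h))
    have h2 : K u u = 0 := by rw [hu]; rfl
    exact h1.ne' h2
  let e := LinearMap.linearEquivOfInjective K hK (Subspace.dual_finrank_eq (K := ℝ)).symm
  refine ⟨(lieAlg n).subtype ∘ₗ e.symm.toLinearMap ∘ₗ (lieAlg n).subtype.dualMap, fun ℓ => ?_⟩
  refine ⟨(e.symm _).2, fun σ hσ => ?_⟩
  have h3 : K (e.symm ((lieAlg n).subtype.dualMap ℓ)) = (lieAlg n).subtype.dualMap ℓ :=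
    e.apply_symm_apply _
  exact congrArg (fun T => T ⟨σ, hσ⟩) h3

/-- The vector in the Lie algebra that represents a linear form. -/
def riesz (B : Fin 2 → RigidBody n) : (Conf n →ₗ[ℝ] ℝ) →ₗ[ℝ] Conf n := (exists_riesz B).choose

theorem riesz_mem (B : Fin 2 → RigidBody n) (ℓ : Conf n →ₗ[ℝ] ℝ) : riesz B ℓ ∈ lieAlg n :=
  ((exists_riesz B).choose_spec ℓ).1

theorem kin_riesz (B : Fin 2 → RigidBody n) (ℓ : Conf n →ₗ[ℝ] ℝ) {σ : Conf n}
    (hσ : σ ∈ lieAlg n) : kin B (riesz B ℓ) σ = ℓ σ :=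
  ((exists_riesz B).choose_spec ℓ).2 σ hσ

theorem eq_of_forall_kin_eq (B : Fin 2 → RigidBody n) {u v : Conf n} (hu : u ∈ lieAlg n)
    (hv : v ∈ lieAlg n) (h : ∀ σ ∈ lieAlg n, kin B u σ = kin B v σ) : u = v := by
  by_contra hne
  have h1 := kin_pos B ((lieAlg n).sub_mem hu hv) (sub_ne_zero.2 hne)
  have h2 := h _ ((lieAlg n).sub_mem hu hv)
  rw [← kinBilin_apply, map_sub (kinBilin B), LinearMap.sub_apply, kinBilin_apply,
    kinBilin_apply, h2, sub_self] at h1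
  exact h1.false

/-! ### The Lie bracket and the force-free equations of motion -/

/-- The Lie bracket of `𝔤 × 𝔤`. -/
def bracket : Conf n →ₗ[ℝ] Conf n →ₗ[ℝ] Conf n :=
  LinearMap.mk₂ ℝ (fun ξ η j =>
      ((ξ j).1 * (η j).1 - (η j).1 * (ξ j).1, (ξ j).1 (η j).2 - (η j).1 (ξ j).2))
    (by intros; ext1 j; refine Prod.ext ?_ ?_ <;> simp [add_mul, mul_add] <;> abel)
    (by intros; ext1 j; refine Prod.ext ?_ ?_ <;> simp [smul_sub])
    (by intros; ext1 j; refine Prod.ext ?_ ?_ <;> simp [add_mul, mul_add] <;> abel)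
    (by intros; ext1 j; refine Prod.ext ?_ ?_ <;> simp [smul_sub])

theorem bracket_apply (ξ η : Conf n) (j : Fin 2) : bracket ξ η j =
    ((ξ j).1 * (η j).1 - (η j).1 * (ξ j).1, (ξ j).1 (η j).2 - (η j).1 (ξ j).2) := rfl

theorem bracket_mem {ξ η : Conf n} (hξ : ξ ∈ lieAlg n) (hη : η ∈ lieAlg n) :
    bracket ξ η ∈ lieAlg n := by
  intro j
  have h1 := hξ j
  have h2 := hη j
  rw [bracket_apply]
  simp only [tr, map_sub]
  change tr (_ * _) - tr (_ * _) = _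
  rw [tr_mul, tr_mul, h1, h2]
  simp

theorem bracket_self (ξ : Conf n) : bracket ξ ξ = 0 := by
  ext1 j
  simp [bracket_apply]

theorem bracket_swap (ξ η : Conf n) : bracket ξ η = -bracket η ξ := by
  ext1 j
  simp [bracket_apply]

theorem bracket_jacobi (ξ η ζ : Conf n) :
    bracket ξ (bracket η ζ) = bracket (bracket ξ η) ζ + bracket η (bracket ξ ζ) := by
  ext1 j
  refine Prod.ext ?_ ?_
  · simp only [bracket_apply, Pi.add_apply, Prod.fst_add]
    noncomm_ring
  · simp only [bracket_apply, Pi.add_apply, Prod.snd_add, map_sub, sub_apply,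
      mul_apply_eq_comp]
    abel

/-- The bilinear map in Euler's equation `ξ' = Q(ξ, ξ)`. -/
def euler (B : Fin 2 → RigidBody n) : Conf n →ₗ[ℝ] Conf n →ₗ[ℝ] Conf n :=
  LinearMap.mk₂ ℝ (fun ξ η => riesz B (kinBilin B ξ ∘ₗ bracket η))
    (fun ξ ξ' η => by rw [map_add, LinearMap.add_comp, map_add])
    (fun a ξ η => by rw [map_smul, LinearMap.smul_comp, map_smul])
    (fun ξ η η' => by rw [map_add, LinearMap.comp_add, map_add])
    (fun a ξ η => by rw [map_smul, LinearMap.comp_smul, map_smul])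

theorem euler_mem (B : Fin 2 → RigidBody n) (ξ η : Conf n) : euler B ξ η ∈ lieAlg n :=
  riesz_mem B _

/-- With both arguments of `euler` equal to ξ this is the weak form ⟨ξ', σ⟩ = ⟨ξ, [ξ, σ]⟩ of the
Euler–Arnold equation. -/
theorem kin_euler (B : Fin 2 → RigidBody n) (ξ η : Conf n) {σ : Conf n} (hσ : σ ∈ lieAlg n) :
    kin B (euler B ξ η) σ = kin B ξ (bracket η σ) := kin_riesz B _ hσ

/-- `translate` as a bilinear map. -/
def translateBilin : Conf n →ₗ[ℝ] Conf n →ₗ[ℝ] Conf n :=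
  LinearMap.mk₂ ℝ translate
    (by intros; ext1 j; refine Prod.ext ?_ ?_ <;> simp [translate, add_mul])
    (by intros; ext1 j; refine Prod.ext ?_ ?_ <;> simp [translate])
    (by intros; ext1 j; refine Prod.ext ?_ ?_ <;> simp [translate, mul_add])
    (by intros; ext1 j; refine Prod.ext ?_ ?_ <;> simp [translate])

theorem translateBilin_apply (q ξ : Conf n) : translateBilin q ξ = translate q ξ := rfl

/-- `untranslate` as a bilinear map. -/
def untranslateBilin : Conf n →ₗ[ℝ] Conf n →ₗ[ℝ] Conf n :=
  LinearMap.mk₂ ℝ untranslate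
    (by intros; ext1 j; refine Prod.ext ?_ ?_ <;> simp [untranslate, add_mul])
    (by intros; ext1 j; refine Prod.ext ?_ ?_ <;> simp [untranslate])
    (by intros; ext1 j; refine Prod.ext ?_ ?_ <;> simp [untranslate, mul_add])
    (by intros; ext1 j; refine Prod.ext ?_ ?_ <;> simp [untranslate])

theorem untranslateBilin_apply (q X : Conf n) : untranslateBilin q X = untranslate q X := rfl

theorem untranslate_translate {q : Conf n} (hq : q ∈ SE2 n) (ξ : Conf n) :
    untranslate q (translate q ξ) = ξ := by
  ext1 j
  have h := (hq j).1
  refine Prod.ext ?_ ?_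
  · simp only [untranslate, translate]
    rw [← mul_assoc, h, one_mul]
  · simp only [untranslate, translate]
    rw [← mul_apply_eq_comp, h, one_apply_eq_self]

theorem translate_untranslate {q : Conf n} (hq : q ∈ SE2 n) (X : Conf n) :
    translate q (untranslate q X) = X := by
  ext1 j
  have h := mul_tr_of_tr_mul (hq j).1
  refine Prod.ext ?_ ?_
  · simp only [untranslate, translate]
    rw [← mul_assoc, h, one_mul]
  · simp only [untranslate, translate]
    rw [← mul_apply_eq_comp, h, one_apply_eq_self]

/-- A shortcut instance. -/
abbrev moduleStateCLM (n : ℕ) : Module ℝ (State n →L[ℝ] State n) := ContinuousLinearMap.module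

attribute [local instance] moduleStateCLM

/-- The quadratic vector field on the space of states whose integral curves are the force-free
motions. -/
def freeField (B : Fin 2 → RigidBody n) : State n →L[ℝ] State n →L[ℝ] State n :=
  LinearMap.toContinuousBilinearMap <|
    -- On the diagonal this is q' = qξ and ξ' = `euler B ξ ξ`; the bilinear form makes the general
    -- theory of quadratic equations applicable.
    LinearMap.mk₂ ℝ (fun x y : State n => ((translate x.1 y.2, euler B x.2 y.2) : State n))
      (fun x x' y => by simp [← translateBilin_apply])
      (fun a x y => by simp [← translateBilin_apply])
      (fun x y y' => by simp [← translateBilin_apply])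
      (fun a x y => by simp [← translateBilin_apply])

end

end RoughBilliards

namespace RoughBilliards

noncomputable section

open Module

variable {n : ℕ}

attribute [local instance] isTopologicalAddGroup_pt moduleStateCLM

/-! ### The dimension of the Lie algebra -/

/-- The entries of a matrix. -/
def entry (i k : Fin n) : Mat n →ₗ[ℝ] ℝ where
  toFun Z := inner ℝ (EuclideanSpace.single i (1 : ℝ)) (Z (EuclideanSpace.single k (1 : ℝ)))
  map_add' Z W := by rw [add_apply, inner_add_right]
  map_smul' a Z := by rw [smul_apply, inner_smul_right]; rfl

theorem entry_apply (Z : Mat n) (i k : Fin n) :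
    entry i k Z = inner ℝ (EuclideanSpace.single i (1 : ℝ)) (Z (EuclideanSpace.single k (1 : ℝ))) :=
  rfl

theorem entry_tr (Z : Mat n) (i k : Fin n) : entry i k (tr Z) = entry k i Z := by
  rw [entry_apply, inner_tr_right, real_inner_comm, entry_apply]

theorem ext_entry {Z W : Mat n} (h : ∀ i k, entry i k Z = entry i k W) : Z = W := by
  refine ContinuousLinearMap.coe_injective
    ((EuclideanSpace.basisFun (Fin n) ℝ).toBasis.ext fun k => ?_)
  ext i
  simpa [entry_apply, EuclideanSpace.inner_single_left] using h i k

theorem entry_toEuclideanCLM (M : Matrix (Fin n) (Fin n) ℝ) (i k : Fin n) :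
    entry i k (Matrix.toEuclideanCLM (n := Fin n) (𝕜 := ℝ) M) = M i k := by
  rw [entry_apply, Matrix.inner_toEuclideanCLM]
  simp

/-- The entries below the diagonal and the translational parts of an element of `𝔤 × 𝔤`. -/
def lieAlgCoords (n : ℕ) :
    lieAlg n →ₗ[ℝ] (Fin 2 → ((Σ i : Fin n, Fin i) → ℝ) × Pt n) where
  toFun ξ j := (fun s => entry s.1 ⟨s.2, s.2.2.trans s.1.2⟩ (ξ.1 j).1, (ξ.1 j).2)
  map_add' ξ η := by
    ext1 j
    refine Prod.ext ?_ rfl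
    ext s
    exact map_add (entry _ _) _ _
  map_smul' a ξ := by
    ext1 j
    refine Prod.ext ?_ rfl
    ext s
    exact map_smul (entry _ _) _ _

/-- A skew-symmetric matrix is freely determined by its entries below the diagonal. -/
theorem lieAlgCoords_bijective (n : ℕ) : Function.Bijective (lieAlgCoords n) := by
  constructor
  · rw [injective_iff_map_eq_zero]
    intro ξ hξ
    have h0 : ∀ j, (∀ i k : Fin n, k < i → entry i k (ξ.1 j).1 = 0) ∧ (ξ.1 j).2 = 0 := by
      intro j
      have hj := congrFun hξ j
      refine ⟨fun i k hik => ?_, congrArg Prod.snd hj⟩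
      exact congrFun (congrArg Prod.fst hj) ⟨i, ⟨k, hik⟩⟩
    refine Subtype.ext (funext fun j => Prod.ext ?_ (h0 j).2)
    rw [show (0 : lieAlg n).1 j = 0 from rfl, Prod.fst_zero]
    have hskew : ∀ i k, entry k i (ξ.1 j).1 = -entry i k (ξ.1 j).1 := by
      intro i k
      rw [← entry_tr, ξ.2 j, map_neg]
    refine ext_entry fun i k => ?_
    rw [map_zero]
    rcases lt_trichotomy i k with h | h | h
    · rw [hskew, (h0 j).1 k i h, neg_zero]
    · subst h
      linarith [hskew i i]
    · exact (h0 j).1 i k h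
  · intro f
    let M : Fin 2 → Matrix (Fin n) (Fin n) ℝ := fun j i k =>
      if h : k < i then (f j).1 ⟨i, ⟨k, h⟩⟩ else if h : i < k then -(f j).1 ⟨k, ⟨i, h⟩⟩ else 0
    have hM : ∀ j i k, M j k i = -M j i k := by
      intro j i k
      simp only [M]
      rcases lt_trichotomy i k with h | h | h
      · simp [h, h.not_gt]
      · simp [h]
      · simp [h, h.not_gt]
    refine ⟨⟨fun j => (Matrix.toEuclideanCLM (n := Fin n) (𝕜 := ℝ) (M j), (f j).2),
      fun j => ?_⟩, ?_⟩
    · refine ext_entry fun i k => ?_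
      rw [entry_tr, map_neg, entry_toEuclideanCLM, entry_toEuclideanCLM]
      exact hM j i k
    · ext1 j
      refine Prod.ext ?_ rfl
      ext ⟨i, k⟩
      refine (entry_toEuclideanCLM _ _ _).trans ?_
      have : (⟨k, k.2.trans i.2⟩ : Fin n) < i := k.2
      simp [M, this]

theorem finrank_lieAlg (n : ℕ) : finrank ℝ (lieAlg n) = dimConf n := by
  rw [(LinearEquiv.ofBijective _ (lieAlgCoords_bijective n)).finrank_eq, finrank_pi_fintype,
    Fin.sum_univ_two, finrank_prod, finrank_fintype_fun_eq_card, finrank_euclideanSpace_fin,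
    Fintype.card_sigma]
  simp only [Fintype.card_fin]
  rw [Fin.sum_univ_eq_sum_range (fun i => i) n, dimConf]
  have h := Finset.sum_range_id_mul_two n
  -- The sum formula contains the truncated difference n - 1, so n = 0 is separated.
  rcases n with _ | m
  · simp
  · simp only [Nat.add_sub_cancel] at h
    nlinarith

/-! ### Motions in the direction of a left-invariant field -/

theorem star_eq_tr (A : Mat n) : star A = tr A := ContinuousLinearMap.star_eq_adjoint A

theorem tr_exp_mul_exp {Z : Mat n} (hZ : tr Z = -Z) :
    tr (NormedSpace.exp Z) * NormedSpace.exp Z = 1 := by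
  let _ := NormedAlgebra.restrictScalars ℚ ℝ (Mat n)
  have h := NormedSpace.exp_mem_unitary_of_mem_skewAdjoint (x := Z)
    (skewAdjoint.mem_iff.2 ((star_eq_tr Z).trans hZ))
  have h1 := (Unitary.mem_iff.1 h).1
  rwa [star_eq_tr] at h1

/-- Since exp Z is the square of the orthogonal matrix exp(Z/2), its determinant is the square of
±1. -/
theorem det_exp_skew {Z : Mat n} (hZ : tr Z = -Z) : (NormedSpace.exp Z).det = 1 := by
  let _ := NormedAlgebra.restrictScalars ℚ ℝ (Mat n)
  have h2 : Z = (1 / 2 : ℝ) • Z + (1 / 2 : ℝ) • Z := by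
    rw [← add_smul]; norm_num
  have hhalf : tr ((1 / 2 : ℝ) • Z) = -((1 / 2 : ℝ) • Z) := by
    rw [← smul_neg, ← hZ]
    simp [tr]
  rw [h2, NormedSpace.exp_add_of_commute (Commute.refl _), mat_det_mul, ← sq]
  exact sq_det_of_orthogonal (tr_exp_mul_exp hhalf)

/-- A local parametrization of `SE(n) × SE(n)` near `q` by the Lie algebra. -/
def chart (q ζ : Conf n) : Conf n :=
  fun j => ((q j).1 * NormedSpace.exp (ζ j).1, (q j).1 (ζ j).2 + (q j).2)

theorem chart_mem {q ζ : Conf n} (hq : q ∈ SE2 n) (hζ : ζ ∈ lieAlg n) : chart q ζ ∈ SE2 n := by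
  intro j
  refine ⟨?_, ?_⟩
  · simp only [chart]
    rw [tr_mul, mul_assoc, ← mul_assoc (tr (q j).1), (hq j).1, one_mul, tr_exp_mul_exp (hζ j)]
  · simp only [chart]
    rw [mat_det_mul, (hq j).2, det_exp_skew (hζ j), one_mul]

theorem chart_zero (q : Conf n) : chart q 0 = q := by
  ext1 j
  simp [chart, NormedSpace.exp_zero]

theorem contDiff_chart (q : Conf n) : ContDiff ℝ ∞ (chart q) := by
  rw [contDiff_pi]
  intro j
  have hexp : ContDiff ℝ ∞ (NormedSpace.exp : Mat n → Mat n) :=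
    contDiff_iff_contDiffAt.2 fun Z => (NormedSpace.exp_analytic (𝕂 := ℝ) Z).contDiffAt
  have h1 : ContDiff ℝ ∞ (fun ζ : Conf n => (ζ j).1) := by fun_prop
  have h2 : ContDiff ℝ ∞ (fun ζ : Conf n => (ζ j).2) := by fun_prop
  exact (contDiff_const.mul (hexp.comp h1)).prodMk
    (((q j).1.contDiff.comp h2).add contDiff_const)

theorem hasFDerivAt_chart (q : Conf n) :
    HasFDerivAt (chart q) (LinearMap.toContinuousLinearMap (translateBilin q)) 0 := by
  rw [hasFDerivAt_pi']
  intro j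
  have hexp : HasFDerivAt (NormedSpace.exp : Mat n → Mat n) (1 : Mat n →L[ℝ] Mat n) 0 :=
    hasFDerivAt_exp_zero
  have h0 : HasFDerivAt (fun ζ : Conf n => ζ j) (ContinuousLinearMap.proj j) 0 :=
    (ContinuousLinearMap.proj (R := ℝ) (φ := fun _ : Fin 2 => Mat n × Pt n) j).hasFDerivAt
  have h1 := h0.fst
  have h2 := h0.snd
  have h3 := ((HasFDerivAt.comp (0 : Conf n) (by exact hexp) h1).const_mul (q j).1).prodMk
    (((q j).1.hasFDerivAt.comp (0 : Conf n) h2).add_const (q j).2)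
  refine h3.congr_fderiv ?_
  ext1 ζ
  rfl

end

end RoughBilliards

namespace RoughBilliards

noncomputable section

open Module

variable {n : ℕ}

attribute [local instance] isTopologicalAddGroup_pt moduleStateCLM

/-! ### Bodies and configurations -/

theorem eventually_lt_of_hasDerivWithinAt {g : ℝ → ℝ} {g' t₀ : ℝ}
    (h : HasDerivWithinAt g g' (Ioi t₀) t₀) (hg' : 0 < g') : ∀ᶠ t in 𝓝[>] t₀, g t₀ < g t := by
  rw [hasDerivWithinAt_iff_tendsto_slope' (by simp)] at h
  filter_upwards [h.eventually_const_lt hg', self_mem_nhdsWithin] with t ht ht0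
  rw [slope_def_field] at ht
  have : 0 < t - t₀ := sub_pos.2 ht0
  have := (div_pos_iff_of_pos_right this).1 ht
  linarith

theorem hasDerivAt_comp_line {E : Type*} [NormedAddCommGroup E] [NormedSpace ℝ E] {f : E → ℝ}
    {f' : E →L[ℝ] ℝ} {b : E} (hf : HasFDerivAt f f' b) (v : E) :
    HasDerivAt (fun t : ℝ => f (b + t • v)) (f' v) 0 := by
  have h1 : HasDerivAt (fun t : ℝ => b + t • v) v 0 := by
    simpa using ((hasDerivAt_id (0 : ℝ)).smul_const v).const_add b
  have h2 : HasFDerivAt f f' (b + (0 : ℝ) • v) := by simpa using hf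
  exact h2.comp_hasDerivAt (0 : ℝ) h1

/-- At a boundary point, moving in a direction in which the local defining function decreases leads
into {f < 0}, which is open and contained in the body. -/
theorem RigidBody.carrier_subset_closure_interior (K : RigidBody n) :
    K.carrier ⊆ closure (interior K.carrier) := by
  intro b hb
  by_cases hi : b ∈ interior K.carrier
  · exact subset_closure hi
  obtain ⟨f, U, hU, hbU, hf, hdf, hKU⟩ := K.smooth_boundary b ⟨subset_closure hb, hi⟩
  have hfb : f b ≤ 0 := (hKU.subset ⟨hb, hbU⟩).2
  have hfd : HasFDerivAt f (fderiv ℝ f b) b :=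
    ((hf.contDiffAt (hU.mem_nhds hbU)).differentiableAt (by simp)).hasFDerivAt
  obtain ⟨v, hv⟩ : ∃ v, fderiv ℝ f b v < 0 := by
    obtain ⟨v, hv⟩ : ∃ v, fderiv ℝ f b v ≠ 0 := by
      by_contra! h
      exact hdf (ContinuousLinearMap.ext h)
    rcases hv.lt_or_gt with h | h
    · exact ⟨v, h⟩
    · exact ⟨-v, by rw [map_neg]; linarith⟩
  have hopen : {x ∈ U | f x < 0} ⊆ interior K.carrier := by
    have ho : IsOpen (U ∩ f ⁻¹' Iio 0) := hf.continuousOn.isOpen_inter_preimage hU isOpen_Iio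
    refine interior_maximal (fun x hx => ?_) ho
    exact (hKU.superset ⟨hx.1, (show f x < 0 from hx.2).le⟩).1
  have h1 := eventually_lt_of_hasDerivWithinAt
    (hasDerivAt_comp_line hfd v).neg.hasDerivWithinAt (by simpa using hv)
  have hlim : Tendsto (fun t : ℝ => b + t • v) (𝓝[>] 0) (𝓝 b) := by
    have : Tendsto (fun t : ℝ => b + t • v) (𝓝 0) (𝓝 (b + (0 : ℝ) • v)) :=
      Continuous.tendsto (by fun_prop) 0
    rw [zero_smul, add_zero] at this
    exact this.mono_left nhdsWithin_le_nhds
  refine mem_closure_of_tendsto hlim ?_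
  filter_upwards [h1, hlim (hU.mem_nhds hbU)] with t ht htU
  refine hopen ⟨htU, ?_⟩
  simp only [Pi.neg_apply, zero_smul, add_zero] at ht
  linarith

theorem continuous_tr : Continuous (fun A : Mat n => tr A) :=
  (ContinuousLinearMap.adjoint (𝕜 := ℝ) (E := Pt n) (F := Pt n)).continuous

theorem isClosed_SE2 (n : ℕ) : IsClosed (SE2 n) := by
  have h : SE2 n = ⋂ j, ({q : Conf n | tr (q j).1 * (q j).1 = 1} ∩
      {q : Conf n | (q j).1.det = 1}) := by
    ext q
    simp [SE2]
  rw [h]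
  refine isClosed_iInter fun j => IsClosed.inter (isClosed_eq ?_ continuous_const)
    (isClosed_eq ?_ continuous_const)
  · have h1 : Continuous fun q : Conf n => (q j).1 := by fun_prop
    exact (continuous_tr.comp h1).mul h1
  · exact ContinuousLinearMap.continuous_det.comp (by fun_prop)

theorem confSpace_subset (B : Fin 2 → RigidBody n) : confSpace B ⊆ SE2 n :=
  closure_minimal (fun _ hq => hq.1) (isClosed_SE2 n)

theorem bdry_subset (B : Fin 2 → RigidBody n) : bdry B ⊆ SE2 n :=
  fun _ hq => confSpace_subset B hq.1

/-- Two bodies with a common point can be shifted by an arbitrarily small amount so that an interior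
point of body 0 meets a point of body 1. Such an overlap survives small perturbations, so the
shifted configuration is not in M. -/
theorem mem_closure_of_not_mem_interiorConf (B : Fin 2 → RigidBody n) {q : Conf n}
    (hq : q ∈ SE2 n) (hqi : q ∉ interiorConf B) : q ∈ closure (SE2 n \ confSpace B) := by
  have hnd : ¬ Disjoint (place (q 0) '' (B 0).carrier) (place (q 1) '' (B 1).carrier) :=
    fun h => hqi ⟨hq, h⟩
  obtain ⟨x, ⟨b₀, hb₀, hx₀⟩, ⟨b₁, hb₁, hx₁⟩⟩ := Set.not_disjoint_iff.1 hnd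
  -- Body 0 is translated so that its material point b comes to lie on the point b₁ of body 1; for b
  -- = b₀ nothing moves.
  let F : Pt n → Conf n := fun b =>
    Function.update q 0 ((q 0).1, (q 0).2 + (place (q 1) b₁ - place (q 0) b))
  have hF : Continuous F := by
    refine continuous_const.update 0 (continuous_const.prodMk ?_)
    unfold place
    fun_prop
  have hFb : F b₀ = q := by
    simp [F, hx₀, hx₁]
  have hmem : ∀ b ∈ interior (B 0).carrier, F b ∈ SE2 n \ confSpace B := by
    intro b hb
    have hF0 : F b 0 = ((q 0).1, (q 0).2 + (place (q 1) b₁ - place (q 0) b)) := by simp [F]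
    have hF1 : F b 1 = q 1 := by simp [F]
    refine ⟨?_, fun hcl => ?_⟩
    · intro j
      have : ∀ j, (F b j).1 = (q j).1 := Fin.forall_fin_two.2 ⟨by rw [hF0], by rw [hF1]⟩
      rw [this]
      exact hq j
    -- In these configurations the point b₁ of body 1 lies in the interior of body 0: an open
    -- condition that excludes M₀.
    · let N : Set (Conf n) :=
        {p | tr (p 0).1 (place (p 1) b₁ - (p 0).2) ∈ interior (B 0).carrier}
      have hN : IsOpen N := by
        refine isOpen_interior.preimage ?_
        have h1 : Continuous fun p : Conf n => tr (p 0).1 := continuous_tr.comp (by fun_prop)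
        refine h1.clm_apply ?_
        unfold place
        have h2 : Continuous fun p : Conf n => (p 1).1 b₁ :=
          Continuous.clm_apply (by fun_prop) continuous_const
        fun_prop
      have hFN : F b ∈ N := by
        change tr (F b 0).1 (place (F b 1) b₁ - (F b 0).2) ∈ interior (B 0).carrier
        rw [hF0, hF1]
        have e : place (q 1) b₁ - ((q 0).2 + (place (q 1) b₁ - place (q 0) b)) = (q 0).1 b := by
          unfold place
          abel
        simp only [e]
        rw [← mul_apply_eq_comp, (hq 0).1, one_apply_eq_self]
        exact hb
      obtain ⟨p, hpN, hp⟩ := mem_closure_iff.1 hcl N hN hFN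
      suffices hx : place (p 1) b₁ ∈ place (p 0) '' (B 0).carrier from
        Set.disjoint_left.1 hp.2 hx ⟨b₁, hb₁, rfl⟩
      refine ⟨_, interior_subset hpN, ?_⟩
      change (p 0).1 (tr (p 0).1 (place (p 1) b₁ - (p 0).2)) + (p 0).2 = _
      rw [← mul_apply_eq_comp, mul_tr_of_tr_mul (hp.1 0).1, one_apply_eq_self]
      abel
  rw [← hFb]
  exact closure_mono (image_subset_iff.2 hmem) (image_closure_subset_closure_image hF
    ⟨b₀, (B 0).carrier_subset_closure_interior hb₀, rfl⟩)

theorem not_mem_bdry_of_mem_interiorConf {B : Fin 2 → RigidBody n} (hcontact : HasUniqueContact B)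
    {q : Conf n} (hq : q ∈ interiorConf B) : q ∉ bdry B := by
  intro hb
  obtain ⟨x, hx, -⟩ := hcontact q hb
  exact Set.disjoint_left.1 hq.2 (hx 0) (hx 1)

/-- A configuration of M with a common point is a limit of configurations outside M, hence in S.
Conversely, configurations in S have a contact point, so they are not in M₀. -/
theorem mem_interiorConf_iff {B : Fin 2 → RigidBody n} (hcontact : HasUniqueContact B)
    {q : Conf n} : q ∈ interiorConf B ↔ q ∈ confSpace B ∧ q ∉ bdry B := by
  refine ⟨fun h => ⟨subset_closure h, not_mem_bdry_of_mem_interiorConf hcontact h⟩, fun h => ?_⟩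
  by_contra hi
  exact h.2 ⟨h.1, mem_closure_of_not_mem_interiorConf B (confSpace_subset B h.1) hi⟩

/-- For unbounded bodies disjointness is not obviously an open condition. Openness comes from M₀ = M
∖ S, since a point of M off S avoids the closure of the complement of M. -/
theorem interiorConf_mem_nhdsWithin {B : Fin 2 → RigidBody n} (hcontact : HasUniqueContact B)
    {q : Conf n} (hq : q ∈ interiorConf B) : interiorConf B ∈ 𝓝[SE2 n] q := by
  obtain ⟨h1, h2⟩ := (mem_interiorConf_iff hcontact).1 hq
  have h3 : q ∉ closure (SE2 n \ confSpace B) := fun h => h2 ⟨h1, h⟩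
  have h4 : (closure (SE2 n \ confSpace B))ᶜ ∈ 𝓝 q := isClosed_closure.isOpen_compl.mem_nhds h3
  filter_upwards [mem_nhdsWithin_of_mem_nhds h4, self_mem_nhdsWithin] with p hp hpS
  rw [mem_interiorConf_iff hcontact]
  refine ⟨?_, fun h => hp h.2⟩
  by_contra hpc
  exact hp (subset_closure ⟨hpS, hpc⟩)

/-! ### Local defining functions of the boundary. -/

theorem hasDerivAt_chart (q ξ : Conf n) :
    HasDerivAt (fun t : ℝ => chart q (t • ξ)) (translate q ξ) 0 := by
  have h1 : HasDerivAt (fun t : ℝ => t • ξ) ξ 0 := by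
    simpa using (hasDerivAt_id (0 : ℝ)).smul_const ξ
  have h2 : HasFDerivAt (chart q) (LinearMap.toContinuousLinearMap (translateBilin q))
      ((0 : ℝ) • ξ) := by
    rw [zero_smul]
    exact hasFDerivAt_chart q
  exact h2.comp_hasDerivAt (0 : ℝ) h1

/-- `f` is a defining function of `S` on the open set `U`. -/
structure IsDefiningOn (B : Fin 2 → RigidBody n) (f : Conf n → ℝ) (U : Set (Conf n)) : Prop where
  isOpen : IsOpen U
  contDiffOn : ContDiffOn ℝ ∞ f U
  mem_bdry_iff : ∀ p ∈ U, p ∈ SE2 n → (p ∈ bdry B ↔ f p = 0)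
  mem_interiorConf_iff : ∀ p ∈ U, p ∈ SE2 n → (p ∈ interiorConf B ↔ 0 < f p)
  exists_transverse : ∃ ξ ∈ lieAlg n, ∀ p ∈ U, fderiv ℝ f p (translate p ξ) ≠ 0

theorem IsDefiningOn.hasFDerivAt {B : Fin 2 → RigidBody n} {f : Conf n → ℝ} {U : Set (Conf n)}
    (h : IsDefiningOn B f U) {p : Conf n} (hp : p ∈ U) : HasFDerivAt f (fderiv ℝ f p) p :=
  ((h.contDiffOn.contDiffAt (h.isOpen.mem_nhds hp)).differentiableAt (by simp)).hasFDerivAt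

theorem IsDefiningOn.continuousOn_fderiv {B : Fin 2 → RigidBody n} {f : Conf n → ℝ}
    {U : Set (Conf n)} (h : IsDefiningOn B f U) : ContinuousOn (fderiv ℝ f) U :=
  h.contDiffOn.continuousOn_fderiv_of_isOpen h.isOpen (by simp)

theorem hasDerivAt_comp_chart {f : Conf n → ℝ} {f' : Conf n →L[ℝ] ℝ} {p : Conf n}
    (hf : HasFDerivAt f f' p) (ξ : Conf n) :
    HasDerivAt (fun t : ℝ => f (chart p (t • ξ))) (f' (translate p ξ)) 0 := by
  have h2 : HasFDerivAt f f' (chart p ((0 : ℝ) • ξ)) := by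
    rwa [zero_smul, chart_zero]
  exact h2.comp_hasDerivAt (0 : ℝ) (hasDerivAt_chart p ξ)

theorem tendsto_chart_line (p ξ : Conf n) :
    Tendsto (fun t : ℝ => chart p (t • ξ)) (𝓝[>] 0) (𝓝 p) := by
  have := (hasDerivAt_chart p ξ).continuousAt.tendsto
  simp only [zero_smul, chart_zero] at this
  exact this.mono_left nhdsWithin_le_nhds

/-- The smoothness hypothesis describes M by f ≥ 0 near q. On a smaller neighbourhood one direction
ξ stays transverse; then each zero of f is a limit of points with f < 0, outside M, while points
with f > 0 have a neighbourhood in M. -/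
theorem exists_isDefiningOn {B : Fin 2 → RigidBody n} (hsmooth : HasSmoothBdry B)
    (hcontact : HasUniqueContact B) {q : Conf n} (hq : q ∈ bdry B) :
    ∃ f U, q ∈ U ∧ IsDefiningOn B f U := by
  obtain ⟨f, U, hU, hqU, hf, ⟨ξ, hξ, hne⟩, hM⟩ := hsmooth q hq
  have hcont : ContinuousOn (fun p => fderiv ℝ f p (translate p ξ)) U := by
    have h1 := hf.continuousOn_fderiv_of_isOpen hU (by simp)
    have h2 : Continuous fun p : Conf n => translate p ξ :=
      (LinearMap.toContinuousLinearMap ((translateBilin (n := n)).flip ξ)).continuous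
    exact h1.clm_apply h2.continuousOn
  have hU' : IsOpen (U ∩ (fun p => fderiv ℝ f p (translate p ξ)) ⁻¹' {0}ᶜ) :=
    hcont.isOpen_inter_preimage hU isOpen_compl_singleton
  have hpos : ∀ p ∈ U, p ∈ SE2 n → 0 < f p → p ∉ bdry B := by
    intro p hpU hpS h0 hb
    have ho : IsOpen (U ∩ f ⁻¹' Ioi 0) := hf.continuousOn.isOpen_inter_preimage hU isOpen_Ioi
    obtain ⟨r, hr, hrS, hrM⟩ := mem_closure_iff.1 hb.2 _ ho ⟨hpU, h0⟩
    exact hrM (hM.superset ⟨⟨hrS, hr.1⟩, (show 0 < f r from hr.2).le⟩).1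
  have hzero : ∀ p ∈ U, fderiv ℝ f p (translate p ξ) ≠ 0 → p ∈ SE2 n → f p = 0 → p ∈ bdry B := by
    intro p hpU hpne hpS h0
    refine ⟨(hM.superset ⟨⟨hpS, hpU⟩, h0.ge⟩).1, ?_⟩
    obtain ⟨η, hη, hη0⟩ : ∃ η ∈ lieAlg n, fderiv ℝ f p (translate p η) < 0 := by
      rcases hpne.lt_or_gt with h | h
      · exact ⟨ξ, hξ, h⟩
      · refine ⟨-ξ, (lieAlg n).neg_mem hξ, ?_⟩
        rw [← translateBilin_apply, map_neg, map_neg, translateBilin_apply]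
        linarith
    have hfd : HasFDerivAt f (fderiv ℝ f p) p :=
      ((hf.contDiffAt (hU.mem_nhds hpU)).differentiableAt (by simp)).hasFDerivAt
    have h1 := eventually_lt_of_hasDerivWithinAt
      (hasDerivAt_comp_chart hfd η).neg.hasDerivWithinAt (by simpa using hη0)
    refine mem_closure_of_tendsto (tendsto_chart_line p η) ?_
    filter_upwards [h1, tendsto_chart_line p η (hU.mem_nhds hpU)] with t ht htU
    refine ⟨chart_mem hpS ((lieAlg n).smul_mem t hη), fun hc => ?_⟩
    have h2 := (hM.subset ⟨hc, htU⟩).2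
    simp only [Pi.neg_apply, zero_smul, chart_zero] at ht
    linarith
  refine ⟨f, U ∩ (fun p => fderiv ℝ f p (translate p ξ)) ⁻¹' {0}ᶜ, ⟨hqU, hne⟩, hU',
    hf.mono inter_subset_left, ?_, ?_, ξ, hξ, fun p hp => hp.2⟩
  · intro p hp hpS
    refine ⟨fun hb => ?_, hzero p hp.1 hp.2 hpS⟩
    have h1 := (hM.subset ⟨hb.1, hp.1⟩).2
    by_contra h2
    exact hpos p hp.1 hpS (lt_of_le_of_ne h1 (Ne.symm h2)) hb
  · intro p hp hpS
    rw [mem_interiorConf_iff hcontact]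
    constructor
    · intro h
      have h1 := (hM.subset ⟨h.1, hp.1⟩).2
      exact lt_of_le_of_ne h1 fun h2 => h.2 (hzero p hp.1 hp.2 hpS h2.symm)
    · intro h
      exact ⟨(hM.superset ⟨⟨hpS, hp.1⟩, h.le⟩).1, hpos p hp.1 hpS h⟩

end

end RoughBilliards

namespace RoughBilliards

noncomputable section

open Module

variable {n : ℕ}

attribute [local instance] isTopologicalAddGroup_pt moduleStateCLM

/-! ### The tangent space of the boundary -/

theorem isInvertible_real {L : ℝ →L[ℝ] ℝ} (h : L 1 ≠ 0) : L.IsInvertible := by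
  refine ⟨ContinuousLinearEquiv.unitsEquivAut ℝ (Units.mk0 (L 1) h), ?_⟩
  ext
  simp

/-- The equation f = 0 on the surface (t, r) ↦ `chart p (t • ξ + r • η)`, with η transverse, is
solved for r by the implicit function theorem. As df vanishes on ξ, r'(0) = 0 and the curve has
velocity ξ. -/
theorem IsDefiningOn.exists_curve {B : Fin 2 → RigidBody n} {f : Conf n → ℝ} {U : Set (Conf n)}
    (h : IsDefiningOn B f U) {p : Conf n} (hpU : p ∈ U) (hp : p ∈ bdry B) {ξ : Conf n}
    (hξ : ξ ∈ lieAlg n) (h0 : fderiv ℝ f p (translate p ξ) = 0) :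
    translate p ξ ∈ tangentVectors (bdry B) p := by
  obtain ⟨η, hη, hne⟩ := h.exists_transverse
  have hpS := bdry_subset B hp
  have hfp : f p = 0 := (h.mem_bdry_iff p hpU hpS).1 hp
  let ℓ : ℝ × ℝ →L[ℝ] Conf n :=
    (ContinuousLinearMap.fst ℝ ℝ ℝ).smulRight ξ + (ContinuousLinearMap.snd ℝ ℝ ℝ).smulRight η
  have hℓ : ∀ z : ℝ × ℝ, ℓ z = z.1 • ξ + z.2 • η := fun z => rfl
  have hℓmem : ∀ z, ℓ z ∈ lieAlg n := fun z =>
    (lieAlg n).add_mem ((lieAlg n).smul_mem _ hξ) ((lieAlg n).smul_mem _ hη)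
  let F : ℝ × ℝ → ℝ := fun z => f (chart p (ℓ z))
  have hbase : chart p (ℓ (0, 0)) = p := by
    rw [hℓ]
    simp [chart_zero]
  have hcurve : HasFDerivAt (fun z : ℝ × ℝ => chart p (ℓ z))
      (LinearMap.toContinuousLinearMap (translateBilin p) ∘L ℓ) (0, 0) := by
    have h1 : HasFDerivAt (chart p) (LinearMap.toContinuousLinearMap (translateBilin p))
        (ℓ (0, 0)) := by
      have : ℓ (0, 0) = 0 := by rw [hℓ]; simp
      rw [this]
      exact hasFDerivAt_chart p
    exact h1.comp (0, 0) ℓ.hasFDerivAt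
  have hF' : HasFDerivAt F
      (fderiv ℝ f p ∘L LinearMap.toContinuousLinearMap (translateBilin p) ∘L ℓ) (0, 0) := by
    have h1 : HasFDerivAt f (fderiv ℝ f p) (chart p (ℓ (0, 0))) := by
      rw [hbase]
      exact h.hasFDerivAt hpU
    exact h1.comp (0, 0) hcurve
  have hcd : ContDiffAt ℝ ∞ F (0, 0) := by
    have h1 : ContDiffAt ℝ ∞ f (chart p (ℓ (0, 0))) := by
      rw [hbase]
      exact h.contDiffOn.contDiffAt (h.isOpen.mem_nhds hpU)
    exact h1.comp (0, 0) ((contDiff_chart p).comp ℓ.contDiff).contDiffAt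
  have hr : (fderiv ℝ F (0, 0) ∘L .inr ℝ ℝ ℝ).IsInvertible := by
    refine isInvertible_real ?_
    rw [hF'.fderiv]
    change fderiv ℝ f p (translate p (ℓ (0, 1))) ≠ 0
    rw [hℓ]
    simpa using hne p hpU
  have hl : fderiv ℝ F (0, 0) ∘L .inl ℝ ℝ ℝ = 0 := by
    ext
    rw [hF'.fderiv]
    change fderiv ℝ f p (translate p (ℓ (1, 0))) = 0
    rw [hℓ]
    simpa using h0
  have hinf : (∞ : WithTop ℕ∞) ≠ 0 := by simp
  let r := hcd.implicitFunction hinf hr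
  have hr0 : r 0 = 0 := hcd.implicitFunction_apply_self hinf hr
  have hrc : ContDiffAt ℝ ∞ r 0 := hcd.contDiffAt_implicitFunction hinf hr
  have hrd : HasDerivAt r 0 0 := by
    have := (hcd.hasStrictFDerivAt_implicitFunction hinf hr).hasFDerivAt
    rw [hl, ContinuousLinearMap.comp_zero] at this
    simpa using this.hasDerivAt
  have hre : ∀ᶠ t in 𝓝 (0 : ℝ), F (t, r t) = F (0, 0) :=
    hcd.eventually_apply_implicitFunction hinf hr
  have hpair : HasDerivAt (fun t : ℝ => (t, r t)) (1, 0) 0 := (hasDerivAt_id 0).prodMk hrd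
  have hder : HasDerivAt (fun t : ℝ => chart p (ℓ (t, r t))) (translate p ξ) 0 := by
    have h1 : HasFDerivAt (fun z : ℝ × ℝ => chart p (ℓ z))
      (LinearMap.toContinuousLinearMap (translateBilin p) ∘L ℓ) (0, r 0) := by rwa [hr0]
    have h2 := h1.comp_hasDerivAt (0 : ℝ) hpair
    have h3 : (LinearMap.toContinuousLinearMap (translateBilin p) ∘L ℓ) (1, 0) = translate p ξ := by
      change translate p (ℓ (1, 0)) = _
      rw [hℓ]
      simp
    rwa [h3] at h2
  refine ⟨fun t => chart p (ℓ (t, r t)), ?_, ?_, ?_, hder⟩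
  · exact ((contDiff_chart p).comp ℓ.contDiff).contDiffAt.comp (0 : ℝ)
      (contDiffAt_id.prodMk hrc)
  · simp only [hr0, hbase]
  · have hU : ∀ᶠ t in 𝓝 (0 : ℝ), chart p (ℓ (t, r t)) ∈ U := by
      refine hder.continuousAt.eventually_mem (h.isOpen.mem_nhds ?_)
      simpa only [hr0, hbase] using hpU
    filter_upwards [hre, hU] with t ht htU
    rw [h.mem_bdry_iff _ htU (chart_mem hpS (hℓmem _))]
    exact ht.trans ((congrArg f hbase).trans hfp)

theorem IsDefiningOn.fderiv_eq_zero_of_curve {B : Fin 2 → RigidBody n} {f : Conf n → ℝ}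
    {U : Set (Conf n)} (h : IsDefiningOn B f U) {p : Conf n} (hpU : p ∈ U) {c : ℝ → Conf n}
    {X : Conf n} (hc : HasDerivAt c X 0) (hc0 : c 0 = p) (hcb : ∀ᶠ t in 𝓝 0, c t ∈ bdry B) :
    fderiv ℝ f p X = 0 := by
  have h1 : HasFDerivAt f (fderiv ℝ f p) (c 0) := by
    rw [hc0]
    exact h.hasFDerivAt hpU
  have h2 := h1.comp_hasDerivAt (0 : ℝ) hc
  have h3 : (f ∘ c) =ᶠ[𝓝 0] fun _ => 0 := by
    have hU : ∀ᶠ t in 𝓝 (0 : ℝ), c t ∈ U :=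
      hc.continuousAt.eventually_mem (h.isOpen.mem_nhds (by rwa [hc0]))
    filter_upwards [hcb, hU] with t ht htU
    exact (h.mem_bdry_iff _ htU (bdry_subset B ht)).1 ht
  exact h2.unique ((hasDerivAt_const (0 : ℝ) (0 : ℝ)).congr_of_eventuallyEq h3)

theorem IsDefiningOn.mem_bdryTangent_iff {B : Fin 2 → RigidBody n} {f : Conf n → ℝ}
    {U : Set (Conf n)} (h : IsDefiningOn B f U) {p : Conf n} (hpU : p ∈ U) (hp : p ∈ bdry B)
    {ξ : Conf n} : ξ ∈ bdryTangent B p ↔ ξ ∈ lieAlg n ∧ fderiv ℝ f p (translate p ξ) = 0 := by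
  constructor
  · rintro ⟨hξ, c, -, hc0, hcb, hc⟩
    exact ⟨hξ, h.fderiv_eq_zero_of_curve hpU hc hc0 hcb⟩
  · rintro ⟨hξ, h0⟩
    exact ⟨hξ, h.exists_curve hpU hp hξ h0⟩

/-- The normal is the normalized gradient of a local defining function f. It points into M because f
becomes positive along it. -/
theorem exists_isInwardNormal {B : Fin 2 → RigidBody n} (hsmooth : HasSmoothBdry B)
    (hcontact : HasUniqueContact B) {q : Conf n} (hq : q ∈ bdry B) :
    ∃ ν, IsInwardNormal B q ν ∧ ∀ ξ, ξ ∈ bdryTangent B q ↔ ξ ∈ lieAlg n ∧ kin B ξ ν = 0 := by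
  obtain ⟨f, U, hqU, h⟩ := exists_isDefiningOn hsmooth hcontact hq
  have hqS := bdry_subset B hq
  let ℓ : Conf n →ₗ[ℝ] ℝ := (fderiv ℝ f q).toLinearMap ∘ₗ translateBilin q
  let ν₀ := riesz B ℓ
  have hν₀ : ν₀ ∈ lieAlg n := riesz_mem B ℓ
  have hkin : ∀ ξ ∈ lieAlg n, kin B ν₀ ξ = fderiv ℝ f q (translate q ξ) := fun ξ hξ =>
    kin_riesz B ℓ hξ
  have hne : ν₀ ≠ 0 := by
    obtain ⟨η, hη, hη0⟩ := h.exists_transverse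
    intro h0
    apply hη0 q hqU
    rw [← hkin η hη, h0, ← kinBilin_apply, map_zero]
    rfl
  have hpos := kin_pos B hν₀ hne
  have hs := Real.sqrt_pos.2 hpos
  let a := (√(kin B ν₀ ν₀))⁻¹
  have ha : 0 < a := inv_pos.2 hs
  have hkin' : ∀ ξ ∈ lieAlg n, kin B (a • ν₀) ξ = a * fderiv ℝ f q (translate q ξ) := by
    intro ξ hξ
    rw [← kinBilin_apply, map_smul (kinBilin B), LinearMap.smul_apply, kinBilin_apply, hkin ξ hξ,
      smul_eq_mul]
  have haν : a • ν₀ ∈ lieAlg n := (lieAlg n).smul_mem a hν₀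
  have hchar : ∀ ξ, ξ ∈ bdryTangent B q ↔ ξ ∈ lieAlg n ∧ kin B ξ (a • ν₀) = 0 := by
    intro ξ
    rw [h.mem_bdryTangent_iff hqU hq]
    refine and_congr_right fun hξ => ?_
    rw [kin_comm, hkin' ξ hξ]
    simp [ha.ne']
  have hunit : kin B (a • ν₀) (a • ν₀) = 1 := by
    rw [hkin' _ haν, ← hkin _ haν, kin_comm, hkin' _ hν₀, ← hkin _ hν₀]
    have : kin B ν₀ ν₀ = √(kin B ν₀ ν₀) * √(kin B ν₀ ν₀) := (Real.mul_self_sqrt hpos.le).symm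
    simp only [a]
    field_simp
    rw [sq, ← this]
  refine ⟨a • ν₀, ⟨haν, hunit, ?_, ?_⟩, hchar⟩
  · intro ξ hξ
    rw [kin_comm]
    exact ((hchar ξ).1 hξ).2
  · refine ⟨fun t => chart q (t • (a • ν₀)), ?_, by simp [chart_zero], hasDerivAt_chart q _, ?_⟩
    · exact ((contDiff_chart q).comp (contDiff_id.smul contDiff_const)).contDiffAt
    · have hd : 0 < fderiv ℝ f q (translate q (a • ν₀)) := by
        have := hkin' _ haν
        rw [hunit] at this
        nlinarith
      have h1 := eventually_lt_of_hasDerivWithinAt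
        (hasDerivAt_comp_chart (h.hasFDerivAt hqU) (a • ν₀)).hasDerivWithinAt hd
      have hU := tendsto_chart_line q (a • ν₀) (h.isOpen.mem_nhds hqU)
      rw [← Ioi_insert, nhdsWithin_insert, eventually_sup]
      refine ⟨?_, ?_⟩
      · simpa [chart_zero] using hq.1
      · filter_upwards [h1, hU] with t ht htU
        simp only [zero_smul, chart_zero] at ht
        rw [(h.mem_bdry_iff q hqU hqS).1 hq] at ht
        exact subset_closure ((h.mem_interiorConf_iff _ htU
          (chart_mem hqS ((lieAlg n).smul_mem t haν))).2 ht)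

/-- The tangent space of `S` as a subspace of the Lie algebra. -/
theorem exists_tangentSubmodule {B : Fin 2 → RigidBody n} (hsmooth : HasSmoothBdry B)
    (hcontact : HasUniqueContact B) {q : Conf n} (hq : q ∈ bdry B) {C : Conf n →ₗ[ℝ] Conf n}
    (hC : IsStrictCollisionMap B q C) :
    ∃ ν ∈ lieAlg n, kin B ν ν = 1 ∧ (∀ ξ, ξ ∈ bdryTangent B q ↔ ξ ∈ lieAlg n ∧ kin B ξ ν = 0) ∧
      C ν = -ν := by
  obtain ⟨ν, hν, hchar⟩ := exists_isInwardNormal hsmooth hcontact hq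
  -- The half-space condition for both ξ and -ξ shows that C maps the orthogonal complement of ν
  -- into itself.
  have hmap : ∀ ξ ∈ lieAlg n, kin B ξ ν = 0 → kin B (C ξ) ν = 0 := by
    intro ξ hξ h0
    have h1 := hC.mapsTo_halfSpace ν hν ξ hξ h0.le
    have h2 := hC.mapsTo_halfSpace ν hν (-ξ) ((lieAlg n).neg_mem hξ) (by
      rw [← kinBilin_apply, map_neg, LinearMap.neg_apply, kinBilin_apply, h0, neg_zero])
    rw [map_neg, ← kinBilin_apply, map_neg, LinearMap.neg_apply, kinBilin_apply] at h2
    linarith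
  refine ⟨ν, hν.mem, hν.unit, hchar, ?_⟩
  have hCν := hC.mapsTo ν hν.mem
  set s := kin B (C ν) ν with hs
  -- Being an isometric involution, C lets ⟨Cν, τ⟩ be rewritten as ⟨ν, Cτ⟩, which is zero for τ
  -- orthogonal to ν. So Cν is a multiple of ν.
  have hCs : C ν = s • ν := by
    refine eq_of_forall_kin_eq B hCν ((lieAlg n).smul_mem s hν.mem) fun σ hσ => ?_
    let τ := σ - kin B σ ν • ν
    have hτ : τ ∈ lieAlg n := (lieAlg n).sub_mem hσ ((lieAlg n).smul_mem _ hν.mem)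
    have hτν : kin B τ ν = 0 := by
      rw [← kinBilin_apply, map_sub (kinBilin B), LinearMap.sub_apply, map_smul (kinBilin B),
        LinearMap.smul_apply, kinBilin_apply, kinBilin_apply, hν.unit, smul_eq_mul, mul_one,
        sub_self]
    have h1 : kin B (C ν) τ = 0 := by
      have h2 := hC.conserves_energy (C τ) (hC.mapsTo _ hτ) ν hν.mem
      rw [hC.involutive τ hτ] at h2
      rw [h2, kin_comm, hmap τ hτ hτν]
    have h3 : σ = τ + kin B σ ν • ν := by simp [τ]
    have h4 : kin B (C ν) σ = kin B σ ν * s := by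
      conv_lhs => rw [h3]
      rw [← kinBilin_apply, map_add, map_smul, kinBilin_apply, kinBilin_apply, h1, zero_add,
        smul_eq_mul]
    rw [h4, ← kinBilin_apply B (s • ν) σ, map_smul (kinBilin B), LinearMap.smul_apply,
      kinBilin_apply, smul_eq_mul, kin_comm B ν σ, mul_comm]
  -- The vector -ν points out of M and must be sent to the other side; with s² = 1 this leaves s =
  -- -1.
  have hs0 : s ≤ 0 := by
    have h1 := hC.mapsTo_halfSpace ν hν (-ν) ((lieAlg n).neg_mem hν.mem) (by
      rw [← kinBilin_apply, map_neg, LinearMap.neg_apply, kinBilin_apply, hν.unit]; norm_num)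
    rw [map_neg, ← kinBilin_apply, map_neg, LinearMap.neg_apply, kinBilin_apply] at h1
    linarith
  have hs2 : s * s = 1 := by
    have h1 := hC.conserves_energy ν hν.mem ν hν.mem
    rw [hCs, hν.unit, ← kinBilin_apply, map_smul, map_smul, LinearMap.smul_apply, kinBilin_apply,
      hν.unit] at h1
    simpa using h1
  have : s = -1 := by nlinarith
  rw [hCs, this, neg_one_smul]

theorem IsStrictCollisionMap.mem_bdryTangent {B : Fin 2 → RigidBody n} (hsmooth : HasSmoothBdry B)
    (hcontact : HasUniqueContact B) {q : Conf n} (hq : q ∈ bdry B) {C : Conf n →ₗ[ℝ] Conf n}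
    (hC : IsStrictCollisionMap B q C) {ξ : Conf n} (hξ : ξ ∈ bdryTangent B q) :
    C ξ ∈ bdryTangent B q := by
  obtain ⟨ν, hν, -, hchar, hCν⟩ := exists_tangentSubmodule hsmooth hcontact hq hC
  obtain ⟨h1, h2⟩ := (hchar ξ).1 hξ
  refine (hchar _).2 ⟨hC.mapsTo ξ h1, ?_⟩
  have h3 := hC.conserves_energy ν hν ξ h1
  rw [hCν, h2, ← kinBilin_apply, map_neg, kinBilin_apply] at h3
  linarith

end

end RoughBilliards

namespace RoughBilliards

noncomputable section

open Module

variable {n : ℕ}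

attribute [local instance] isTopologicalAddGroup_pt moduleStateCLM

/-! ### Force-free motions -/

/-- Vectors of the Lie algebra are expanded by linear forms that are defined on the whole of `Conf
n`. This reduces differentiability of Lie algebra valued functions, and of C_p ξ jointly in p and ξ,
to finitely many components. -/
theorem exists_lieAlg_coords (n : ℕ) : ∃ (m : ℕ) (e : Fin m → Conf n) (ℓ : Fin m → Conf n →ₗ[ℝ] ℝ),
    (∀ k, e k ∈ lieAlg n) ∧ ∀ ξ ∈ lieAlg n, ∑ k, ℓ k ξ • e k = ξ := by
  obtain ⟨P, hP⟩ := (lieAlg n).subtype.exists_leftInverse_of_injective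
    (LinearMap.ker_eq_bot.2 (lieAlg n).injective_subtype)
  let b := Module.finBasis ℝ (lieAlg n)
  refine ⟨_, fun k => b k, fun k => b.coord k ∘ₗ P, fun k => (b k).2, fun ξ hξ => ?_⟩
  have h1 : P ξ = ⟨ξ, hξ⟩ := LinearMap.congr_fun hP ⟨ξ, hξ⟩
  have h2 := congrArg (lieAlg n).subtype (b.sum_repr ⟨ξ, hξ⟩)
  rw [map_sum] at h2
  simpa [h1] using h2

/-- The transpose as a continuous linear map. -/
def trCLM (n : ℕ) : Mat n →L[ℝ] Mat n :=
  LinearMap.toContinuousLinearMap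
    { toFun := fun A => tr A
      map_add' := fun A B => by simp [tr]
      map_smul' := fun a A => by simp [tr] }

theorem trCLM_apply (A : Mat n) : trCLM n A = tr A := rfl

theorem hasDerivWithinAt_tr {f : ℝ → Mat n} {f' : Mat n} {s : Set ℝ} {t : ℝ}
    (hf : HasDerivWithinAt f f' s t) : HasDerivWithinAt (fun u => tr (f u)) (tr f') s t :=
  (trCLM n).hasFDerivAt.comp_hasDerivWithinAt t hf

theorem hasDerivWithinAt_bilin {E F G : Type*} [NormedAddCommGroup E] [NormedSpace ℝ E]
    [NormedAddCommGroup F] [NormedSpace ℝ F] [NormedAddCommGroup G] [NormedSpace ℝ G]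
    [FiniteDimensional ℝ E] [FiniteDimensional ℝ F]
    (b : E →ₗ[ℝ] F →ₗ[ℝ] G) {f : ℝ → E} {g : ℝ → F} {f' : E} {g' : F} {s : Set ℝ} {t : ℝ}
    (hf : HasDerivWithinAt f f' s t) (hg : HasDerivWithinAt g g' s t) :
    HasDerivWithinAt (fun u => b (f u) (g u)) (b f' (g t) + b (f t) g') s t := by
  have h := ((LinearMap.toContinuousBilinearMap b).hasFDerivAt.comp_hasDerivWithinAt t hf).clm_apply
    hg
  exact h

theorem hasDerivWithinAt_kin (B : Fin 2 → RigidBody n) {f g : ℝ → Conf n} {f' g' : Conf n}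
    {s : Set ℝ} {t : ℝ} (hf : HasDerivWithinAt f f' s t) (hg : HasDerivWithinAt g g' s t) :
    HasDerivWithinAt (fun u => kin B (f u) (g u)) (kin B f' (g t) + kin B (f t) g') s t :=
  hasDerivWithinAt_bilin (kinBilin B) hf hg

/-- Inverse of the adjoint action. -/
def coAdj (q w : Conf n) : Conf n :=
  fun j => (tr (q j).1 * ((w j).1 * (q j).1), tr (q j).1 ((w j).1 (q j).2 + (w j).2))

/-- The adjoint action. -/
def adj (q w : Conf n) : Conf n :=
  fun j => ((q j).1 * (w j).1 * tr (q j).1,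
    (q j).1 (w j).2 - ((q j).1 * (w j).1 * tr (q j).1) (q j).2)

theorem coAdj_adj {q : Conf n} (hq : q ∈ SE2 n) (w : Conf n) : coAdj q (adj q w) = w := by
  ext1 j
  have h := (hq j).1
  refine Prod.ext ?_ ?_
  · simp only [coAdj, adj]
    rw [mul_assoc, h, mul_one, ← mul_assoc, h, one_mul]
  · simp only [coAdj, adj, add_sub_cancel]
    rw [← mul_apply_eq_comp, h, one_apply_eq_self]

theorem adj_mem (q : Conf n) {w : Conf n} (hw : w ∈ lieAlg n) : adj q w ∈ lieAlg n := by
  intro j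
  have h := hw j
  simp only [adj]
  rw [tr_mul, tr_mul, tr_tr, h]
  simp [mul_assoc]

theorem coAdj_mem (q : Conf n) {w : Conf n} (hw : w ∈ lieAlg n) : coAdj q w ∈ lieAlg n := by
  intro j
  have h := hw j
  simp only [coAdj]
  rw [tr_mul, tr_mul, tr_tr, h]
  simp [mul_assoc]

/-- The infinitesimal action of w at q left-translates to Ad(q⁻¹)w. Conservation of the momenta of
both bodies therefore makes ⟨ξ, Ad(q⁻¹)w⟩ constant for every w in 𝔤 × 𝔤. -/
theorem sum_momentum (B : Fin 2 → RigidBody n) (q ξ w : Conf n) :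
    ∑ j, momentum B j q ξ (w j) = kin B ξ (coAdj q w) := rfl

theorem momentum_eq (B : Fin 2 → RigidBody n) (j : Fin 2) (q ξ : Conf n) (w : Mat n × Pt n) :
    momentum B j q ξ w = kin B ξ (coAdj q (Pi.single j w)) := by
  rw [← sum_momentum, Finset.sum_eq_single j]
  · simp
  · intro i _ hij
    simp [momentum, hij, bodyForm]
  · simp

theorem hasDerivWithinAt_coAdj {q : ℝ → Conf n} {ξ : Conf n} {s : Set ℝ} {t : ℝ}
    (hξ : ξ ∈ lieAlg n) (hq : HasDerivWithinAt q (translate (q t) ξ) s t) (w : Conf n) :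
    HasDerivWithinAt (fun u => coAdj (q u) w) (-bracket ξ (coAdj (q t) w)) s t := by
  rw [hasDerivWithinAt_pi]
  intro j
  have h := hasDerivWithinAt_pi.1 hq j
  have h1 : HasDerivWithinAt (fun u => (q u j).1) ((q t j).1 * (ξ j).1) s t := h.fst
  have h2 : HasDerivWithinAt (fun u => (q u j).2) ((q t j).1 (ξ j).2) s t := h.snd
  have h3 := hasDerivWithinAt_tr h1
  have h4 := h3.mul (h1.const_mul (w j).1)
  have h5 := h3.clm_apply ((((w j).1.hasFDerivAt.comp_hasDerivWithinAt t h2)).add_const (w j).2)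
  have h6 := hξ j
  refine (h4.prodMk h5).congr_deriv ?_
  refine Prod.ext ?_ ?_
  · simp only [Pi.neg_apply, bracket_apply, coAdj, Prod.fst_neg]
    rw [tr_mul, h6]
    noncomm_ring
  · simp only [Pi.neg_apply, bracket_apply, coAdj, Prod.snd_neg]
    rw [tr_mul, h6]
    simp only [mul_apply_eq_comp, neg_apply, Function.comp_apply]
    abel

theorem hasDerivWithinAt_adj {q : ℝ → Conf n} {ξ : Conf n} {s : Set ℝ} {t : ℝ}
    (hξ : ξ ∈ lieAlg n) (hqt : q t ∈ SE2 n) (hq : HasDerivWithinAt q (translate (q t) ξ) s t)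
    (w : Conf n) :
    HasDerivWithinAt (fun u => coAdj (q t) (adj (q u) w)) (bracket ξ w) s t := by
  rw [hasDerivWithinAt_pi]
  intro j
  have h := hasDerivWithinAt_pi.1 hq j
  have h0 := (hqt j).1
  have h1 : HasDerivWithinAt (fun u => (q u j).1) ((q t j).1 * (ξ j).1) s t := h.fst
  have h2 : HasDerivWithinAt (fun u => (q u j).2) ((q t j).1 (ξ j).2) s t := h.snd
  have h3 := hasDerivWithinAt_tr h1
  have h4 := (h1.mul_const (w j).1).mul h3
  have h5 := (h1.clm_apply (hasDerivWithinAt_const t s (w j).2)).sub (h4.clm_apply h2)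
  have h6 := hξ j
  have h7 := (h4.mul_const (q t j).1).const_mul (tr (q t j).1)
  have h8 := (tr (q t j).1).hasFDerivAt.comp_hasDerivWithinAt t
    ((h4.clm_apply (hasDerivWithinAt_const t s (q t j).2)).add h5)
  refine (h7.prodMk h8).congr_deriv ?_
  have h9 : ∀ x, tr (q t j).1 ((q t j).1 x) = x := fun x => by
    rw [← mul_apply_eq_comp, h0, one_apply_eq_self]
  refine Prod.ext ?_ ?_
  · ext1 x
    simp only [bracket_apply]
    rw [tr_mul, h6]
    simp only [mul_apply_eq_comp, add_apply, sub_apply, neg_apply, map_add, map_neg, h9]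
    abel
  · simp only [bracket_apply]
    rw [tr_mul, h6]
    simp only [Pi.mul_apply, mul_apply_eq_comp, add_apply, neg_apply, map_add, map_neg, map_sub, h9,
      map_zero]
    abel

theorem IsFreeMotion.kin_coAdj_eq {B : Fin 2 → RigidBody n} {c : ℝ → State n} {τ : ℝ}
    (h : IsFreeMotion B c τ) {w : Conf n} (hw : w ∈ lieAlg n) {s t : ℝ} (hs : s ∈ Icc 0 τ)
    (ht : t ∈ Icc 0 τ) :
    kin B (c s).2 (coAdj (c s).1 w) = kin B (c t).2 (coAdj (c t).1 w) := by
  have key : ∀ u ∈ Icc 0 τ, kin B (c u).2 (coAdj (c u).1 w) -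
      kin B (c 0).2 (coAdj (c 0).1 w) = 0 := by
    refine eq_zero_of_hasDerivWithinAt_of_bound (f' := fun _ => 0) (K := 0) (fun u hu => ?_)
      (sub_self _) (by simp)
    refine HasDerivWithinAt.sub_const _ ?_
    have h1 := HasDerivWithinAt.fun_sum (u := Finset.univ) fun j _ => (h u hu).2.2.2 j (w j) (hw j)
    simp only [Finset.sum_const_zero] at h1
    exact h1
  rw [sub_eq_zero.1 (key s hs), sub_eq_zero.1 (key t ht)]

/-- Force-free motions solve the first-order equation of motion. -/
theorem IsFreeMotion.hasDerivWithinAt {B : Fin 2 → RigidBody n} {c : ℝ → State n} {τ : ℝ}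
    (h : IsFreeMotion B c τ) {t : ℝ} (ht : t ∈ Icc 0 τ) :
    HasDerivWithinAt c (freeField B (c t) (c t)) (Icc 0 τ) t := by
  obtain ⟨hq, hξ, hd, -⟩ := h t ht
  have hkin : ∀ σ ∈ lieAlg n, HasDerivWithinAt (fun s => kin B (c s).2 σ)
      (kin B (euler B (c t).2 (c t).2) σ) (Icc 0 τ) t := by
    intro σ hσ
    have h0 := hasDerivWithinAt_adj (q := fun s => (c s).1) hξ hq hd σ
    have h1 := hasDerivWithinAt_kin B (f := fun _ => (c t).2)
      (hasDerivWithinAt_const t (Icc 0 τ) (c t).2) h0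
    -- Momentum conservation is applied to w = Ad(q(s))σ, which depends on s. The velocity ξ(s), not
    -- assumed differentiable, is thereby replaced by the fixed ξ(t) paired with a differentiable
    -- vector.
    have h2 : ∀ s ∈ Icc 0 τ, kin B (c s).2 σ = kin B (c t).2 (coAdj (c t).1 (adj (c s).1 σ)) := by
      intro s hs
      have h3 := h.kin_coAdj_eq (adj_mem (c s).1 hσ) hs ht
      rwa [coAdj_adj (h s hs).1] at h3
    have h4 := h1.congr h2 (h2 t ht)
    refine h4.congr_deriv ?_
    rw [kin_euler B _ _ hσ, ← kinBilin_apply, map_zero, LinearMap.zero_apply, zero_add]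
  have hξ' : HasDerivWithinAt (fun s => (c s).2) (euler B (c t).2 (c t).2) (Icc 0 τ) t := by
    obtain ⟨m, e, ℓ, -, hℓ⟩ := exists_lieAlg_coords n
    -- The velocity is recovered from finitely many of its inner products, whose derivatives are
    -- known.
    have h3 : ∀ ξ ∈ lieAlg n, ∑ k, kin B ξ (riesz B (ℓ k)) • e k = ξ := by
      intro ξ hξ
      conv_rhs => rw [← hℓ ξ hξ]
      exact Finset.sum_congr rfl fun k _ => by rw [kin_comm, kin_riesz B _ hξ]
    have h4 := HasDerivWithinAt.fun_sum (u := Finset.univ) fun k _ =>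
      (hkin _ (riesz_mem B (ℓ k))).smul_const (e k)
    rw [h3 _ (euler_mem B _ _)] at h4
    exact h4.congr (fun s hs => (h3 _ (h s hs).2.1).symm) (h3 _ hξ).symm
  exact hd.prodMk hξ'

theorem bounded_of_continuousOn_Icc {E : Type*} [NormedAddCommGroup E] {f : ℝ → E} {a b : ℝ}
    (hf : ContinuousOn f (Icc a b)) : ∃ K, 0 ≤ K ∧ ∀ s ∈ Icc a b, ‖f s‖ ≤ K := by
  obtain ⟨K, hK⟩ := isCompact_Icc.exists_bound_of_continuousOn hf
  exact ⟨max K 0, le_max_right _ _, fun s hs => (hK s hs).trans (le_max_left _ _)⟩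

/-- β(c, c) - β(d, d) is linear in c - d with coefficients bounded on the interval, so the
difference of the solutions vanishes. -/
theorem eqOn_of_hasDerivWithinAt_quadratic {E : Type*} [NormedAddCommGroup E] [NormedSpace ℝ E]
    (β : E →L[ℝ] E →L[ℝ] E) {c d : ℝ → E} {a b : ℝ}
    (hc : ∀ s ∈ Icc a b, HasDerivWithinAt c (β (c s) (c s)) (Icc a b) s)
    (hd : ∀ s ∈ Icc a b, HasDerivWithinAt d (β (d s) (d s)) (Icc a b) s) (h0 : c a = d a) :
    ∀ s ∈ Icc a b, c s = d s := by
  obtain ⟨K, hK0, hK⟩ := bounded_of_continuousOn_Icc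
    (fun s hs => (hc s hs).continuousWithinAt : ContinuousOn c _)
  obtain ⟨L, hL0, hL⟩ := bounded_of_continuousOn_Icc
    (fun s hs => (hd s hs).continuousWithinAt : ContinuousOn d _)
  have key := eq_zero_of_hasDerivWithinAt_of_bound (f := fun s => c s - d s)
    (f' := fun s => β (c s) (c s) - β (d s) (d s)) (K := ‖β‖ * K + ‖β‖ * L)
    (fun s hs => (hc s hs).sub (hd s hs)) (sub_eq_zero.2 h0) ?_
  · exact fun s hs => sub_eq_zero.1 (key s hs)
  · intro s hs
    have h1 : β (c s) (c s) - β (d s) (d s) = β (c s) (c s - d s) + β (c s - d s) (d s) := by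
      simp
    rw [h1, add_mul]
    refine (norm_add_le _ _).trans (add_le_add ?_ ?_)
    · refine (β.le_opNorm₂ _ _).trans ?_
      gcongr
      exact hK s hs
    · refine (β.le_opNorm₂ _ _).trans ?_
      rw [mul_right_comm]
      gcongr
      exact hL s hs

theorem IsFreeMotion.mono {B : Fin 2 → RigidBody n} {c : ℝ → State n} {τ τ' : ℝ}
    (h : IsFreeMotion B c τ) (hτ : τ' ≤ τ) : IsFreeMotion B c τ' := by
  intro t ht
  have hsub : Icc 0 τ' ⊆ Icc 0 τ := Icc_subset_Icc_right hτ
  obtain ⟨h1, h2, h3, h4⟩ := h t (hsub ht)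
  exact ⟨h1, h2, h3.mono hsub, fun j w hw => (h4 j w hw).mono hsub⟩

theorem IsFreeMotion.eqOn {B : Fin 2 → RigidBody n} {c d : ℝ → State n} {τ : ℝ}
    (hc : IsFreeMotion B c τ) (hd : IsFreeMotion B d τ) (h0 : c 0 = d 0) :
    ∀ t ∈ Icc 0 τ, c t = d t :=
  eqOn_of_hasDerivWithinAt_quadratic (freeField B) (fun _ hs => hc.hasDerivWithinAt hs)
    (fun _ hs => hd.hasDerivWithinAt hs) h0

/-- Both motions agree as long as both are defined. If one ended earlier, its end point would lie
both on S and, seen on the longer motion, in M₀. -/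
theorem IsNextCollision.unique {B : Fin 2 → RigidBody n} (hcontact : HasUniqueContact B)
    {x y y' : State n} (h : IsNextCollision B x y) (h' : IsNextCollision B x y') : y = y' := by
  obtain ⟨τ, hτ, c, hc, hc0, hcτ, hci, hy⟩ := h
  obtain ⟨τ', hτ', c', hc', hc0', hcτ', hci', hy'⟩ := h'
  rcases lt_trichotomy τ τ' with hlt | heq | hgt
  · have h1 := hc.eqOn (hc'.mono hlt.le) (hc0.trans hc0'.symm) τ ⟨hτ.le, le_rfl⟩
    rw [← hcτ, h1] at hy
    exact absurd hy (not_mem_bdry_of_mem_interiorConf hcontact (hci' τ ⟨hτ, hlt⟩))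
  · subst heq
    rw [← hcτ, ← hcτ']
    exact hc.eqOn hc' (hc0.trans hc0'.symm) τ ⟨hτ.le, le_rfl⟩
  · have h1 := (hc.mono hgt.le).eqOn hc' (hc0.trans hc0'.symm) τ' ⟨hτ'.le, le_rfl⟩
    rw [← hcτ', ← h1] at hy'
    exact absurd hy' (not_mem_bdry_of_mem_interiorConf hcontact (hci τ' ⟨hτ', hgt⟩))

theorem IsNextCollision.billiardMap_eq {B : Fin 2 → RigidBody n} (hcontact : HasUniqueContact B)
    (C : Conf n → Conf n →ₗ[ℝ] Conf n) {x y : State n} (h : IsNextCollision B x y) :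
    billiardMap B C x = collide C y := by
  obtain ⟨z, hz, he⟩ := Classical.epsilon_spec
    (p := fun z => ∃ y, IsNextCollision B x y ∧ z = collide C y) ⟨_, y, h, rfl⟩
  rw [billiardMap, he, h.unique hcontact hz]

/-- Solutions of the first-order equation of motion are force-free motions. -/
theorem isFreeMotion_of_hasDerivWithinAt {B : Fin 2 → RigidBody n} {c : ℝ → State n} {τ : ℝ}
    (hc : ∀ t ∈ Icc 0 τ, HasDerivWithinAt c (freeField B (c t) (c t)) (Icc 0 τ) t)
    (hq : (c 0).1 ∈ SE2 n) (hξ : (c 0).2 ∈ lieAlg n) : IsFreeMotion B c τ := by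
  have hc1 : ∀ t ∈ Icc 0 τ,
      HasDerivWithinAt (fun s => (c s).1) (translate (c t).1 (c t).2) (Icc 0 τ) t :=
    fun t ht => (hc t ht).fst
  have hc2 : ∀ t ∈ Icc 0 τ,
      HasDerivWithinAt (fun s => (c s).2) (euler B (c t).2 (c t).2) (Icc 0 τ) t :=
    fun t ht => (hc t ht).snd
  have hA : ∀ t ∈ Icc 0 τ, ∀ j, HasDerivWithinAt (fun s => ((c s).1 j).1)
      (((c t).1 j).1 * ((c t).2 j).1) (Icc 0 τ) t :=
    fun t ht j => (hasDerivWithinAt_pi.1 (hc1 t ht) j).fst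
  have hZ : ∀ t ∈ Icc 0 τ, ∀ j, HasDerivWithinAt (fun s => ((c s).2 j).1)
      (euler B (c t).2 (c t).2 j).1 (Icc 0 τ) t :=
    fun t ht j => (hasDerivWithinAt_pi.1 (hc2 t ht) j).fst
  have hskew : ∀ t ∈ Icc 0 τ, (c t).2 ∈ lieAlg n := by
    intro t ht j
    have key := eq_zero_of_hasDerivWithinAt_of_bound
      (f := fun s => tr ((c s).2 j).1 + ((c s).2 j).1) (f' := fun _ => 0) (K := 0) (a := 0) (b := τ)
      (fun s hs => ((hasDerivWithinAt_tr (hZ s hs j)).add (hZ s hs j)).congr_deriv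
        (by rw [euler_mem B (c s).2 (c s).2 j, neg_add_cancel]))
      (by rw [hξ j, neg_add_cancel]) (by simp)
    exact eq_neg_of_add_eq_zero_left (key t ht)
  -- With D = AᵀA - 1 and Z skew, A' = AZ gives the linear homogeneous equation D' = DZ - ZD, and D
  -- vanishes initially.
  have horth : ∀ t ∈ Icc 0 τ, ∀ j, tr ((c t).1 j).1 * ((c t).1 j).1 = 1 := by
    intro t ht j
    obtain ⟨K, hK0, hK⟩ := bounded_of_continuousOn_Icc
      (fun s hs => (hZ s hs j).continuousWithinAt : ContinuousOn (fun s => ((c s).2 j).1) (Icc 0 τ))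
    have key := eq_zero_of_hasDerivWithinAt_of_bound
      (f := fun s => tr ((c s).1 j).1 * ((c s).1 j).1 - 1)
      (f' := fun s => (tr ((c s).1 j).1 * ((c s).1 j).1 - 1) * ((c s).2 j).1 -
        ((c s).2 j).1 * (tr ((c s).1 j).1 * ((c s).1 j).1 - 1)) (K := K + K) (a := 0) (b := τ)
      (fun s hs => (((hasDerivWithinAt_tr (hA s hs j)).mul (hA s hs j)).sub_const 1).congr_deriv
        (by rw [tr_mul, hskew s hs j]; noncomm_ring))
      (by rw [(hq j).1, sub_self]) ?_
    · exact sub_eq_zero.1 (key t ht)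
    · intro s hs
      rw [add_mul]
      refine (norm_sub_le _ _).trans (add_le_add ?_ ?_)
      · refine (norm_mul_le _ _).trans ?_
        rw [mul_comm]
        gcongr
        exact hK s hs
      · refine (norm_mul_le _ _).trans ?_
        gcongr
        exact hK s hs
  have hdet : ∀ t ∈ Icc 0 τ, ∀ j, ((c t).1 j).1.det = 1 := by
    intro t ht j
    have hcont : ContinuousOn (fun s => ((c s).1 j).1.det) (Icc 0 τ) :=
      ContinuousLinearMap.continuous_det.comp_continuousOn
        fun s hs => (hA s hs j).continuousWithinAt
    -- The determinant is continuous with square 1, so it keeps its initial value.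
    refine isPreconnected_Icc.eq_of_sq_eq hcont continuousOn_const ?_ (by simp)
      (⟨le_rfl, ht.1.trans ht.2⟩ : (0 : ℝ) ∈ Icc 0 τ) (hq j).2 ht
    intro s hs
    simpa using sq_det_of_orthogonal (horth s hs j)
  intro t ht
  refine ⟨fun j => ⟨horth t ht j, hdet t ht j⟩, hskew t ht, hc1 t ht, fun j w hw => ?_⟩
  have hw' : (Pi.single j w : Conf n) ∈ lieAlg n := by
    intro i
    by_cases hij : i = j
    · subst hij; simpa using hw
    · simp [hij]
  simp only [momentum_eq]
  refine (hasDerivWithinAt_kin B (hc2 t ht)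
    (hasDerivWithinAt_coAdj (q := fun s => (c s).1) (hskew t ht) (hc1 t ht)
      (Pi.single j w))).congr_deriv ?_
  -- The derivative of the momentum is ⟨ξ, [ξ, ζ]⟩ - ⟨ξ, [ξ, ζ]⟩, where ζ = Ad(q⁻¹)w.
  rw [kin_euler B _ _ (coAdj_mem _ hw'), ← kinBilin_apply, ← kinBilin_apply, map_neg,
    add_neg_cancel]

end

end RoughBilliards

namespace RoughBilliards

noncomputable section

open Module

variable {n : ℕ}

attribute [local instance] isTopologicalAddGroup_pt moduleStateCLM

/-! ### The symplectic form and the variational equation -/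

theorem kin_add_left (B : Fin 2 → RigidBody n) (u v w : Conf n) :
    kin B (u + v) w = kin B u w + kin B v w := by
  rw [← kinBilin_apply, map_add, LinearMap.add_apply, kinBilin_apply, kinBilin_apply]

theorem kin_add_right (B : Fin 2 → RigidBody n) (u v w : Conf n) :
    kin B u (v + w) = kin B u v + kin B u w := by
  rw [← kinBilin_apply, map_add, kinBilin_apply, kinBilin_apply]

theorem kin_sub_right (B : Fin 2 → RigidBody n) (u v w : Conf n) :
    kin B u (v - w) = kin B u v - kin B u w := by
  rw [← kinBilin_apply, map_sub, kinBilin_apply, kinBilin_apply]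

theorem kin_smul_left (B : Fin 2 → RigidBody n) (a : ℝ) (u v : Conf n) :
    kin B (a • u) v = a * kin B u v := by
  rw [← kinBilin_apply, map_smul, LinearMap.smul_apply, kinBilin_apply, smul_eq_mul]

theorem kin_smul_right (B : Fin 2 → RigidBody n) (a : ℝ) (u v : Conf n) :
    kin B u (a • v) = a * kin B u v := by
  rw [← kinBilin_apply, map_smul, kinBilin_apply, smul_eq_mul]

theorem kin_neg_left (B : Fin 2 → RigidBody n) (u v : Conf n) :
    kin B (-u) v = -kin B u v := by
  rw [← kinBilin_apply, map_neg, LinearMap.neg_apply, kinBilin_apply]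

theorem kin_neg_right (B : Fin 2 → RigidBody n) (u v : Conf n) :
    kin B u (-v) = -kin B u v := by
  rw [← kinBilin_apply, map_neg, kinBilin_apply]

theorem kin_zero_left (B : Fin 2 → RigidBody n) (v : Conf n) : kin B 0 v = 0 := by
  rw [← kinBilin_apply, map_zero, LinearMap.zero_apply]

theorem kin_zero_right (B : Fin 2 → RigidBody n) (v : Conf n) : kin B v 0 = 0 := by
  rw [← kinBilin_apply, map_zero]

/-- The contact form, polarized in its quadratic dependence on the state. -/
def contactBilin (B : Fin 2 → RigidBody n) : State n →ₗ[ℝ] State n →ₗ[ℝ] State n →L[ℝ] ℝ :=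
  LinearMap.mk₂ ℝ (fun x y => LinearMap.toContinuousLinearMap
      (kinBilin B x.2 ∘ₗ untranslateBilin y.1 ∘ₗ LinearMap.fst ℝ (Conf n) (Conf n)))
    (by intros; refine ContinuousLinearMap.ext fun X => ?_; simp)
    (by intros; refine ContinuousLinearMap.ext fun X => ?_; simp)
    (by intros; refine ContinuousLinearMap.ext fun X => ?_; simp)
    (by intros; refine ContinuousLinearMap.ext fun X => ?_; simp)

theorem contactForm_eq (B : Fin 2 → RigidBody n) (x : State n) :
    contactForm B x = contactBilin B x x :=
  ContinuousLinearMap.ext fun _ => rfl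

theorem hasFDerivAt_bilin_diag {E G : Type*} [NormedAddCommGroup E] [NormedSpace ℝ E]
    [NormedAddCommGroup G] [NormedSpace ℝ G] [FiniteDimensional ℝ E] (b : E →ₗ[ℝ] E →ₗ[ℝ] G)
    (x : E) :
    HasFDerivAt (fun y => b y y) (LinearMap.toContinuousLinearMap (b.flip x + b x)) x := by
  let b' := LinearMap.toContinuousBilinearMap b
  have h : HasFDerivAt (fun y => b' y y) _ x := b'.hasFDerivAt.clm_apply (hasFDerivAt_id x)
  refine h.congr_fderiv (ContinuousLinearMap.ext fun X => ?_)
  rw [add_comm (b.flip x)]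
  rfl

/-- dθ(X, Y) is the derivative of θ(Y) along X minus that of θ(X) along Y, for constant X and Y. For
a one-form depending quadratically on the state both are algebraic. -/
theorem extDeriv_ofSubsingleton_bilin {E : Type*} [NormedAddCommGroup E] [NormedSpace ℝ E]
    [FiniteDimensional ℝ E] (b : E →ₗ[ℝ] E →ₗ[ℝ] E →L[ℝ] ℝ) (x X Y : E) :
    extDeriv (fun y => ContinuousAlternatingMap.ofSubsingleton ℝ E ℝ (0 : Fin 1) (b y y)) x
        ![X, Y] =
      (b X x Y + b x X Y) - (b Y x X + b x Y X) := by
  let L : (E →L[ℝ] ℝ) →ₗ[ℝ] (E [⋀^Fin 1]→L[ℝ] ℝ) :=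
    { toFun := fun f => ContinuousAlternatingMap.ofSubsingleton ℝ E ℝ (0 : Fin 1) f
      map_add' := fun f g => by ext; simp
      map_smul' := fun a f => by ext; simp }
  have h1 : HasFDerivAt
      (fun y => ContinuousAlternatingMap.ofSubsingleton ℝ E ℝ (0 : Fin 1) (b y y)) _ x :=
    hasFDerivAt_bilin_diag (G := E [⋀^Fin 1]→L[ℝ] ℝ) (b.compr₂ L) x
  rw [extDeriv, h1.fderiv, ContinuousAlternatingMap.alternatizeUncurryFin_apply, Fin.sum_univ_two,
    sub_eq_add_neg]
  congr 1
  · rw [Fin.val_zero, pow_zero, one_smul]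
    rfl
  · rw [Fin.val_one, pow_one, neg_one_smul]
    rfl

theorem symplecticForm_apply (B : Fin 2 → RigidBody n) (x X Y : State n) :
    symplecticForm B x X Y =
      (kin B X.2 (untranslate x.1 Y.1) + kin B x.2 (untranslate X.1 Y.1)) -
        (kin B Y.2 (untranslate x.1 X.1) + kin B x.2 (untranslate Y.1 X.1)) := by
  have h := extDeriv_ofSubsingleton_bilin (contactBilin B) x X Y
  simp only [← contactForm_eq] at h
  exact h

theorem untranslate_translate_left {q ζ : Conf n} (hζ : ζ ∈ lieAlg n) (X : Conf n) :
    untranslate (translate q ζ) X =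
      fun j => (-((ζ j).1 * (untranslate q X j).1), -(ζ j).1 (untranslate q X j).2) := by
  ext1 j
  have h := hζ j
  refine Prod.ext ?_ ?_
  · simp only [untranslate, translate]
    rw [tr_mul, h]
    noncomm_ring
  · simp only [untranslate, translate]
    rw [tr_mul, h]
    simp

/-- The symplectic form in terms of left-translated tangent vectors. -/
theorem symplecticForm_translate (B : Fin 2 → RigidBody n) {x X Y : State n} (hq : x.1 ∈ SE2 n)
    (hX : untranslate x.1 X.1 ∈ lieAlg n) (hY : untranslate x.1 Y.1 ∈ lieAlg n) :
    symplecticForm B x X Y =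
      kin B X.2 (untranslate x.1 Y.1) - kin B Y.2 (untranslate x.1 X.1) -
        kin B x.2 (bracket (untranslate x.1 X.1) (untranslate x.1 Y.1)) := by
  have key : ∀ X Y : State n, untranslate x.1 X.1 ∈ lieAlg n →
      untranslate X.1 Y.1 = fun j => (-((untranslate x.1 X.1 j).1 * (untranslate x.1 Y.1 j).1),
        -(untranslate x.1 X.1 j).1 (untranslate x.1 Y.1 j).2) := by
    intro X Y hX
    rw [← untranslate_translate_left hX, translate_untranslate hq]
  -- This is the Maurer–Cartan term: it arises from the dependence of the left translation on the
  -- base point.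
  have h : bracket (untranslate x.1 X.1) (untranslate x.1 Y.1) =
      untranslate Y.1 X.1 - untranslate X.1 Y.1 := by
    rw [key X Y hX, key Y X hY]
    ext1 j
    rw [bracket_apply]
    refine Prod.ext ?_ ?_
    · simp only [Pi.sub_apply, Prod.fst_sub]
      abel
    · simp only [Pi.sub_apply, Prod.snd_sub]
      abel
  rw [symplecticForm_apply, h, kin_sub_right]
  ring

/-- `h` solves the linearization, along the curve `c` run through with speed `t`, of the equation of
motion, for the variation `δ` of `t`. -/
def IsVariation (B : Fin 2 → RigidBody n) (t δ : ℝ) (c h : ℝ → State n) : Prop :=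
  ∀ s ∈ Icc (0 : ℝ) 1, HasDerivWithinAt h (δ • freeField B (c s) (c s) +
    t • (freeField B (c s) (h s) + freeField B (h s) (c s))) (Icc 0 1) s

/-! ### Linearized motions along a solution. -/

section Variation

variable {B : Fin 2 → RigidBody n} {t δ : ℝ} {c h : ℝ → State n}

theorem IsVariation.snd (hh : IsVariation B t δ c h) {s : ℝ} (hs : s ∈ Icc (0 : ℝ) 1) :
    HasDerivWithinAt (fun s => (h s).2) (δ • euler B (c s).2 (c s).2 +
      t • (euler B (c s).2 (h s).2 + euler B (h s).2 (c s).2)) (Icc 0 1) s :=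
  (hh s hs).snd

theorem IsVariation.fst (hh : IsVariation B t δ c h) {s : ℝ} (hs : s ∈ Icc (0 : ℝ) 1) :
    HasDerivWithinAt (fun s => (h s).1) (δ • translate (c s).1 (c s).2 +
      t • (translate (c s).1 (h s).2 + translate (h s).1 (c s).2)) (Icc 0 1) s :=
  (hh s hs).fst

theorem IsVariation.snd_mem (hh : IsVariation B t δ c h) (h0 : (h 0).2 ∈ lieAlg n) :
    ∀ s ∈ Icc (0 : ℝ) 1, (h s).2 ∈ lieAlg n := by
  intro s hs j
  have hmem : ∀ s, δ • euler B (c s).2 (c s).2 +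
      t • (euler B (c s).2 (h s).2 + euler B (h s).2 (c s).2) ∈ lieAlg n := fun s =>
    (lieAlg n).add_mem ((lieAlg n).smul_mem _ (euler_mem B _ _))
      ((lieAlg n).smul_mem _ ((lieAlg n).add_mem (euler_mem B _ _) (euler_mem B _ _)))
  have key := eq_zero_of_hasDerivWithinAt_of_bound
    (f := fun s => tr ((h s).2 j).1 + ((h s).2 j).1) (f' := fun _ => 0) (K := 0) (a := 0) (b := 1)
    (fun s hs => by
      have h1 := (hasDerivWithinAt_pi.1 (hh.snd hs) j).fst
      refine ((hasDerivWithinAt_tr h1).add h1).congr_deriv ?_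
      rw [hmem s j, neg_add_cancel])
    (by rw [h0 j, neg_add_cancel]) (by simp)
  exact eq_neg_of_add_eq_zero_left (key s hs)

/-- This is linearized conservation of energy: the terms ⟨·, [ξ, ξ]⟩, including the one from the
variation of the run time, vanish, and the other two cancel by antisymmetry. -/
theorem IsVariation.kin_eq
    (hc : ∀ s ∈ Icc (0 : ℝ) 1, HasDerivWithinAt c (t • freeField B (c s) (c s)) (Icc 0 1) s)
    (hh : IsVariation B t δ c h) (hξ : ∀ s ∈ Icc (0 : ℝ) 1, (c s).2 ∈ lieAlg n)
    (h0 : (h 0).2 ∈ lieAlg n) (he : kin B (c 0).2 (h 0).2 = 0) :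
    ∀ s ∈ Icc (0 : ℝ) 1, kin B (c s).2 (h s).2 = 0 := by
  refine eq_zero_of_hasDerivWithinAt_of_bound (f' := fun _ => 0) (K := 0) (fun s hs => ?_) he
    (by simp)
  have h1 : HasDerivWithinAt (fun s => (c s).2) (t • euler B (c s).2 (c s).2) (Icc 0 1) s :=
    (hc s hs).snd
  refine (hasDerivWithinAt_kin B h1 (hh.snd hs)).congr_deriv ?_
  have hη := hh.snd_mem h0 s hs
  have hξs := hξ s hs
  rw [kin_smul_left, kin_euler B _ _ hη, kin_comm B (c s).2 (_ + _), kin_add_left, kin_smul_left,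
    kin_smul_left, kin_add_left, kin_euler B _ _ hξs, kin_euler B _ _ hξs, kin_euler B _ _ hξs, bracket_self,
    bracket_swap (h s).2, kin_zero_right, kin_zero_right, kin_neg_right]
  ring

/-- The equation for the left-translated variation of the configuration. -/
theorem IsVariation.hasDerivWithinAt_untranslate
    (hc : ∀ s ∈ Icc (0 : ℝ) 1, HasDerivWithinAt c (t • freeField B (c s) (c s)) (Icc 0 1) s)
    (hq : ∀ s ∈ Icc (0 : ℝ) 1, (c s).1 ∈ SE2 n) (hξ : ∀ s ∈ Icc (0 : ℝ) 1, (c s).2 ∈ lieAlg n)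
    (hh : IsVariation B t δ c h) {s : ℝ}
    (hs : s ∈ Icc (0 : ℝ) 1) :
    HasDerivWithinAt (fun s => untranslate (c s).1 (h s).1)
      (δ • (c s).2 + t • ((h s).2 - bracket (c s).2 (untranslate (c s).1 (h s).1)))
      (Icc 0 1) s := by
  have h1 : HasDerivWithinAt (fun s => (c s).1) (t • translate (c s).1 (c s).2) (Icc 0 1) s :=
    (hc s hs).fst
  refine (hasDerivWithinAt_bilin untranslateBilin h1 (hh.fst hs)).congr_deriv ?_
  have h2 : untranslate (c s).1 (translate (h s).1 (c s).2) = fun j =>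
      ((untranslate (c s).1 (h s).1 j).1 * ((c s).2 j).1,
        (untranslate (c s).1 (h s).1 j).1 ((c s).2 j).2) := by
    ext1 j
    simp only [untranslate, translate]
    rw [mul_assoc]
    rfl
  rw [map_smul, LinearMap.smul_apply, map_add, map_smul, map_smul, map_add]
  simp only [untranslateBilin_apply]
  rw [untranslate_translate_left (hξ s hs), untranslate_translate (hq s hs),
    untranslate_translate (hq s hs), h2, add_left_comm, ← smul_add]
  congr 2
  ext1 j
  rw [Pi.sub_apply, bracket_apply]
  refine Prod.ext ?_ ?_
  · simp only [Pi.add_apply, Prod.fst_add, Prod.fst_sub]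
    abel
  · simp only [Pi.add_apply, Prod.snd_add, Prod.snd_sub]
    abel

/-- The symmetric part of the rotational component satisfies a linear homogeneous equation, because
the inhomogeneous terms of the variational equation are skew. -/
theorem IsVariation.untranslate_mem
    (hc : ∀ s ∈ Icc (0 : ℝ) 1, HasDerivWithinAt c (t • freeField B (c s) (c s)) (Icc 0 1) s)
    (hq : ∀ s ∈ Icc (0 : ℝ) 1, (c s).1 ∈ SE2 n) (hξ : ∀ s ∈ Icc (0 : ℝ) 1, (c s).2 ∈ lieAlg n)
    (hh : IsVariation B t δ c h) (h0 : (h 0).2 ∈ lieAlg n)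
    (h0' : untranslate (c 0).1 (h 0).1 ∈ lieAlg n) :
    ∀ s ∈ Icc (0 : ℝ) 1, untranslate (c s).1 (h s).1 ∈ lieAlg n := by
  intro s hs j
  have hcont : ContinuousOn (fun s => ((c s).2 j).1) (Icc 0 1) := fun u hu => by
    have h1 : HasDerivWithinAt (fun s => (c s).2) (t • euler B (c u).2 (c u).2) (Icc 0 1) u :=
      (hc u hu).snd
    have h2 : HasDerivWithinAt (fun s => ((c s).2 j).1) (t • euler B (c u).2 (c u).2 j).1
      (Icc 0 1) u := (hasDerivWithinAt_pi.1 h1 j).fst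
    exact h2.continuousWithinAt
  obtain ⟨K, hK0, hK⟩ := bounded_of_continuousOn_Icc hcont
  let D : ℝ → Mat n := fun s =>
    tr (untranslate (c s).1 (h s).1 j).1 + (untranslate (c s).1 (h s).1 j).1
  have key := eq_zero_of_hasDerivWithinAt_of_bound (f := D)
    (f' := fun s => t • (D s * ((c s).2 j).1 - ((c s).2 j).1 * D s))
    (K := |t| * (K + K)) (a := 0) (b := 1) ?_ ?_ ?_
  · exact eq_neg_of_add_eq_zero_left (key s hs)
  · intro u hu
    have h1 := (hasDerivWithinAt_pi.1 (hh.hasDerivWithinAt_untranslate hc hq hξ hu) j).fst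
    refine ((hasDerivWithinAt_tr h1).add h1).congr_deriv ?_
    have h2 := hξ u hu j
    have h3 := hh.snd_mem h0 u hu j
    simp only [D]
    generalize untranslate (c u).1 (h u).1 = ζ
    simp only [Pi.add_apply, Pi.smul_apply, Pi.sub_apply, Prod.fst_add, Prod.smul_fst, Prod.fst_sub,
      bracket_apply, ← trCLM_apply, map_add, map_sub, map_smul] at h2 h3 ⊢
    rw [h2, h3]
    simp only [trCLM_apply]
    rw [tr_mul, tr_mul, hξ u hu j]
    simp only [smul_sub, mul_add, add_mul, smul_add, smul_neg, neg_mul, mul_neg]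
    abel
  · simp only [D]
    rw [h0' j, neg_add_cancel]
  · intro u hu
    rw [norm_smul, mul_assoc, Real.norm_eq_abs]
    gcongr
    rw [add_mul K K]
    refine (norm_sub_le _ _).trans (add_le_add ?_ ?_)
    · refine (norm_mul_le _ _).trans ?_
      rw [mul_comm]
      gcongr
      exact hK u hu
    · refine (norm_mul_le _ _).trans ?_
      gcongr
      exact hK u hu

/-- The flow preserves the symplectic form on variations that do not change the energy. -/
theorem IsVariation.symplecticForm_eq
    (hc : ∀ s ∈ Icc (0 : ℝ) 1, HasDerivWithinAt c (t • freeField B (c s) (c s)) (Icc 0 1) s)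
    (hq : ∀ s ∈ Icc (0 : ℝ) 1, (c s).1 ∈ SE2 n) (hξ : ∀ s ∈ Icc (0 : ℝ) 1, (c s).2 ∈ lieAlg n)
    {δ' : ℝ} {h' : ℝ → State n} (hh : IsVariation B t δ c h)
    (hh' : IsVariation B t δ' c h') (h0 : (h 0).2 ∈ lieAlg n) (h0' : (h' 0).2 ∈ lieAlg n)
    (h1 : untranslate (c 0).1 (h 0).1 ∈ lieAlg n) (h1' : untranslate (c 0).1 (h' 0).1 ∈ lieAlg n)
    (he : kin B (c 0).2 (h 0).2 = 0) (he' : kin B (c 0).2 (h' 0).2 = 0) :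
    symplecticForm B (c 1) (h 1) (h' 1) = symplecticForm B (c 0) (h 0) (h' 0) := by
  have hm := hh.untranslate_mem hc hq hξ h0 h1
  have hm' := hh'.untranslate_mem hc hq hξ h0' h1'
  let W : ℝ → ℝ := fun s =>
    kin B (h s).2 (untranslate (c s).1 (h' s).1) - kin B (h' s).2 (untranslate (c s).1 (h s).1) -
      kin B (c s).2 (bracket (untranslate (c s).1 (h s).1) (untranslate (c s).1 (h' s).1))
  have hW : ∀ s ∈ Icc (0 : ℝ) 1, symplecticForm B (c s) (h s) (h' s) = W s := fun s hs =>
    symplecticForm_translate B (hq s hs) (hm s hs) (hm' s hs)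
  rw [hW 1 (by simp), hW 0 (by simp), ← sub_eq_zero]
  refine eq_zero_of_hasDerivWithinAt_of_bound (f := fun s => W s - W 0) (f' := fun _ => 0) (K := 0)
    (a := 0) (b := 1) (fun s hs => HasDerivWithinAt.sub_const _ ?_) (sub_self _) (by simp) 1
    (by simp)
  have hc2 : HasDerivWithinAt (fun s => (c s).2) (t • euler B (c s).2 (c s).2) (Icc 0 1) s :=
    (hc s hs).snd
  have hz := hh.hasDerivWithinAt_untranslate hc hq hξ hs
  have hz' := hh'.hasDerivWithinAt_untranslate hc hq hξ hs
  have d1 := hasDerivWithinAt_kin B (hh.snd hs) hz'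
  have d2 := hasDerivWithinAt_kin B (hh'.snd hs) hz
  have d3 := hasDerivWithinAt_kin B hc2 (hasDerivWithinAt_bilin bracket hz hz')
  refine ((d1.sub d2).sub d3).congr_deriv ?_
  -- After cancellation the run-time variations contribute only δ'⟨ξ, η⟩ - δ⟨ξ, η'⟩, which is zero
  -- by the energy condition. The remaining terms cancel by the Jacobi identity and the symmetry of
  -- the metric.
  have e1 := hh.kin_eq hc hξ h0 he s hs
  have e1' := hh'.kin_eq hc hξ h0' he' s hs
  have m := hm s hs
  have m' := hm' s hs
  generalize untranslate (c s).1 (h s).1 = ζ at m ⊢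
  generalize untranslate (c s).1 (h' s).1 = ζ' at m' ⊢
  generalize (c s).2 = ξ at e1 e1' ⊢
  generalize (h s).2 = η at e1 ⊢
  generalize (h' s).2 = η' at e1' ⊢
  rw [kin_comm] at e1 e1'
  simp only [kin_add_left, kin_add_right, kin_smul_left, kin_smul_right, kin_sub_right, map_add,
    map_sub, map_smul, LinearMap.add_apply, LinearMap.sub_apply, LinearMap.smul_apply,
    kin_euler B _ _ m, kin_euler B _ _ m', kin_euler B _ _ (bracket_mem m m'), e1, e1']
  rw [bracket_jacobi ξ ζ ζ', kin_add_right, bracket_swap ζ ξ, bracket_swap ζ η', kin_neg_right,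
    kin_neg_right, kin_comm B η' η]
  ring

end Variation

end

end RoughBilliards

namespace RoughBilliards

noncomputable section

/-! ### Hitting times of a quadratic flow -/

/-- The derivative is positive on a neighbourhood of a that does not depend on x, so all φ x are
strictly increasing there and vanish at a. -/
theorem eventually_sign_of_deriv_pos {X : Type*} {l : Filter X} {D : Set ℝ} (hD : Convex ℝ D)
    {a : ℝ} (ha : a ∈ D) {φ φ' : X → ℝ → ℝ}
    (h : ∀ᶠ p : X × ℝ in l ×ˢ 𝓝[D] a,
      HasDerivWithinAt (φ p.1) (φ' p.1 p.2) D p.2 ∧ 0 < φ' p.1 p.2)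
    (h0 : ∀ᶠ x in l, φ x a = 0) :
    ∀ᶠ p : X × ℝ in l ×ˢ 𝓝[D] a,
      (a < p.2 → 0 < φ p.1 p.2) ∧ (p.2 < a → φ p.1 p.2 < 0) := by
  obtain ⟨P, hP, Q, hQ, hPQ⟩ := eventually_prod_iff.1 h
  obtain ⟨r, hr, hrQ⟩ := Metric.mem_nhdsWithin_iff.1 hQ
  have hball : Metric.ball a r ∩ D ∈ 𝓝[D] a :=
    inter_mem (mem_nhdsWithin_of_mem_nhds (Metric.ball_mem_nhds a hr)) self_mem_nhdsWithin
  refine eventually_prod_iff.2 ⟨_, hP.and h0, _, hball, ?_⟩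
  rintro x ⟨hx, hx0⟩ s hs
  have hmono : StrictMonoOn (φ x) (Metric.ball a r ∩ D) := by
    refine strictMonoOn_of_hasDerivWithinAt_pos (f' := φ' x) ((convex_ball a r).inter hD) ?_ ?_ ?_
    · exact fun u hu => (hPQ hx (hrQ hu)).1.continuousWithinAt.mono inter_subset_right
    · exact fun u hu => (hPQ hx (hrQ (interior_subset hu))).1.mono
        (interior_subset.trans inter_subset_right)
    · exact fun u hu => (hPQ hx (hrQ (interior_subset hu))).2
  have ha' : a ∈ Metric.ball a r ∩ D := ⟨Metric.mem_ball_self hr, ha⟩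
  refine ⟨fun hlt => ?_, fun hlt => ?_⟩
  · have := hmono ha' hs hlt
    rwa [hx0] at this
  · have := hmono hs ha' hlt
    rwa [hx0] at this

theorem continuousAt_extendPath {E : Type*} [NormedAddCommGroup E] {X : Type*}
    [TopologicalSpace X] {ρ : X → C(Icc (0 : ℝ) 1, E)}
    {x₀ : X} (hρ : ContinuousAt ρ x₀) (s : ℝ) :
    ContinuousAt (fun p : X × ℝ => extendPath (ρ p.1) p.2) (x₀, s) := by
  have h1 : ContinuousAt (fun p : X × ℝ => ρ p.1) (x₀, s) :=
    ContinuousAt.comp (f := Prod.fst) (g := ρ) hρ continuousAt_fst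
  have h2 : ContinuousAt (fun p : X × ℝ => projIcc (0 : ℝ) 1 zero_le_one p.2) (x₀, s) :=
    (continuous_projIcc.comp continuous_snd).continuousAt
  exact (h1.eval h2 :)

variable {E : Type*} [NormedAddCommGroup E] [NormedSpace ℝ E]

theorem hasDerivWithinAt_rescale {c : ℝ → E} {v : E} {τ s : ℝ} (hτ : 0 < τ)
    (hc : HasDerivWithinAt c v (Icc 0 τ) (τ * s)) :
    HasDerivWithinAt (fun s => c (τ * s)) (τ • v) (Icc 0 1) s := by
  have h1 : HasDerivWithinAt (fun s => τ * s) τ (Icc 0 1) s := by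
    simpa using ((hasDerivAt_id s).const_mul τ).hasDerivWithinAt
  refine hc.scomp s h1 fun u hu => ⟨mul_nonneg hτ.le hu.1, ?_⟩
  simpa using mul_le_mul_of_nonneg_left hu.2 hτ.le

theorem hasDerivWithinAt_rescale_div {c : ℝ → E} {v : E} {τ t : ℝ} (hτ : 0 < τ)
    (hc : HasDerivWithinAt c (τ • v) (Icc 0 1) (t / τ)) :
    HasDerivWithinAt (fun t => c (t / τ)) v (Icc 0 τ) t := by
  have h1 : HasDerivWithinAt (fun t => t / τ) (1 / τ) (Icc 0 τ) t :=
    ((hasDerivAt_id t).div_const τ).hasDerivWithinAt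
  have h2 := HasDerivWithinAt.scomp t hc h1 (fun u (hu : u ∈ Icc 0 τ) =>
    (⟨div_nonneg hu.1 hτ.le, div_le_one_of_le₀ hu.2 hτ.le⟩ : u / τ ∈ Icc (0 : ℝ) 1))
  rwa [smul_smul, one_div_mul_cancel hτ.ne', one_smul] at h2

/-- Changing only the run time moves a point along its own orbit. At s = 1 this gives the derivative
of the end point with respect to the run time. -/
theorem eqOn_of_hasDerivWithinAt_linearized (β : E →L[ℝ] E →L[ℝ] E) {t δ : ℝ} {c k : ℝ → E}
    (hc : ∀ s ∈ Icc (0 : ℝ) 1, HasDerivWithinAt c (t • β (c s) (c s)) (Icc 0 1) s)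
    (hk0 : k 0 = 0) (hk : ∀ s ∈ Icc (0 : ℝ) 1, HasDerivWithinAt k (δ • β (c s) (c s) +
      t • (β (c s) (k s) + β (k s) (c s))) (Icc 0 1) s) :
    ∀ s ∈ Icc (0 : ℝ) 1, k s = (δ * s) • β (c s) (c s) := by
  obtain ⟨K, hK0, hK⟩ := bounded_of_continuousOn_Icc
    (fun s hs => (hc s hs).continuousWithinAt : ContinuousOn c _)
  have key := eq_zero_of_hasDerivWithinAt_of_bound (f := fun s => k s - (δ * s) • β (c s) (c s))
    (f' := fun s => t • (β (c s) (k s - (δ * s) • β (c s) (c s)) +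
      β (k s - (δ * s) • β (c s) (c s)) (c s))) (K := |t| * (‖β‖ * K + ‖β‖ * K)) (a := 0) (b := 1)
    ?_ (by simp [hk0]) ?_
  · exact fun s hs => sub_eq_zero.1 (key s hs)
  · intro s hs
    have h1 : HasDerivWithinAt (fun s => δ * s) δ (Icc 0 1) s := by
      simpa using ((hasDerivAt_id s).const_mul δ).hasDerivWithinAt
    have h2 := (β.hasFDerivAt.comp_hasDerivWithinAt s (hc s hs)).clm_apply (hc s hs)
    refine ((hk s hs).sub (h1.smul h2)).congr_deriv ?_
    simp only [map_smul, smul_apply, map_sub, sub_apply, Function.comp_apply]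
    module
  · intro s hs
    rw [norm_smul, mul_assoc, Real.norm_eq_abs]
    gcongr
    rw [add_mul]
    refine (norm_add_le _ _).trans (add_le_add ?_ ?_)
    · refine (β.le_opNorm₂ _ _).trans ?_
      gcongr
      exact hK s hs
    · refine (β.le_opNorm₂ _ _).trans ?_
      rw [mul_right_comm]
      gcongr
      exact hK s hs

/-- The time at which the orbits near a given one hit the zero set of a function transversally, and
the derivative of the hitting map. -/
theorem exists_hitting [CompleteSpace E] (β : E →L[ℝ] E →L[ℝ] E) (τ : ℝ) (c : ℝ → E)
    (hc : ∀ s ∈ Icc (0 : ℝ) 1, HasDerivWithinAt c (τ • β (c s) (c s)) (Icc 0 1) s)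
    {g : E → ℝ} {g' : E →L[ℝ] ℝ} (hg : HasStrictFDerivAt g g' (c 1)) (hg0 : g (c 1) = 0)
    (hg' : g' (β (c 1) (c 1)) ≠ 0) :
    ∃ (T : E → ℝ) (ρ : E → C(Icc (0 : ℝ) 1, E)) (Φ' : E →L[ℝ] E),
      ContinuousAt T (c 0) ∧ T (c 0) = τ ∧
      ContinuousAt ρ (c 0) ∧ (∀ s ∈ Icc (0 : ℝ) 1, extendPath (ρ (c 0)) s = c s) ∧
      (∀ᶠ x in 𝓝 (c 0), extendPath (ρ x) 0 = x ∧ g (extendPath (ρ x) 1) = 0 ∧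
        ∀ s ∈ Icc (0 : ℝ) 1, HasDerivWithinAt (extendPath (ρ x))
          (T x • β (extendPath (ρ x) s) (extendPath (ρ x) s)) (Icc 0 1) s) ∧
      HasFDerivAt (fun x => extendPath (ρ x) 1) Φ' (c 0) ∧
      ∀ X, g' (Φ' X) = 0 ∧ ∃ (δ : ℝ) (h : ℝ → E), h 0 = X ∧ h 1 = Φ' X ∧
        ∀ s ∈ Icc (0 : ℝ) 1, HasDerivWithinAt h (δ • β (c s) (c s) +
          τ • (β (c s) (h s) + β (h s) (c s))) (Icc 0 1) s := by
  obtain ⟨Ψ, Ψ', hΨ', hΨc, hΨ, hΨv⟩ := exists_flow β τ c hc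
  have h1mem : (1 : ℝ) ∈ Icc (0 : ℝ) 1 := by simp
  let ev : C(Icc (0 : ℝ) 1, E) →L[ℝ] E := ContinuousMap.evalCLM ℝ ⟨1, h1mem⟩
  have hev : ∀ f, ev f = extendPath f 1 := fun f => (extendPath_of_mem f h1mem).symm
  let swap : E × ℝ →L[ℝ] ℝ × E :=
    (ContinuousLinearMap.snd ℝ E ℝ).prod (ContinuousLinearMap.fst ℝ E ℝ)
  have hG : HasStrictFDerivAt (fun p : E × ℝ => g (ev (Ψ (swap p)))) (g' ∘L ev ∘L Ψ' ∘L swap)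
      (c 0, τ) := by
    have h1 : HasStrictFDerivAt (fun p : E × ℝ => ev (Ψ (swap p))) (ev ∘L Ψ' ∘L swap) (c 0, τ) :=
      ev.hasStrictFDerivAt.comp (c 0, τ) (HasStrictFDerivAt.comp (g := Ψ) (c 0, τ) hΨ'
        swap.hasStrictFDerivAt)
    refine HasStrictFDerivAt.comp (g := g) (c 0, τ) ?_ h1
    have : ev (Ψ (swap (c 0, τ))) = c 1 := (hev _).trans (hΨc 1 h1mem)
    rwa [this]
  -- The derivative of g at the end point with respect to the run time is g' of the velocity there,
  -- so transversality is what the implicit function theorem needs.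
  have hinv : ((g' ∘L ev ∘L Ψ' ∘L swap) ∘L .inr ℝ E ℝ).IsInvertible := by
    refine isInvertible_real ?_
    change g' (ev (Ψ' (1, 0))) ≠ 0
    obtain ⟨hk0, hk⟩ := hΨv (1, 0)
    rw [hev, eqOn_of_hasDerivWithinAt_linearized β hc hk0 hk 1 h1mem]
    simpa using hg'
  let T := hG.implicitFunctionOfProdDomain hinv
  have hTd := hG.hasStrictFDerivAt_implicitFunctionOfProdDomain hinv
  set T' : E →L[ℝ] ℝ := -((g' ∘L ev ∘L Ψ' ∘L swap) ∘L .inr ℝ E ℝ).inverse ∘L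
    ((g' ∘L ev ∘L Ψ' ∘L swap) ∘L .inl ℝ E ℝ)
  have hT0 : T (c 0) = τ :=
    (hG.eventually_apply_eq_iff_implicitFunctionOfProdDomain hinv).self_of_nhds.1 rfl
  have hTg := hG.eventually_apply_implicitFunctionOfProdDomain hinv
  have hg1 : g (ev (Ψ (swap (c 0, τ)))) = 0 := by
    have : ev (Ψ (swap (c 0, τ))) = c 1 := (hev _).trans (hΨc 1 h1mem)
    rw [this, hg0]
  let pr : E → ℝ × E := fun x => (T x, x)
  have hpr : HasStrictFDerivAt pr (T'.prod (.id ℝ E)) (c 0) := hTd.prodMk (hasStrictFDerivAt_id _)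
  have hpr0 : pr (c 0) = (τ, c 0) := by rw [← hT0]
  have hρ : HasStrictFDerivAt (fun x => Ψ (pr x)) (Ψ' ∘L T'.prod (.id ℝ E)) (c 0) := by
    refine HasStrictFDerivAt.comp (g := Ψ) (c 0) ?_ hpr
    rwa [hpr0]
  have hΦ : HasStrictFDerivAt (fun x => extendPath (Ψ (pr x)) 1)
      (ev ∘L Ψ' ∘L T'.prod (.id ℝ E)) (c 0) := by
    have := ev.hasStrictFDerivAt.comp (c 0) hρ
    simpa only [← hev] using this
  have hev0 : ∀ᶠ x in 𝓝 (c 0), g (extendPath (Ψ (pr x)) 1) = 0 := by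
    filter_upwards [hTg] with x hx
    rw [← hev]
    exact hx.trans hg1
  have hgΦ : HasFDerivAt (fun x => g (extendPath (Ψ (pr x)) 1))
      (g' ∘L ev ∘L Ψ' ∘L T'.prod (.id ℝ E)) (c 0) := by
    refine HasFDerivAt.comp (g := g) (c 0) ?_ hΦ.hasFDerivAt
    rw [hpr0, hΨc 1 h1mem]
    exact hg.hasFDerivAt
  -- The variation of the hitting point is that of the path with initial variation X and run-time
  -- variation δ = T' X.
  refine ⟨T, fun x => Ψ (pr x), ev ∘L Ψ' ∘L T'.prod (.id ℝ E), hTd.continuousAt, hT0,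
    hρ.continuousAt, ?_, ?_, hΦ.hasFDerivAt, fun X => ⟨?_, T' X, extendPath (Ψ' (T' X, X)), ?_⟩⟩
  · intro s hs
    change extendPath (Ψ (pr (c 0))) s = c s
    rw [hpr0]
    exact hΨc s hs
  · have := hpr.continuousAt.tendsto
    rw [hpr0] at this
    filter_upwards [this.eventually hΨ, hev0] with x hx hx'
    exact ⟨hx.1, hx', hx.2⟩
  · have h0 : HasFDerivAt (fun x => g (extendPath (Ψ (pr x)) 1)) (0 : E →L[ℝ] ℝ) (c 0) :=
      (hasFDerivAt_const (0 : ℝ) (c 0)).congr_of_eventuallyEq hev0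
    exact congrArg (fun L => L X) (hgΦ.unique h0)
  · exact ⟨(hΨv (T' X, X)).1, (hev _).symm, (hΨv (T' X, X)).2⟩

end

end RoughBilliards

namespace RoughBilliards

noncomputable section

variable {n : ℕ}

attribute [local instance] isTopologicalAddGroup_pt moduleStateCLM

theorem completeSpace_state (n : ℕ) : CompleteSpace (State n) := FiniteDimensional.complete ℝ _

attribute [local instance] completeSpace_state

/-! ### The next collision as a function of the initial state -/

/-- Near the endpoint a the nonzero derivative gives all φ x the same sign inside the interval.
Which sign it is can be seen at the single parameter x₀. -/
theorem eventually_pos_of_deriv_ne_zero {X : Type*} {l : Filter X} {x₀ : X} (hx₀ : pure x₀ ≤ l)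
    {a d : ℝ} (ha : a = 0 ∨ a = 1) (hd : d ≠ 0) {φ φ' : X → ℝ → ℝ}
    (h : ∀ᶠ p : X × ℝ in l ×ˢ 𝓝[Icc 0 1] a, HasDerivWithinAt (φ p.1) (φ' p.1 p.2) (Icc 0 1) p.2)
    (hφ' : Tendsto (fun p : X × ℝ => φ' p.1 p.2) (l ×ˢ 𝓝[Icc 0 1] a) (𝓝 d))
    (h0 : ∀ᶠ x in l, φ x a = 0) (hpos : ∀ᶠ s in 𝓝[Icc 0 1] a, s ∈ Ioo (0 : ℝ) 1 → 0 < φ x₀ s) :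
    ∀ᶠ p : X × ℝ in l ×ˢ 𝓝[Icc 0 1] a, p.2 ∈ Ioo (0 : ℝ) 1 → 0 < φ p.1 p.2 := by
  have haI : a ∈ Icc (0 : ℝ) 1 := by rcases ha with rfl | rfl <;> simp
  obtain ⟨σ, hσ, hσd⟩ : ∃ σ : ℝ, (σ = 1 ∨ σ = -1) ∧ 0 < σ * d := by
    rcases hd.lt_or_gt with hlt | hgt
    · exact ⟨-1, Or.inr rfl, by linarith⟩
    · exact ⟨1, Or.inl rfl, by linarith⟩
  have E := eventually_sign_of_deriv_pos (φ := fun x s => σ * φ x s)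
    (φ' := fun x s => σ * φ' x s) (convex_Icc (0 : ℝ) 1) haI
    ((h.mono fun p hp => hp.const_mul σ).and ((hφ'.const_mul σ).eventually_const_lt hσd))
    (h0.mono fun x hx => by rw [hx, mul_zero])
  have E₀ : ∀ᶠ s in 𝓝[Icc 0 1] a, (a < s → 0 < σ * φ x₀ s) ∧ (s < a → σ * φ x₀ s < 0) := by
    have := E.filter_mono (prod_mono hx₀ le_rfl)
    rw [pure_prod] at this
    exact this
  have hne : (𝓝[Ioo 0 1] a).NeBot := by
    rw [← mem_closure_iff_nhdsWithin_neBot, closure_Ioo zero_ne_one]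
    exact haI
  -- One interior point where φ x₀ is positive decides σ relative to the endpoint.
  obtain ⟨s, ⟨hs, hps⟩, hsI⟩ := (((E₀.and hpos).filter_mono
    (nhdsWithin_mono a Ioo_subset_Icc_self)).and self_mem_nhdsWithin).exists
  replace hps := hps hsI
  refine E.mono fun p hp hpI => ?_
  rcases ha with rfl | rfl
  · have h1 := hs.1 hsI.1
    have h2 := hp.1 hpI.1
    rcases hσ with rfl | rfl <;> linarith
  · have h1 := hs.2 hsI.2
    have h2 := hp.2 hpI.2
    rcases hσ with rfl | rfl <;> linarith

theorem isFreeMotion_rescale {B : Fin 2 → RigidBody n} {τ : ℝ} (hτ : 0 < τ) {p : ℝ → State n}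
    (hp : ∀ s ∈ Icc (0 : ℝ) 1, HasDerivWithinAt p (τ • freeField B (p s) (p s)) (Icc 0 1) s)
    (hq : (p 0).1 ∈ SE2 n) (hξ : (p 0).2 ∈ lieAlg n) :
    IsFreeMotion B (fun t => p (t / τ)) τ := by
  refine isFreeMotion_of_hasDerivWithinAt (fun t ht => ?_) (by simpa using hq) (by simpa using hξ)
  exact hasDerivWithinAt_rescale_div hτ
    (hp (t / τ) ⟨div_nonneg ht.1 hτ.le, div_le_one_of_le₀ ht.2 hτ.le⟩)

theorem IsFreeMotion.kin_eq {B : Fin 2 → RigidBody n} {c : ℝ → State n} {τ : ℝ}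
    (h : IsFreeMotion B c τ) {t : ℝ} (ht : t ∈ Icc 0 τ) :
    kin B (c t).2 (c t).2 = kin B (c 0).2 (c 0).2 := by
  have key := eq_zero_of_hasDerivWithinAt_of_bound
    (f := fun s => kin B (c s).2 (c s).2 - kin B (c 0).2 (c 0).2) (f' := fun _ => 0) (K := 0)
    (a := 0) (b := τ) (fun s hs => ?_) (sub_self _) (by simp)
  · exact sub_eq_zero.1 (key t ht)
  · have h1 : HasDerivWithinAt (fun s => (c s).2) (euler B (c s).2 (c s).2) (Icc 0 τ) s :=
      (h.hasDerivWithinAt hs).snd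
    refine ((hasDerivWithinAt_kin B h1 h1).sub_const _).congr_deriv ?_
    rw [kin_comm B (c s).2 (euler B _ _), kin_euler B _ _ (h s hs).2.1, bracket_self,
      kin_zero_right, add_zero]

theorem IsDefiningOn.deriv_ne_zero {B : Fin 2 → RigidBody n} {f : Conf n → ℝ} {U : Set (Conf n)}
    (h : IsDefiningOn B f U) {x : State n} (hU : x.1 ∈ U) (hx : x.1 ∈ bdry B)
    (hξ : x.2 ∈ lieAlg n) (ht : x.2 ∉ bdryTangent B x.1) :
    fderiv ℝ f x.1 (translate x.1 x.2) ≠ 0 := fun h0 =>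
  ht ((h.mem_bdryTangent_iff hU hx).2 ⟨hξ, h0⟩)

theorem continuous_translate : Continuous fun x : State n => translate x.1 x.2 := by
  have h : Continuous fun x : State n =>
      (LinearMap.toContinuousBilinearMap translateBilin) x.1 x.2 := by
    fun_prop
  exact h

/-- Near an endpoint of the motion the bodies are disjoint. -/
theorem IsDefiningOn.eventually_mem_interiorConf {B : Fin 2 → RigidBody n} {f : Conf n → ℝ}
    {U : Set (Conf n)} (h : IsDefiningOn B f U) {l : Filter (State n)} {x₀ : State n}
    (hl : pure x₀ ≤ l) (hl' : l ≤ 𝓝 x₀) {a : ℝ} (ha : a = 0 ∨ a = 1) {T : State n → ℝ}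
    {F : State n × ℝ → State n} (hT : ContinuousAt T x₀) (hT0 : 0 < T x₀)
    (hF : ContinuousAt F (x₀, a)) (hU : (F (x₀, a)).1 ∈ U)
    (hd : fderiv ℝ f (F (x₀, a)).1 (translate (F (x₀, a)).1 (F (x₀, a)).2) ≠ 0)
    (hgood : ∀ᶠ x in l, (∀ s ∈ Icc (0 : ℝ) 1, (F (x, s)).1 ∈ SE2 n) ∧
      ∀ s ∈ Icc (0 : ℝ) 1, HasDerivWithinAt (fun s => F (x, s))
        (T x • freeField B (F (x, s)) (F (x, s))) (Icc 0 1) s)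
    (hend : ∀ᶠ x in l, (F (x, a)).1 ∈ bdry B)
    (hpos : ∀ s ∈ Ioo (0 : ℝ) 1, (F (x₀, s)).1 ∈ interiorConf B) :
    ∀ᶠ p : State n × ℝ in l ×ˢ 𝓝[Icc 0 1] a, p.2 ∈ Ioo (0 : ℝ) 1 → (F p).1 ∈ interiorConf B := by
  have haI : a ∈ Icc (0 : ℝ) 1 := by rcases ha with rfl | rfl <;> simp
  have hle : l ×ˢ 𝓝[Icc 0 1] a ≤ 𝓝 (x₀, a) := by
    rw [nhds_prod_eq]
    exact prod_mono hl' nhdsWithin_le_nhds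
  have hF1 : ContinuousAt (fun p => (F p).1) (x₀, a) := continuousAt_fst.comp hF
  have hU' : ∀ᶠ p in 𝓝 (x₀, a), (F p).1 ∈ U := hF1 (h.isOpen.mem_nhds hU)
  have hI : ∀ᶠ p : State n × ℝ in l ×ˢ 𝓝[Icc 0 1] a, p.2 ∈ Icc (0 : ℝ) 1 :=
    tendsto_snd.eventually self_mem_nhdsWithin
  have hgood' : ∀ᶠ p : State n × ℝ in l ×ˢ 𝓝[Icc 0 1] a, _ := tendsto_fst.eventually hgood
  have hcurve : Tendsto (fun x : State n => (x, a)) l (𝓝 (x₀, a)) :=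
    (Continuous.prodMk_left a).continuousAt.tendsto.mono_left hl'
  have hcurve' : Tendsto (fun s : ℝ => (x₀, s)) (𝓝[Icc 0 1] a) (𝓝 (x₀, a)) :=
    (Continuous.prodMk_right x₀).continuousAt.tendsto.mono_left nhdsWithin_le_nhds
  have key := eventually_pos_of_deriv_ne_zero (l := l) (x₀ := x₀) hl ha
    (φ := fun x s => f (F (x, s)).1)
    (φ' := fun x s => T x * fderiv ℝ f (F (x, s)).1 (translate (F (x, s)).1 (F (x, s)).2))
    (mul_ne_zero hT0.ne' hd) ?_ ?_ ?_ ?_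
  · filter_upwards [key, hle hU', hI, hgood'] with p hp hpU hpI hpg hps
    exact (h.mem_interiorConf_iff _ hpU (hpg.1 _ hpI)).2 (hp hps)
  · filter_upwards [hle hU', hI, hgood'] with p hpU hpI hpg
    have h1 : HasDerivWithinAt (fun s => (F (p.1, s)).1)
      (T p.1 • translate (F (p.1, p.2)).1 (F (p.1, p.2)).2) (Icc 0 1) p.2 := (hpg.2 p.2 hpI).fst
    have h2 := (h.hasFDerivAt hpU).comp_hasDerivWithinAt p.2 h1
    rwa [map_smul, smul_eq_mul] at h2
  · have h1 : ContinuousAt (fun p => fderiv ℝ f (F p).1) (x₀, a) :=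
      ContinuousAt.comp (f := fun p => (F p).1) (g := fderiv ℝ f)
        (h.continuousOn_fderiv.continuousAt (h.isOpen.mem_nhds hU)) hF1
    have h2 : ContinuousAt (fun p => translate (F p).1 (F p).2) (x₀, a) :=
      ContinuousAt.comp (f := F) (g := fun x : State n => translate x.1 x.2)
        continuous_translate.continuousAt hF
    have h3 : ContinuousAt (fun p : State n × ℝ => T p.1) (x₀, a) :=
      ContinuousAt.comp (f := Prod.fst) (g := T) hT continuousAt_fst
    exact (h3.mul (h1.clm_apply h2)).tendsto.mono_left hle
  · filter_upwards [hcurve hU', hend] with x hxU hxb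
    exact (h.mem_bdry_iff _ hxU (bdry_subset B hxb)).1 hxb
  · filter_upwards [hcurve' hU'] with s hsU hs
    exact (h.mem_interiorConf_iff _ hsU (hpos s hs).1).1 (hpos s hs)

/-- Near a state with a transversal next collision, the next collision exists and depends
differentiably on the state, and the derivative preserves the symplectic form. -/
theorem IsNextCollision.exists_hasFDerivAt {B : Fin 2 → RigidBody n} (hsmooth : HasSmoothBdry B)
    (hcontact : HasUniqueContact B) {𝓔 : ℝ} {x₀ y₀ : State n} (hx : x₀ ∈ phaseSpace B 𝓔)
    (hxy : IsNextCollision B x₀ y₀) (hy : y₀.2 ∉ bdryTangent B y₀.1) :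
    ∃ (Φ : State n → State n) (Φ' : State n →L[ℝ] State n), HasFDerivAt Φ Φ' x₀ ∧ Φ x₀ = y₀ ∧
      (∀ᶠ x in 𝓝[phaseSpace B 𝓔] x₀, IsNextCollision B x (Φ x)) ∧
      (∀ X, untranslate x₀.1 X.1 ∈ lieAlg n → X.2 ∈ lieAlg n → kin B x₀.2 X.2 = 0 →
        untranslate y₀.1 (Φ' X).1 ∈ bdryTangent B y₀.1 ∧ (Φ' X).2 ∈ lieAlg n ∧
          kin B y₀.2 (Φ' X).2 = 0) ∧
      ∀ X Y, untranslate x₀.1 X.1 ∈ lieAlg n → X.2 ∈ lieAlg n → kin B x₀.2 X.2 = 0 →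
        untranslate x₀.1 Y.1 ∈ lieAlg n → Y.2 ∈ lieAlg n → kin B x₀.2 Y.2 = 0 →
        symplecticForm B y₀ (Φ' X) (Φ' Y) = symplecticForm B x₀ X Y := by
  obtain ⟨τ, hτ, c, hc, hc0, hcτ, hint, hyb⟩ := hxy
  let γ : ℝ → State n := fun s => c (τ * s)
  have hmul : ∀ s ∈ Icc (0 : ℝ) 1, τ * s ∈ Icc 0 τ := fun s hs =>
    ⟨mul_nonneg hτ.le hs.1, mul_le_of_le_one_right hτ.le hs.2⟩
  have hγ : ∀ s ∈ Icc (0 : ℝ) 1, HasDerivWithinAt γ (τ • freeField B (γ s) (γ s)) (Icc 0 1) s :=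
    fun s hs => hasDerivWithinAt_rescale hτ (hc.hasDerivWithinAt (hmul s hs))
  have hγ0 : γ 0 = x₀ := by simp only [γ, mul_zero, hc0]
  have hγ1 : γ 1 = y₀ := by simp only [γ, mul_one, hcτ]
  have hγq : ∀ s ∈ Icc (0 : ℝ) 1, (γ s).1 ∈ SE2 n := fun s hs => (hc _ (hmul s hs)).1
  have hγξ : ∀ s ∈ Icc (0 : ℝ) 1, (γ s).2 ∈ lieAlg n := fun s hs => (hc _ (hmul s hs)).2.1
  have hγi : ∀ s ∈ Ioo (0 : ℝ) 1, (γ s).1 ∈ interiorConf B := fun s hs =>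
    hint _ ⟨mul_pos hτ hs.1, mul_lt_of_lt_one_right hτ hs.2⟩
  have h1mem : (1 : ℝ) ∈ Icc (0 : ℝ) 1 := by simp
  have h0mem : (0 : ℝ) ∈ Icc (0 : ℝ) 1 := by simp
  obtain ⟨f₁, U₁, hU₁, hf₁⟩ := exists_isDefiningOn hsmooth hcontact hx.1
  obtain ⟨f₂, U₂, hU₂, hf₂⟩ := exists_isDefiningOn hsmooth hcontact hyb
  have hd₁ := hf₁.deriv_ne_zero hU₁ hx.1 hx.2.1 hx.2.2.2
  have hyξ : y₀.2 ∈ lieAlg n := hγ1 ▸ hγξ 1 h1mem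
  have hyq : y₀.1 ∈ SE2 n := bdry_subset B hyb
  have hd₂ := hf₂.deriv_ne_zero hU₂ hyb hyξ hy
  have hg : HasStrictFDerivAt (fun x : State n => f₂ x.1)
      (fderiv ℝ f₂ y₀.1 ∘L ContinuousLinearMap.fst ℝ (Conf n) (Conf n)) (γ 1) := by
    rw [hγ1]
    have h1 : HasStrictFDerivAt f₂ (fderiv ℝ f₂ y₀.1) y₀.1 :=
      (hf₂.contDiffOn.contDiffAt (hf₂.isOpen.mem_nhds hU₂)).hasStrictFDerivAt (by simp)
    exact HasStrictFDerivAt.comp (g := f₂) y₀ h1 hasStrictFDerivAt_fst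
  -- The target of the flow is the zero set of a defining function of S near the contact;
  -- non-tangency of the velocity is the required transversality.
  obtain ⟨T, ρ, Φ', hT, hT0, hρ, hργ, hev, hΦ, hvar⟩ := exists_hitting (freeField B) τ γ hγ hg
    (by rw [hγ1]; exact (hf₂.mem_bdry_iff _ hU₂ hyq).1 hyb) (by rw [hγ1]; exact hd₂)
  rw [hγ0] at hT hT0 hρ hργ hev hΦ
  let F : State n × ℝ → State n := fun p => extendPath (ρ p.1) p.2
  have hF : ∀ s, ContinuousAt F (x₀, s) := continuousAt_extendPath hρ
  have hF0 : F (x₀, 0) = x₀ := (hργ 0 h0mem).trans hγ0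
  have hF1 : F (x₀, 1) = y₀ := (hργ 1 h1mem).trans hγ1
  have hΦ0 : extendPath (ρ x₀) 1 = y₀ := hF1
  have hTpos : ∀ᶠ x in 𝓝 x₀, 0 < T x := hT.eventually_const_lt (by rw [hT0]; exact hτ)
  let l := 𝓝[phaseSpace B 𝓔] x₀
  have hmotion : ∀ᶠ x in l, 0 < T x ∧ IsFreeMotion B (fun t => F (x, t / T x)) (T x) := by
    filter_upwards [nhdsWithin_le_nhds hTpos, nhdsWithin_le_nhds hev, self_mem_nhdsWithin]
      with x hxT hxe hxp
    have h1 : F (x, 0) = x := hxe.1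
    exact ⟨hxT, isFreeMotion_rescale (p := fun s => F (x, s)) hxT hxe.2.2
      (by rw [h1]; exact bdry_subset B hxp.1) (by rw [h1]; exact hxp.2.1)⟩
  have hgood : ∀ᶠ x in l, (∀ s ∈ Icc (0 : ℝ) 1, (F (x, s)).1 ∈ SE2 n) ∧
      ∀ s ∈ Icc (0 : ℝ) 1, HasDerivWithinAt (fun s => F (x, s))
        (T x • freeField B (F (x, s)) (F (x, s))) (Icc 0 1) s := by
    filter_upwards [hmotion, nhdsWithin_le_nhds hev] with x hxm hxe
    refine ⟨fun s hs => ?_, hxe.2.2⟩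
    have h1 := (hxm.2 (T x * s) ⟨mul_nonneg hxm.1.le hs.1, mul_le_of_le_one_right hxm.1.le hs.2⟩).1
    simpa only [mul_div_cancel_left₀ s hxm.1.ne'] using h1
  have hstart : ∀ᶠ x in l, (F (x, 0)).1 ∈ bdry B := by
    filter_upwards [nhdsWithin_le_nhds hev, self_mem_nhdsWithin] with x hxe hxp
    have h1 : F (x, 0) = x := hxe.1
    rw [h1]
    exact hxp.1
  have hcurve : Tendsto (fun x : State n => (x, (1 : ℝ))) l (𝓝 (x₀, 1)) :=
    (Continuous.prodMk_left (1 : ℝ)).continuousAt.tendsto.mono_left nhdsWithin_le_nhds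
  have hend : ∀ᶠ x in l, (F (x, 1)).1 ∈ bdry B := by
    have hU : ∀ᶠ p in 𝓝 (x₀, (1 : ℝ)), (F p).1 ∈ U₂ :=
      (continuousAt_fst.comp (hF 1)) (hf₂.isOpen.mem_nhds (by rwa [Function.comp_apply, hF1]))
    filter_upwards [hcurve hU, hgood, nhdsWithin_le_nhds hev] with x hxU hxg hxe
    exact (hf₂.mem_bdry_iff _ hxU (hxg.1 1 h1mem)).2 hxe.2.1
  have hFi : ∀ s ∈ Ioo (0 : ℝ) 1, (F (x₀, s)).1 ∈ interiorConf B := fun s hs => by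
    have : F (x₀, s) = γ s := hργ s (Ioo_subset_Icc_self hs)
    rw [this]
    exact hγi s hs
  have hpure : pure x₀ ≤ l := pure_le_nhdsWithin hx
  -- At the endpoints the motion lies on S, and the sign of the defining function decides; at
  -- interior times M₀ is a relative neighbourhood.
  have hlocal : ∀ s ∈ Icc (0 : ℝ) 1, ∀ᶠ p : State n × ℝ in l ×ˢ 𝓝[Icc 0 1] s,
      p.2 ∈ Ioo (0 : ℝ) 1 → (F p).1 ∈ interiorConf B := by
    intro s hs
    rcases eq_endpoints_or_mem_Ioo_of_mem_Icc hs with rfl | rfl | hsI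
    · exact hf₁.eventually_mem_interiorConf hpure nhdsWithin_le_nhds (Or.inl rfl) hT
        (by rwa [hT0]) (hF 0) (by rwa [hF0]) (by rwa [hF0]) hgood hstart hFi
    · exact hf₂.eventually_mem_interiorConf hpure nhdsWithin_le_nhds (Or.inr rfl) hT
        (by rwa [hT0]) (hF 1) (by rwa [hF1]) (by rwa [hF1]) hgood hend hFi
    · have h1 := interiorConf_mem_nhdsWithin hcontact (hFi s hsI)
      have h2 : Tendsto (fun p => (F p).1) (l ×ˢ 𝓝[Icc 0 1] s) (𝓝[SE2 n] (F (x₀, s)).1) := by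
        refine tendsto_nhdsWithin_iff.2 ⟨?_, ?_⟩
        · refine (continuousAt_fst.comp (hF s)).tendsto.mono_left ?_
          rw [nhds_prod_eq]
          exact prod_mono nhdsWithin_le_nhds nhdsWithin_le_nhds
        · filter_upwards [tendsto_fst.eventually hgood, tendsto_snd.eventually self_mem_nhdsWithin]
            with p hp hpI
          exact hp.1 p.2 hpI
      filter_upwards [h2 h1] with p hp _ using hp
  have hinterior : ∀ᶠ x in l, ∀ s ∈ Icc (0 : ℝ) 1, s ∈ Ioo (0 : ℝ) 1 →
      (F (x, s)).1 ∈ interiorConf B := by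
    have h1 : ∀ᶠ x in 𝓝 x₀, ∀ s ∈ Icc (0 : ℝ) 1, x ∈ phaseSpace B 𝓔 → s ∈ Ioo (0 : ℝ) 1 →
        (F (x, s)).1 ∈ interiorConf B := by
      -- Compactness of the time interval yields one neighbourhood of initial states for all times.
      refine isCompact_Icc.eventually_forall_of_forall_eventually fun s hs => ?_
      have h2 := hlocal s hs
      rw [← nhdsWithin_prod_eq, eventually_nhdsWithin_iff] at h2
      filter_upwards [h2] with p hp hpx hps
      exact hp ⟨hpx, Ioo_subset_Icc_self hps⟩ hps
    filter_upwards [nhdsWithin_le_nhds h1, self_mem_nhdsWithin] with x hx' hxp s hs hsI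
    exact hx' s hs hxp hsI
  have hvar' : ∀ X, ∃ (δ : ℝ) (h : ℝ → State n), h 0 = X ∧ h 1 = Φ' X ∧ IsVariation B τ δ γ h :=
    fun X => (hvar X).2
  refine ⟨fun x => extendPath (ρ x) 1, Φ', hΦ, hΦ0, ?_, ?_, ?_⟩
  · filter_upwards [hmotion, hinterior, hend, nhdsWithin_le_nhds hev] with x hxm hxi hxe hx0
    refine ⟨T x, hxm.1, fun t => F (x, t / T x), hxm.2, ?_, ?_, fun t ht => ?_, hxe⟩
    · simp only [zero_div]
      exact hx0.1
    · simp only [div_self hxm.1.ne']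
      rfl
    · have h1 : t / T x ∈ Ioo (0 : ℝ) 1 := ⟨div_pos ht.1 hxm.1, (div_lt_one hxm.1).2 ht.2⟩
      exact hxi _ (Ioo_subset_Icc_self h1) h1
  · intro X hX1 hX2 hX3
    obtain ⟨δ, h, hh0, hh1, hh⟩ := hvar' X
    rw [← hh0] at hX1 hX2 hX3
    rw [← hγ0] at hX1 hX3
    have h1 := hh.untranslate_mem hγ hγq hγξ hX2 hX1 1 h1mem
    have h2 := hh.snd_mem hX2 1 h1mem
    have h3 := hh.kin_eq hγ hγξ hX2 hX3 1 h1mem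
    rw [hh1] at h1 h2 h3
    rw [hγ1] at h1 h3
    refine ⟨(hf₂.mem_bdryTangent_iff hU₂ hyb).2 ⟨h1, ?_⟩, h2, h3⟩
    rw [translate_untranslate hyq]
    exact (hvar X).1
  · intro X Y hX1 hX2 hX3 hY1 hY2 hY3
    obtain ⟨δ, h, hh0, hh1, hh⟩ := hvar' X
    obtain ⟨δ', h', hh0', hh1', hh'⟩ := hvar' Y
    rw [← hh1, ← hh1', ← hγ1]
    subst hh0 hh0'
    rw [← hγ0] at hX1 hX3 hY1 hY3 ⊢
    exact hh.symplecticForm_eq hγ hγq hγξ hh' hX2 hY2 hX1 hY1 hX3 hY3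

end

end RoughBilliards

namespace RoughBilliards

noncomputable section

open Module

variable {n : ℕ}

attribute [local instance] isTopologicalAddGroup_pt moduleStateCLM

/-! ### Orthogonal complements and determinants of collision maps -/

/-- The orthogonal complement of `ν` in the Lie algebra. -/
def orth (B : Fin 2 → RigidBody n) (ν : Conf n) : Submodule ℝ (Conf n) :=
  lieAlg n ⊓ LinearMap.ker (kinBilin B ν)

theorem mem_orth {B : Fin 2 → RigidBody n} {ν ξ : Conf n} :
    ξ ∈ orth B ν ↔ ξ ∈ lieAlg n ∧ kin B ν ξ = 0 := Iff.rfl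

/-- The decomposition of the Lie algebra into multiples of `ν` and the orthogonal complement. -/
theorem exists_orthEquiv (B : Fin 2 → RigidBody n) {ν : Conf n} (hν : ν ∈ lieAlg n) (h0 : ν ≠ 0) :
    ∃ e : (orth B ν × ℝ) ≃ₗ[ℝ] lieAlg n, ∀ ξ s, (e (ξ, s) : Conf n) = ξ + s • ν := by
  have hpos := kin_pos B hν h0
  let L : (orth B ν × ℝ) →ₗ[ℝ] lieAlg n :=
    (Submodule.inclusion inf_le_left).coprod (LinearMap.toSpanSingleton ℝ (lieAlg n) ⟨ν, hν⟩)
  have hL : ∀ ξ s, (L (ξ, s) : Conf n) = ξ + s • ν := fun ξ s => rfl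
  have hbij : Function.Bijective L := by
    constructor
    · rw [injective_iff_map_eq_zero]
      rintro ⟨ξ, s⟩ h
      have h1 : (ξ : Conf n) + s • ν = 0 := by rw [← hL, h]; rfl
      have h2 : s * kin B ν ν = 0 := by
        have h3 := congrArg (kin B ν) h1
        rwa [kin_add_right, (mem_orth.1 ξ.2).2, kin_smul_right, kin_zero_right, zero_add] at h3
      have hs : s = 0 := (mul_eq_zero.1 h2).resolve_right hpos.ne'
      subst hs
      rw [zero_smul, add_zero] at h1
      exact Prod.ext (Subtype.ext h1) rfl
    · rintro ⟨ξ, hξ⟩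
      let s := kin B ν ξ / kin B ν ν
      have hm : ξ - s • ν ∈ orth B ν := by
        refine mem_orth.2 ⟨(lieAlg n).sub_mem hξ ((lieAlg n).smul_mem s hν), ?_⟩
        rw [kin_sub_right, kin_smul_right, div_mul_cancel₀ _ hpos.ne', sub_self]
      refine ⟨(⟨_, hm⟩, s), Subtype.ext ?_⟩
      rw [hL]
      simp
  exact ⟨LinearEquiv.ofBijective L hbij, hL⟩

theorem finrank_orth (B : Fin 2 → RigidBody n) {ν : Conf n} (hν : ν ∈ lieAlg n) (h0 : ν ≠ 0) :
    finrank ℝ (orth B ν) = dimConf n - 1 := by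
  obtain ⟨e, -⟩ := exists_orthEquiv B hν h0
  have h := e.finrank_eq
  rw [finrank_prod, finrank_self, finrank_lieAlg] at h
  omega

theorem exists_lieAlgProj (n : ℕ) : ∃ P : Conf n →ₗ[ℝ] lieAlg n, ∀ ξ : lieAlg n, P ξ = ξ := by
  obtain ⟨P, hP⟩ := (lieAlg n).subtype.exists_leftInverse_of_injective
    (LinearMap.ker_eq_bot.2 (lieAlg n).injective_subtype)
  exact ⟨P, fun ξ => LinearMap.congr_fun hP ξ⟩

/-- A linear projection onto the Lie algebra. -/
def lieAlgProj (n : ℕ) : Conf n →ₗ[ℝ] lieAlg n := (exists_lieAlgProj n).choose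

theorem lieAlgProj_apply (ξ : lieAlg n) : lieAlgProj n ξ = ξ := (exists_lieAlgProj n).choose_spec ξ

/-- The determinant of the compression of a linear map to the Lie algebra. -/
def lieAlgDet (C : Conf n →ₗ[ℝ] Conf n) : ℝ :=
  LinearMap.det (lieAlgProj n ∘ₗ C ∘ₗ (lieAlg n).subtype)

/-- An isometry that is its own inverse is self-adjoint. -/
theorem IsStrictCollisionMap.kin_map {B : Fin 2 → RigidBody n} {q : Conf n}
    {C : Conf n →ₗ[ℝ] Conf n} (hC : IsStrictCollisionMap B q C) {u v : Conf n} (hu : u ∈ lieAlg n)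
    (hv : v ∈ lieAlg n) : kin B (C u) v = kin B u (C v) := by
  have h := hC.conserves_energy (C v) (hC.mapsTo v hv) u hu
  rwa [hC.involutive v hv] at h

theorem IsStrictCollisionMap.sq_lieAlgDet {B : Fin 2 → RigidBody n} {q : Conf n}
    {C : Conf n →ₗ[ℝ] Conf n} (hC : IsStrictCollisionMap B q C) : lieAlgDet C ^ 2 = 1 := by
  have h : ∀ ξ : lieAlg n, (lieAlgProj n (C ξ) : Conf n) = C ξ := fun ξ =>
    congrArg Subtype.val (lieAlgProj_apply ⟨C ξ, hC.mapsTo ξ ξ.2⟩)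
  rw [sq, lieAlgDet, ← LinearMap.det_comp, ← LinearMap.det_id (M := lieAlg n) (A := ℝ)]
  congr 1
  refine LinearMap.ext fun ξ => Subtype.ext ?_
  change (lieAlgProj n (C (lieAlgProj n (C ξ) : Conf n)) : Conf n) = ξ
  rw [h, h, hC.involutive ξ ξ.2]

theorem IsStrictCollisionMap.map_mem_orth {B : Fin 2 → RigidBody n} {q : Conf n}
    {C : Conf n →ₗ[ℝ] Conf n} (hC : IsStrictCollisionMap B q C) {ν : Conf n} (hν : ν ∈ lieAlg n)
    (hCν : C ν = -ν) : ∀ ξ ∈ orth B ν, C ξ ∈ orth B ν := by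
  intro ξ hξ
  refine mem_orth.2 ⟨hC.mapsTo ξ hξ.1, ?_⟩
  rw [← hC.kin_map hν hξ.1, hCν, kin_neg_left, (mem_orth.1 hξ).2, neg_zero]

/-- The Lie algebra is the sum of the invariant subspace ν^⊥ and the line through ν, which
contributes the factor -1. -/
theorem IsStrictCollisionMap.det_restrict {B : Fin 2 → RigidBody n} {q : Conf n}
    {C : Conf n →ₗ[ℝ] Conf n} (hC : IsStrictCollisionMap B q C) {ν : Conf n} (hν : ν ∈ lieAlg n)
    (h0 : ν ≠ 0) (hCν : C ν = -ν) :
    LinearMap.det (C.restrict (hC.map_mem_orth hν hCν)) = -lieAlgDet C := by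
  obtain ⟨e, he⟩ := exists_orthEquiv B hν h0
  let R := C.restrict (hC.map_mem_orth hν hCν)
  have hconj : (lieAlgProj n ∘ₗ C ∘ₗ (lieAlg n).subtype) =
      (e : (orth B ν × ℝ) →ₗ[ℝ] lieAlg n) ∘ₗ (R.prodMap (-LinearMap.id : ℝ →ₗ[ℝ] ℝ)) ∘ₗ
        (e.symm : lieAlg n →ₗ[ℝ] (orth B ν × ℝ)) := by
    refine LinearMap.ext fun ξ => Subtype.ext ?_
    obtain ⟨⟨ζ, s⟩, rfl⟩ := e.surjective ξ
    have h1 : (lieAlgProj n (C (e (ζ, s))) : Conf n) = C (e (ζ, s)) :=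
      congrArg Subtype.val (lieAlgProj_apply ⟨C (e (ζ, s)), hC.mapsTo _ (e (ζ, s)).2⟩)
    change (lieAlgProj n (C (e (ζ, s))) : Conf n) =
      (e ((R.prodMap (-LinearMap.id : ℝ →ₗ[ℝ] ℝ)) (e.symm (e (ζ, s)))) : Conf n)
    rw [h1, e.symm_apply_apply, LinearMap.prodMap_apply, he, he, map_add, map_smul, hCν]
    simp [R]
  have hneg : LinearMap.det (-LinearMap.id : ℝ →ₗ[ℝ] ℝ) = -1 := by simp
  rw [lieAlgDet, hconj, LinearMap.det_conj, LinearMap.det_prodMap, hneg]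
  ring

theorem continuousWithinAt_lieAlgDet {X : Type*} [TopologicalSpace X] {s : Set X} {x₀ : X}
    {C : X → Conf n →ₗ[ℝ] Conf n}
    (hC : ∀ ξ ∈ lieAlg n, ContinuousWithinAt (fun x => C x ξ) s x₀) :
    ContinuousWithinAt (fun x => lieAlgDet (C x)) s x₀ := by
  let b := Module.finBasis ℝ (lieAlg n)
  have h : ∀ x, lieAlgDet (C x) =
      (LinearMap.toMatrix b b (lieAlgProj n ∘ₗ C x ∘ₗ (lieAlg n).subtype)).det := fun x =>
    (LinearMap.det_toMatrix b _).symm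
  simp only [h]
  have hcont : ContinuousWithinAt
      (fun x => LinearMap.toMatrix b b (lieAlgProj n ∘ₗ C x ∘ₗ (lieAlg n).subtype)) s x₀ := by
    refine continuousWithinAt_pi.2 fun i => continuousWithinAt_pi.2 fun j => ?_
    simp only [LinearMap.toMatrix_apply]
    exact (LinearMap.continuous_of_finiteDimensional (b.coord i ∘ₗ lieAlgProj n)).continuousAt
      |>.comp_continuousWithinAt (hC (b j) (b j).2)
  exact (continuous_id.matrix_det).continuousAt.comp_continuousWithinAt hcont

/-! ### The effect of a collision on the top form -/

theorem wedgePower_congr {F G : Type*} {α : F → F → ℝ} {β : G → G → ℝ} {k : ℕ}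
    {X : Fin (2 * k) → F} {Y : Fin (2 * k) → G} (h : ∀ i j, α (X i) (X j) = β (Y i) (Y j)) :
    wedgePower α k X = wedgePower β k Y := by
  simp only [wedgePower, h]

/-- The symplectic form as a bilinear map. -/
def symplecticBilin (B : Fin 2 → RigidBody n) (x : State n) : State n →ₗ[ℝ] State n →ₗ[ℝ] ℝ :=
  let P : State n →ₗ[ℝ] State n →ₗ[ℝ] ℝ :=
    ContinuousLinearMap.coeLM ℝ ∘ₗ ((contactBilin B).flip x + contactBilin B x)
  P - P.flip

theorem symplecticBilin_apply (B : Fin 2 → RigidBody n) (x X Y : State n) :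
    symplecticBilin B x X Y = symplecticForm B x X Y := by
  rw [symplecticForm_apply]
  rfl

/-- A collision multiplies the top form by the determinant of the collision map on the tangent
space of `S`. -/
theorem wedgePower_collide {B : Fin 2 → RigidBody n} (hsmooth : HasSmoothBdry B)
    (hcontact : HasUniqueContact B) {y : State n} (hq : y.1 ∈ bdry B) (hy : y.2 ∈ lieAlg n)
    (hy0 : y.2 ≠ 0) {C : Conf n →ₗ[ℝ] Conf n} (hC : IsStrictCollisionMap B y.1 C)
    (Γ : Conf n →ₗ[ℝ] Conf n) {Y : Fin (2 * (dimConf n - 1)) → State n}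
    (hY : ∀ i, untranslate y.1 (Y i).1 ∈ bdryTangent B y.1 ∧ (Y i).2 ∈ lieAlg n ∧
      kin B y.2 (Y i).2 = 0) :
    wedgePower (symplecticForm B (y.1, C y.2)) (dimConf n - 1)
        (fun i => ((Y i).1, C (Y i).2 + Γ (Y i).1)) =
      -lieAlgDet C * wedgePower (symplecticForm B y) (dimConf n - 1) Y := by
  obtain ⟨ν, hν, hν1, hchar, hCν⟩ := exists_tangentSubmodule hsmooth hcontact hq hC
  have hν0 : ν ≠ 0 := by
    rintro rfl
    rw [kin_zero_left] at hν1
    exact zero_ne_one hν1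
  have hqS := bdry_subset B hq
  -- E consists of the position variations along S, F of the velocity variations of constant energy;
  -- each has codimension one in the Lie algebra.
  let E := orth B ν
  let F := orth B y.2
  let tE : (E × F) →ₗ[ℝ] Conf n := translateBilin y.1 ∘ₗ E.subtype ∘ₗ LinearMap.fst ℝ E F
  let pF : (E × F) →ₗ[ℝ] Conf n := F.subtype ∘ₗ LinearMap.snd ℝ E F
  let ι : (E × F) →ₗ[ℝ] State n := tE.prod pF
  -- This is the differential of the collision applied to `ι`. The term Γ, the derivative of C in
  -- the base point, acts on E alone and so affects only pairs from E.
  let ι' : (E × F) →ₗ[ℝ] State n := tE.prod (C ∘ₗ pF + Γ ∘ₗ tE)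
  let α := (symplecticBilin B y).compl₁₂ ι ι
  let α' := (symplecticBilin B (y.1, C y.2)).compl₁₂ ι' ι'
  have hu : ∀ z : E × F, untranslate y.1 (tE z) = z.1 := fun z => untranslate_translate hqS _
  have hα : ∀ z w : E × F, α z w = kin B z.2 w.1 - kin B w.2 z.1 -
      kin B y.2 (bracket (z.1 : Conf n) (w.1 : Conf n)) := by
    intro z w
    have h := symplecticForm_translate B (x := y) (X := ι z) (Y := ι w) hqS
      (by change untranslate y.1 (tE z) ∈ _; rw [hu]; exact z.1.2.1)
      (by change untranslate y.1 (tE w) ∈ _; rw [hu]; exact w.1.2.1)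
    change symplecticBilin B y (ι z) (ι w) = _
    rw [symplecticBilin_apply, h]
    change kin B z.2 (untranslate y.1 (tE w)) - kin B w.2 (untranslate y.1 (tE z)) -
      kin B y.2 (bracket (untranslate y.1 (tE z)) (untranslate y.1 (tE w))) = _
    rw [hu, hu]
  have hα' : ∀ z w : E × F, α' z w = kin B (C z.2 + Γ (tE z)) w.1 - kin B (C w.2 + Γ (tE w)) z.1 -
      kin B (C y.2) (bracket (z.1 : Conf n) (w.1 : Conf n)) := by
    intro z w
    have h := symplecticForm_translate B (x := (y.1, C y.2)) (X := ι' z) (Y := ι' w) hqS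
      (by change untranslate y.1 (tE z) ∈ _; rw [hu]; exact z.1.2.1)
      (by change untranslate y.1 (tE w) ∈ _; rw [hu]; exact w.1.2.1)
    change symplecticBilin B (y.1, C y.2) (ι' z) (ι' w) = _
    rw [symplecticBilin_apply, h]
    change kin B (C z.2 + Γ (tE z)) (untranslate y.1 (tE w)) -
      kin B (C w.2 + Γ (tE w)) (untranslate y.1 (tE z)) -
      kin B (C y.2) (bracket (untranslate y.1 (tE z)) (untranslate y.1 (tE w))) = _
    rw [hu, hu]
  let Z : Fin (2 * (dimConf n - 1)) → E × F := fun i =>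
    (⟨untranslate y.1 (Y i).1, mem_orth.2 ⟨((hchar _).1 (hY i).1).1, by
      rw [kin_comm]; exact ((hchar _).1 (hY i).1).2⟩⟩, ⟨(Y i).2, mem_orth.2 (hY i).2⟩)
  have htE : ∀ i, tE (Z i) = (Y i).1 := fun i => translate_untranslate hqS _
  have hι : ∀ i, ι (Z i) = Y i := fun i => Prod.ext (htE i) rfl
  have hι' : ∀ i, ι' (Z i) = ((Y i).1, C (Y i).2 + Γ (Y i).1) := fun i =>
    Prod.ext (htE i) (by change C (Y i).2 + Γ (tE (Z i)) = _; rw [htE])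
  have key := wedgePower_eq_det_mul (finrank_orth B hν hν0) (finrank_orth B hy hy0) α α'
    (C.restrict (hC.map_mem_orth hν hCν)) ?_ ?_ ?_ ?_ Z
  · rw [hC.det_restrict hν hν0 hCν] at key
    have h1 : wedgePower (fun a b => α a b) (dimConf n - 1) Z =
        wedgePower (symplecticForm B y) (dimConf n - 1) Y := by
      refine wedgePower_congr fun i j => ?_
      change symplecticBilin B y (ι (Z i)) (ι (Z j)) = _
      rw [symplecticBilin_apply, hι, hι]
    have h2 : wedgePower (fun a b => α' a b) (dimConf n - 1) Z =
        wedgePower (symplecticForm B (y.1, C y.2)) (dimConf n - 1)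
          (fun i => ((Y i).1, C (Y i).2 + Γ (Y i).1)) := by
      refine wedgePower_congr fun i j => ?_
      change symplecticBilin B (y.1, C y.2) (ι' (Z i)) (ι' (Z j)) = _
      rw [symplecticBilin_apply, hι', hι']
    rw [← h1, ← h2, key]
  · intro u v
    simp [hα, kin_zero_right]
  · intro u v
    simp [hα', kin_zero_right]
  -- The velocity C v is paired with the position u; self-adjointness moves C to u.
  · intro u v
    have h := hC.kin_map (u := v) (v := u) v.2.1 u.2.1
    simp [hα, hα', kin_zero_right, tE, h]
  · intro u v
    have h := hC.kin_map (u := v) (v := u) v.2.1 u.2.1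
    simp [hα, hα', kin_zero_right, tE, h]

end

end RoughBilliards

namespace RoughBilliards

noncomputable section

variable {n : ℕ}

attribute [local instance] isTopologicalAddGroup_pt moduleStateCLM

/-! ### Tangent vectors of the phase space -/

theorem mem_lieAlg_of_hasDerivAt {c : ℝ → Conf n} {X : Conf n} (hc : HasDerivAt c X 0)
    (hmem : ∀ᶠ t in 𝓝 0, c t ∈ lieAlg n) : X ∈ lieAlg n := by
  intro j
  have h1 : HasDerivWithinAt (fun t => (c t j).1) (X j).1 univ 0 :=
    (hasDerivWithinAt_pi.1 hc.hasDerivWithinAt j).fst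
  have h2 := ((hasDerivWithinAt_tr h1).add h1).hasDerivAt univ_mem
  have h3 : HasDerivAt ((fun t => tr (c t j).1) + fun t => (c t j).1) 0 0 := by
    refine (hasDerivAt_const (0 : ℝ) (0 : Mat n)).congr_of_eventuallyEq ?_
    filter_upwards [hmem] with t ht
    rw [Pi.add_apply, ht j, neg_add_cancel]
  exact eq_neg_of_add_eq_zero_left (h2.unique h3)

theorem untranslate_mem_of_hasDerivAt {c : ℝ → Conf n} {X : Conf n} (hc : HasDerivAt c X 0)
    (hmem : ∀ᶠ t in 𝓝 0, c t ∈ SE2 n) : untranslate (c 0) X ∈ lieAlg n := by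
  intro j
  have h1 : HasDerivWithinAt (fun t => (c t j).1) (X j).1 univ 0 :=
    (hasDerivWithinAt_pi.1 hc.hasDerivWithinAt j).fst
  have h2 := ((hasDerivWithinAt_tr h1).mul h1).hasDerivAt univ_mem
  have h3 : HasDerivAt ((fun t => tr (c t j).1) * fun t => (c t j).1) 0 0 := by
    refine (hasDerivAt_const (0 : ℝ) (1 : Mat n)).congr_of_eventuallyEq ?_
    filter_upwards [hmem] with t ht
    exact (ht j).1
  have h4 := h2.unique h3
  simp only [untranslate]
  rw [tr_mul, tr_tr]
  exact eq_neg_of_add_eq_zero_left h4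

theorem mem_of_mem_tangentVectors {B : Fin 2 → RigidBody n} {𝓔 : ℝ} {x X : State n}
    (hX : X ∈ tangentVectors (phaseSpace B 𝓔) x) :
    untranslate x.1 X.1 ∈ bdryTangent B x.1 ∧ X.2 ∈ lieAlg n ∧ kin B x.2 X.2 = 0 := by
  obtain ⟨c, hcd, rfl, hmem, hc⟩ := hX
  have hc1 : HasDerivAt (fun t => (c t).1) X.1 0 := hc.fst
  have hc2 : HasDerivAt (fun t => (c t).2) X.2 0 := hc.snd
  have hS : ∀ᶠ t in 𝓝 0, (c t).1 ∈ SE2 n := hmem.mono fun t ht => bdry_subset B ht.1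
  have h1 := untranslate_mem_of_hasDerivAt (c := fun t => (c t).1) hc1 hS
  refine ⟨⟨h1, ?_⟩, mem_lieAlg_of_hasDerivAt hc2 (hmem.mono fun t ht => ht.2.1), ?_⟩
  · rw [translate_untranslate hS.self_of_nhds]
    exact ⟨fun t => (c t).1, contDiffAt_fst.comp 0 hcd, rfl, hmem.mono fun t ht => ht.1, hc1⟩
  · have h2 := (hasDerivWithinAt_kin B (hc2.hasDerivWithinAt (s := univ))
      (hc2.hasDerivWithinAt (s := univ))).hasDerivAt univ_mem
    have h3 : HasDerivAt (fun t => kin B (c t).2 (c t).2) 0 0 := by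
      refine (hasDerivAt_const (0 : ℝ) (2 * 𝓔)).congr_of_eventuallyEq ?_
      filter_upwards [hmem] with t ht
      have := ht.2.2.1
      linarith
    have h4 := h2.unique h3
    rw [kin_comm B X.2] at h4
    linarith

/-- Where derivatives within a set are not unique, `fderivWithin` is a choice. On the velocity of a
curve in the set all choices agree by the chain rule. -/
theorem fderivWithin_apply_tangentVectors {E F : Type*} [NormedAddCommGroup E] [NormedSpace ℝ E]
    [NormedAddCommGroup F] [NormedSpace ℝ F] {f : E → F} {f' : E →L[ℝ] F} {s : Set E} {x X : E}
    (hf : HasFDerivWithinAt f f' s x) (hX : X ∈ tangentVectors s x) :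
    fderivWithin ℝ f s x X = f' X := by
  obtain ⟨c, -, rfl, hmem, hc⟩ := hX
  have key : ∀ g' : E →L[ℝ] F, HasFDerivWithinAt f g' s (c 0) →
      HasDerivAt (fun t => f (c t)) (g' X) 0 := by
    intro g' hg
    have h1 := hg.comp_hasDerivWithinAt (s := {t | c t ∈ s}) (f := c) (0 : ℝ) hc.hasDerivWithinAt
      (fun t ht => ht)
    exact h1.hasDerivAt hmem
  exact (key _ hf.differentiableWithinAt.hasFDerivWithinAt).unique (key _ hf)

/-! ### Differentiability of the collision -/

theorem mem_smoothLocus_of_eventually {B : Fin 2 → RigidBody n} {C : Conf n → Conf n →ₗ[ℝ] Conf n}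
    {q : Conf n} (hq : q ∈ smoothLocus B C) :
    ∀ᶠ p in 𝓝 q, p ∈ bdry B → p ∈ smoothLocus B C := by
  obtain ⟨-, U, hU, hC⟩ := hq
  filter_upwards [eventually_mem_nhds_iff.2 hU] with p hp hpb
  exact ⟨hpb, U, hp, hC⟩

theorem smoothLocus_differentiableWithinAt {B : Fin 2 → RigidBody n}
    {C : Conf n → Conf n →ₗ[ℝ] Conf n} {q : Conf n} (hq : q ∈ smoothLocus B C) {ξ : Conf n}
    (hξ : ξ ∈ lieAlg n) : DifferentiableWithinAt ℝ (fun p => C p ξ) (bdry B) q := by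
  obtain ⟨hqb, U, hU, hC⟩ := hq
  have h1 : DifferentiableWithinAt ℝ (fun p => C p ξ) (bdry B ∩ U) q :=
    (hC ξ hξ).differentiableOn (by simp) q ⟨hqb, mem_of_mem_nhds hU⟩
  exact (differentiableWithinAt_inter hU).1 h1

/-- Smoothness is given only for p ↦ C_p ξ with ξ fixed. Expanding ξ in coordinates makes the
collision a finite sum of products, and Γ collects the derivatives in the base point. -/
theorem exists_hasFDerivWithinAt_collide {B : Fin 2 → RigidBody n}
    {C : Conf n → Conf n →ₗ[ℝ] Conf n} {y : State n} (hq : y.1 ∈ smoothLocus B C)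
    (hξ : y.2 ∈ lieAlg n) :
    ∃ (L : State n →L[ℝ] State n) (Γ : Conf n →ₗ[ℝ] Conf n),
      HasFDerivWithinAt (collide C) L {z | z.1 ∈ bdry B ∧ z.2 ∈ lieAlg n} y ∧
      ∀ Y : State n, Y.2 ∈ lieAlg n → L Y = (Y.1, C y.1 Y.2 + Γ Y.1) := by
  obtain ⟨m, e, ℓ, he, hℓ⟩ := exists_lieAlg_coords n
  let W : Set (State n) := {z | z.1 ∈ bdry B ∧ z.2 ∈ lieAlg n}
  let ℓ' : Fin m → Conf n →L[ℝ] ℝ := fun k => LinearMap.toContinuousLinearMap (ℓ k)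
  have hC : ∀ p, ∀ ξ ∈ lieAlg n, C p ξ = ∑ k, ℓ' k ξ • C p (e k) := by
    intro p ξ hξ
    conv_lhs => rw [← hℓ ξ hξ]
    rw [map_sum]
    exact Finset.sum_congr rfl fun k _ => map_smul _ _ _
  let G : Fin m → Conf n →L[ℝ] Conf n := fun k => fderivWithin ℝ (fun p => C p (e k)) (bdry B) y.1
  have hterm : ∀ k, HasFDerivWithinAt (fun z : State n => ℓ' k z.2 • C z.1 (e k))
      (ℓ' k y.2 • (G k ∘L ContinuousLinearMap.fst ℝ (Conf n) (Conf n)) +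
        (ℓ' k ∘L ContinuousLinearMap.snd ℝ (Conf n) (Conf n)).smulRight (C y.1 (e k))) W y := by
    intro k
    have h1 : HasFDerivWithinAt (fun p => C p (e k)) (G k) (bdry B) y.1 :=
      (smoothLocus_differentiableWithinAt hq (he k)).hasFDerivWithinAt
    have h2 : HasFDerivWithinAt (fun z : State n => C z.1 (e k))
        (G k ∘L ContinuousLinearMap.fst ℝ (Conf n) (Conf n)) W y :=
      HasFDerivWithinAt.comp (g := fun p => C p (e k)) y h1
        hasFDerivAt_fst.hasFDerivWithinAt (fun z hz => hz.1)
    have h3 : HasFDerivWithinAt (fun z : State n => ℓ' k z.2)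
        (ℓ' k ∘L ContinuousLinearMap.snd ℝ (Conf n) (Conf n)) W y :=
      (ℓ' k ∘L ContinuousLinearMap.snd ℝ (Conf n) (Conf n)).hasFDerivWithinAt
    exact h3.smul h2
  have hsum := (HasFDerivWithinAt.fun_sum (u := Finset.univ) fun k _ => hterm k)
  have hpair := (ContinuousLinearMap.fst ℝ (Conf n) (Conf n)).hasFDerivWithinAt (s := W) (x := y)
    |>.prodMk hsum
  refine ⟨_, ∑ k, ℓ' k y.2 • (G k : Conf n →ₗ[ℝ] Conf n), hpair.congr ?_ ?_, ?_⟩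
  · intro z hz
    exact Prod.ext rfl (hC z.1 z.2 hz.2)
  · exact Prod.ext rfl (hC y.1 y.2 hξ)
  · intro Y hY
    refine Prod.ext rfl ?_
    rw [hC y.1 Y.2 hY]
    rw [LinearMap.sum_apply, ← Finset.sum_add_distrib]
    change (∑ k, (ℓ' k y.2 • (G k ∘L ContinuousLinearMap.fst ℝ (Conf n) (Conf n)) +
      (ℓ' k ∘L ContinuousLinearMap.snd ℝ (Conf n) (Conf n)).smulRight (C y.1 (e k)))) Y = _
    rw [sum_apply]
    exact Finset.sum_congr rfl fun k _ => add_comm _ _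

/-- Tangency is the vanishing of df on the velocity, which depends continuously on the state. -/
theorem eventually_not_mem_bdryTangent {B : Fin 2 → RigidBody n} (hsmooth : HasSmoothBdry B)
    (hcontact : HasUniqueContact B) {y : State n} (hq : y.1 ∈ bdry B) (hξ : y.2 ∈ lieAlg n)
    (hy : y.2 ∉ bdryTangent B y.1) :
    ∀ᶠ z in 𝓝 y, z.1 ∈ bdry B → z.2 ∉ bdryTangent B z.1 := by
  obtain ⟨f, U, hU, hf⟩ := exists_isDefiningOn hsmooth hcontact hq
  have hd := hf.deriv_ne_zero hU hq hξ hy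
  have h1 : ContinuousAt (fun z : State n => fderiv ℝ f z.1) y :=
    ContinuousAt.comp (f := Prod.fst) (g := fderiv ℝ f)
      (hf.continuousOn_fderiv.continuousAt (hf.isOpen.mem_nhds hU)) continuousAt_fst
  have h2 := h1.clm_apply (continuous_translate (n := n)).continuousAt
  have h3 : ∀ᶠ z : State n in 𝓝 y, z.1 ∈ U := continuousAt_fst (hf.isOpen.mem_nhds hU)
  filter_upwards [h2.eventually_ne hd, h3] with z hz hzU hzb hzt
  exact hz ((hf.mem_bdryTangent_iff hzU hzb).1 hzt).2

/-! ### The billiard map -/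

theorem mapsTo_billiardMap {B : Fin 2 → RigidBody n} (hcontact : HasUniqueContact B)
    (C : Conf n → Conf n →ₗ[ℝ] Conf n) (𝓔 : ℝ) :
    MapsTo (billiardMap B C) (billiardDomain B C 𝓔) (phaseSpace B 𝓔) := by
  rintro x ⟨-, y, hxy, -, hcy⟩
  rwa [hxy.billiardMap_eq hcontact C]

theorem IsStrictCollisionMap.mem_bdryTangent_iff {B : Fin 2 → RigidBody n}
    (hsmooth : HasSmoothBdry B)
    (hcontact : HasUniqueContact B) {C : Conf n → Conf n →ₗ[ℝ] Conf n}
    (hC : ∀ q ∈ bdry B, IsStrictCollisionMap B q (C q))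
    {q : Conf n} (hq : q ∈ bdry B) {ξ : Conf n}
    (hξ : ξ ∈ lieAlg n) : C q ξ ∈ bdryTangent B q ↔ ξ ∈ bdryTangent B q := by
  refine ⟨fun h => ?_, (hC q hq).mem_bdryTangent hsmooth hcontact hq⟩
  rw [← (hC q hq).involutive ξ hξ]
  exact (hC q hq).mem_bdryTangent hsmooth hcontact hq h

/-- The billiard map near a point of its domain: the next collision, followed by the collision
map. -/
theorem exists_hasFDerivWithinAt_billiardMap {B : Fin 2 → RigidBody n} (hsmooth : HasSmoothBdry B)
    (hcontact : HasUniqueContact B) {C : Conf n → Conf n →ₗ[ℝ] Conf n}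
    (hC : ∀ q ∈ bdry B, IsStrictCollisionMap B q (C q)) {𝓔 : ℝ}
    {x₀ : State n} (hx₀ : x₀ ∈ billiardDomain B C 𝓔) :
    billiardDomain B C 𝓔 ∈ 𝓝[phaseSpace B 𝓔] x₀ ∧
    ∃ (y : State n) (Φ' L : State n →L[ℝ] State n) (Γ : Conf n →ₗ[ℝ] Conf n),
      y.1 ∈ smoothLocus B C ∧ y.2 ∈ lieAlg n ∧ kin B y.2 y.2 = 2 * 𝓔 ∧
      billiardMap B C x₀ = (y.1, C y.1 y.2) ∧
      HasFDerivWithinAt (billiardMap B C) (L ∘L Φ') (phaseSpace B 𝓔) x₀ ∧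
      (∀ Y : State n, Y.2 ∈ lieAlg n → L Y = (Y.1, C y.1 Y.2 + Γ Y.1)) ∧
      (∀ X, untranslate x₀.1 X.1 ∈ lieAlg n → X.2 ∈ lieAlg n → kin B x₀.2 X.2 = 0 →
        untranslate y.1 (Φ' X).1 ∈ bdryTangent B y.1 ∧ (Φ' X).2 ∈ lieAlg n ∧
          kin B y.2 (Φ' X).2 = 0) ∧
      ∀ X Y, untranslate x₀.1 X.1 ∈ lieAlg n → X.2 ∈ lieAlg n → kin B x₀.2 X.2 = 0 →
        untranslate x₀.1 Y.1 ∈ lieAlg n → Y.2 ∈ lieAlg n → kin B x₀.2 Y.2 = 0 →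
        symplecticForm B y (Φ' X) (Φ' Y) = symplecticForm B x₀ X Y := by
  obtain ⟨hx₀p, y, hxy, hys, hcy⟩ := hx₀
  have hmotion : ∀ {x y : State n}, x ∈ phaseSpace B 𝓔 → IsNextCollision B x y →
      y.1 ∈ bdry B ∧ y.2 ∈ lieAlg n ∧ kin B y.2 y.2 = 2 * 𝓔 := by
    rintro x y hx ⟨τ, hτ, c, hc, hc0, rfl, -, hb⟩
    have hτI : τ ∈ Icc 0 τ := ⟨hτ.le, le_rfl⟩
    refine ⟨hb, (hc τ hτI).2.1, ?_⟩
    rw [hc.kin_eq hτI, hc0]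
    have := hx.2.2.1
    linarith
  obtain ⟨hyb, hyξ, hyE⟩ := hmotion hx₀p hxy
  -- Since C preserves the tangent space of S, a non-grazing outgoing velocity comes from a
  -- non-grazing incoming one.
  have hyt : y.2 ∉ bdryTangent B y.1 := fun h =>
    hcy.2.2.2 ((hC y.1 hyb).mem_bdryTangent hsmooth hcontact hyb h)
  obtain ⟨Φ, Φ', hΦ, hΦ0, hnext, hmap, hsymp⟩ := hxy.exists_hasFDerivAt hsmooth hcontact hx₀p hyt
  have hΦc : Tendsto Φ (𝓝[phaseSpace B 𝓔] x₀) (𝓝 y) := by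
    have := hΦ.continuousAt.tendsto
    rw [hΦ0] at this
    exact this.mono_left nhdsWithin_le_nhds
  have hΦc1 : Tendsto (fun x => (Φ x).1) (𝓝[phaseSpace B 𝓔] x₀) (𝓝 y.1) :=
    (continuous_fst.tendsto y).comp hΦc
  obtain ⟨L, Γ, hL, hLΓ⟩ := exists_hasFDerivWithinAt_collide hys hyξ
  refine ⟨?_, y, Φ', L, Γ, hys, hyξ, hyE, hxy.billiardMap_eq hcontact C, ?_, hLΓ, hmap, hsymp⟩
  · filter_upwards [hnext, self_mem_nhdsWithin, hΦc1 (mem_smoothLocus_of_eventually hys),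
      hΦc (eventually_not_mem_bdryTangent hsmooth hcontact hyb hyξ hyt)] with x hx hxp hxs hxt
    obtain ⟨h1, h2, h3⟩ := hmotion hxp hx
    refine ⟨hxp, Φ x, hx, hxs h1, h1, (hC _ h1).mapsTo _ h2, ?_, fun h =>
      hxt h1 ((IsStrictCollisionMap.mem_bdryTangent_iff hsmooth hcontact hC h1 h2).1 h)⟩
    change 1 / 2 * kin B (C (Φ x).1 (Φ x).2) (C (Φ x).1 (Φ x).2) = 𝓔
    rw [(hC _ h1).conserves_energy _ h2 _ h2, h3]
    ring
  -- On V the billiard map equals the collision after Φ; V is a relative neighbourhood, so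
  -- derivatives within it are derivatives within the phase space.
  · let V : Set (State n) := {x ∈ phaseSpace B 𝓔 | IsNextCollision B x (Φ x)}
    have hV : V ∈ 𝓝[phaseSpace B 𝓔] x₀ := inter_mem self_mem_nhdsWithin hnext
    rw [← hΦ0] at hL
    have h1 : HasFDerivWithinAt (fun x => collide C (Φ x)) (L ∘L Φ') V x₀ :=
      hL.comp x₀ hΦ.hasFDerivWithinAt fun x hx =>
        ⟨(hmotion hx.1 hx.2).1, (hmotion hx.1 hx.2).2.1⟩
    have h2 : HasFDerivWithinAt (billiardMap B C) (L ∘L Φ') V x₀ :=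
      h1.congr (fun x hx => hx.2.billiardMap_eq hcontact C) (by
        rw [hΦ0]
        exact hxy.billiardMap_eq hcontact C)
    exact h2.mono_of_mem_nhdsWithin hV

/-- The pull-back of the top form by the billiard map. -/
theorem topForm_billiardMap {B : Fin 2 → RigidBody n} (hsmooth : HasSmoothBdry B)
    (hcontact : HasUniqueContact B) {C : Conf n → Conf n →ₗ[ℝ] Conf n}
    (hC : ∀ q ∈ bdry B, IsStrictCollisionMap B q (C q)) {𝓔 : ℝ}
    (h𝓔 : 0 < 𝓔) {x : State n} (hx : x ∈ billiardDomain B C 𝓔)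
    {X : Fin (2 * (dimConf n - 1)) → State n}
    (hX : ∀ i, X i ∈ tangentVectors (phaseSpace B 𝓔) x) :
    topForm B (billiardMap B C x)
        (fun i => fderivWithin ℝ (billiardMap B C) (phaseSpace B 𝓔) x (X i)) =
      -lieAlgDet (C (billiardMap B C x).1) * topForm B x X := by
  obtain ⟨-, y, Φ', L, Γ, hys, hyξ, hyE, hbil, hder, hLΓ, hmap, hsymp⟩ :=
    exists_hasFDerivWithinAt_billiardMap hsmooth hcontact hC hx
  -- Positive energy excludes the zero velocity, for which v^⊥ would not have codimension one.
  have hy0 : y.2 ≠ 0 := by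
    intro h
    rw [h, kin_zero_right] at hyE
    linarith
  have hX' := fun i => mem_of_mem_tangentVectors (hX i)
  have hY := fun i => hmap (X i) (hX' i).1.1 (hX' i).2.1 (hX' i).2.2
  have h1 := wedgePower_collide hsmooth hcontact hys.1 hyξ hy0 (hC y.1 hys.1) Γ hY
  have h2 : ∀ i, fderivWithin ℝ (billiardMap B C) (phaseSpace B 𝓔) x (X i) =
      ((Φ' (X i)).1, C y.1 (Φ' (X i)).2 + Γ (Φ' (X i)).1) := by
    intro i
    rw [fderivWithin_apply_tangentVectors hder (hX i)]
    exact hLΓ _ (hY i).2.1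
  simp only [h2]
  rw [topForm, topForm, hbil]
  refine h1.trans ?_
  congr 1
  exact wedgePower_congr fun i j => hsymp _ _ (hX' i).1.1 (hX' i).2.1 (hX' i).2.2 (hX' j).1.1
    (hX' j).2.1 (hX' j).2.2

theorem continuousWithinAt_lieAlgDet_billiardMap {B : Fin 2 → RigidBody n}
    (hsmooth : HasSmoothBdry B)
    (hcontact : HasUniqueContact B) {C : Conf n → Conf n →ₗ[ℝ] Conf n}
    (hC : ∀ q ∈ bdry B, IsStrictCollisionMap B q (C q)) {𝓔 : ℝ}
    {x₀ : State n} (hx₀ : x₀ ∈ billiardDomain B C 𝓔) :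
    ContinuousWithinAt (fun x => lieAlgDet (C (billiardMap B C x).1))
      (billiardDomain B C 𝓔) x₀ := by
  obtain ⟨-, y, Φ', L, Γ, hys, hyξ, hyE, hbil, hder, -⟩ :=
    exists_hasFDerivWithinAt_billiardMap hsmooth hcontact hC hx₀
  have hcont : ContinuousWithinAt (fun x => (billiardMap B C x).1) (billiardDomain B C 𝓔) x₀ :=
    continuousAt_fst.comp_continuousWithinAt
      (hder.continuousWithinAt.mono fun x hx => hx.1)
  refine ContinuousWithinAt.comp (g := fun q => lieAlgDet (C q)) (t := bdry B) ?_ hcont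
    fun x hx => (mapsTo_billiardMap hcontact C 𝓔 hx).1
  rw [hbil]
  exact continuousWithinAt_lieAlgDet fun ξ hξ =>
    (smoothLocus_differentiableWithinAt hys hξ).continuousWithinAt

/-- The billiard map preserves the top form up to a locally constant sign. -/
theorem billiardMap_invariance {B : Fin 2 → RigidBody n} (hsmooth : HasSmoothBdry B)
    (hcontact : HasUniqueContact B) {C : Conf n → Conf n →ₗ[ℝ] Conf n}
    (hC : ∀ q ∈ bdry B, IsStrictCollisionMap B q (C q)) {𝓔 : ℝ}
    (h𝓔 : 0 < 𝓔) :
    (∀ x ∈ billiardDomain B C 𝓔, billiardDomain B C 𝓔 ∈ 𝓝[phaseSpace B 𝓔] x) ∧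
    MapsTo (billiardMap B C) (billiardDomain B C 𝓔) (phaseSpace B 𝓔) ∧
    DifferentiableOn ℝ (billiardMap B C) (billiardDomain B C 𝓔) ∧
    ∀ x₀ ∈ billiardDomain B C 𝓔, ∃ ε : ℝ, (ε = 1 ∨ ε = -1) ∧
      ∀ᶠ x in 𝓝[billiardDomain B C 𝓔] x₀,
        ∀ X : Fin (2 * (dimConf n - 1)) → State n,
          (∀ i, X i ∈ tangentVectors (phaseSpace B 𝓔) x) →
          topForm B (billiardMap B C x)
              (fun i => fderivWithin ℝ (billiardMap B C) (phaseSpace B 𝓔) x (X i)) =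
            ε * topForm B x X := by
  refine ⟨fun x hx => (exists_hasFDerivWithinAt_billiardMap hsmooth hcontact hC hx).1,
    mapsTo_billiardMap hcontact C 𝓔, fun x hx => ?_, fun x₀ hx₀ => ?_⟩
  · obtain ⟨-, y, Φ', L, Γ, -, -, -, -, hder, -⟩ :=
      exists_hasFDerivWithinAt_billiardMap hsmooth hcontact hC hx
    exact hder.differentiableWithinAt.mono fun z hz => hz.1
  · have hsign : ∀ x ∈ billiardDomain B C 𝓔, lieAlgDet (C (billiardMap B C x).1) = 1 ∨
        lieAlgDet (C (billiardMap B C x).1) = -1 := fun x hx =>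
      sq_eq_one_iff.1 (hC _ (mapsTo_billiardMap hcontact C 𝓔 hx).1).sq_lieAlgDet
    refine ⟨-lieAlgDet (C (billiardMap B C x₀).1), ?_, ?_⟩
    · rcases hsign x₀ hx₀ with h | h <;> simp [h]
    · have hcont := continuousWithinAt_lieAlgDet_billiardMap hsmooth hcontact hC hx₀
      have hnear := hcont.tendsto.eventually (Metric.ball_mem_nhds _ one_pos)
      filter_upwards [hnear, self_mem_nhdsWithin] with x hxn hx X hX
      rw [topForm_billiardMap hsmooth hcontact hC h𝓔 hx hX]
      congr 2
      -- Two values in {1, -1} at distance less than 1 are equal.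
      obtain ⟨h1, h2⟩ := abs_lt.1 (Real.dist_eq _ _ ▸ hxn)
      rcases hsign x hx with h | h <;> rcases hsign x₀ hx₀ with h' | h' <;> linarith

end

end RoughBilliards

theorem mainTheorem5 (n : ℕ) (hn : 1 ≤ n) (B : Fin 2 → RigidBody n)
    (hsmooth : HasSmoothBdry B) (hcontact : HasUniqueContact B)
    (C : Conf n → Conf n →ₗ[ℝ] Conf n)
    (hC : ∀ q ∈ bdry B, IsStrictCollisionMap B q (C q))
    (hpiecewise : IsPiecewiseSmooth B C)
    (hparallel : ∀ q ∈ smoothLocus B C, IsParallelAt B C q)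
    (𝓔 : ℝ) (h𝓔 : 0 < 𝓔) :
    -- the domain is open in `N^𝓔 ∖ TS` and is mapped differentiably into `N^𝓔 ∖ TS`
    (∀ x ∈ billiardDomain B C 𝓔, billiardDomain B C 𝓔 ∈ 𝓝[phaseSpace B 𝓔] x) ∧
    MapsTo (billiardMap B C) (billiardDomain B C 𝓔) (phaseSpace B 𝓔) ∧
    DifferentiableOn ℝ (billiardMap B C) (billiardDomain B C 𝓔) ∧
    -- the pull-back of `Ω` is `ε Ω`, with a locally constant sign `ε`
    ∀ x₀ ∈ billiardDomain B C 𝓔, ∃ ε : ℝ, (ε = 1 ∨ ε = -1) ∧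
      ∀ᶠ x in 𝓝[billiardDomain B C 𝓔] x₀,
        ∀ X : Fin (2 * (dimConf n - 1)) → State n,
          (∀ i, X i ∈ tangentVectors (phaseSpace B 𝓔) x) →
          topForm B (billiardMap B C x)
              (fun i => fderivWithin ℝ (billiardMap B C) (phaseSpace B 𝓔) x (X i)) =
            ε * topForm B x X := by
  exact billiardMap_invariance hsmooth hcontact hC h𝓔
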